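/- Let $k$ be a commutative ring containing $\mathbb{Q}$. An $L_\infty$-algebra $(L,\mu_*)$ over $k$ is a $\mathbb{Z}$-graded $k$-module $L$ with graded antisymmetric multilinear maps $\mu_n:\bigwedge^n L\to L$ of degree $2-n$, $n\ge 1$, such that the coderivation $Q$ of the graded symmetric coalgebra $S(L[1])$ determined by the maps $Q_n=(-1)^{n(n-1)/2}\downarrow\circ\,\mu_n\circ\uparrow^{\otimes n}$ satisfies $Q^2=0$, where $\downarrow:L\to L[1]$ is the canonical map of degree $-1$ and $\uparrow=\downarrow^{-1}$. An $L_\infty$-morphism $f:(L,\mu_*)\to(L',\mu'_*)$ is a sequence of graded antisymmetric maps $f_n:\bigwedge^nL\to L'$ of degree $1-n$, $n\ge 1$, such that the coalgebra morphism $F:S(L[1])\to S(L'[1])$ determined by $F_n=(-1)^{n(n-1)/2}\downarrow\circ f_n\circ\uparrow^{\otimes n}$ satisfies $F\circ Q=Q'\circ F$. It is an $L_\infty$-quasi-isomorphism if the map $f_1:(L,\mu_1)\to(L',\mu'_1)$ of complexes induces an isomorphism on homology. The complex $(L,\mu_1)$ is split if there is a $k$-linear map $\eta:L\to L$ of degree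 $-1$ with $\mu_1\eta\mu_1=\mu_1$. Let $(L,\mu_*)$ and $(L',\mu'_*)$ be $L_\infty$-algebras over $k$ such that $(L,\mu_1)$ and $(L',\mu'_1)$ are split. Then for each $L_\infty$-quasi-isomorphism $f:L\to L'$ there exists an $L_\infty$-morphism $g:L'\to L$ such that the maps induced by $f_1$ and $g_1$ on homology are inverse to each other. In particular, if $k$ is a field, then the relation "there is an $L_\infty$-quasi-isomorphism $L\to L'$" is an equivalence relation on $L_\infty$-algebras over $k$. -/

import Mathlib

universe u v w

noncomputable section

namespace LInfty

/-- The Koszul sign `ε(σ)` of a permutation of homogeneous elements `w 0, …, w (n-1)` of degrees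
`p 0, …, p (n-1)`: in the graded symmetric algebra,
`w (σ 0) ⊙ ⋯ ⊙ w (σ (n-1)) = ε(σ) w 0 ⊙ ⋯ ⊙ w (n-1)`.  Every inversion contributes
the sign for interchanging the two elements. -/
def koszulSign {n : ℕ} (p : Fin n → ℤ) (σ : Equiv.Perm (Fin n)) : ℤˣ :=
  ∏ i : Fin n, ∏ j : Fin n,
    if i < j ∧ σ j < σ i then Int.negOnePow (p (σ i) * p (σ j)) else 1

/-- The sign `χ(σ)` of a permutation in the graded exterior algebra:
`a (σ 0) ∧ ⋯ ∧ a (σ (n-1)) = χ(σ) a 0 ∧ ⋯ ∧ a (n-1)`. -/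
def antiKoszulSign {n : ℕ} (p : Fin n → ℤ) (σ : Equiv.Perm (Fin n)) : ℤˣ :=
  Equiv.Perm.sign σ * koszulSign p σ

/-- `σ` is a `(k, n-k)`-shuffle: increasing on the first `k` and on the last `n - k` indices. -/
def IsShuffle {n : ℕ} (k : ℕ) (σ : Equiv.Perm (Fin n)) : Prop :=
  (∀ i j : Fin n, i < j → (j : ℕ) < k → σ i < σ j) ∧
    (∀ i j : Fin n, i < j → k ≤ (i : ℕ) → σ i < σ j)

open scoped Classical in
/-- The set `Sh(k,n)` of shuffles. -/
def shuffles (k n : ℕ) : Finset (Equiv.Perm (Fin n)) :=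
  Finset.univ.filter (IsShuffle k)

section Decalage

variable {k : Type u} [CommRing k] {M : Type v} [AddCommGroup M] [Module k M]
  {N : Type w} [AddCommGroup N] [Module k N]

/-- The linear involution `a ↦ (-1)^{|a|} a` of a graded module. -/
def parity (𝓜 : ℤ → Submodule k M) [DirectSum.Decomposition 𝓜] : M →ₗ[k] M :=
  (DirectSum.toModule k ℤ M fun i => ((Int.negOnePow i : ℤˣ) : ℤ) • (𝓜 i).subtype) ∘ₗ
    (DirectSum.decomposeLinearEquiv 𝓜).toLinearMap

theorem parity_of_mem (𝓜 : ℤ → Submodule k M) [DirectSum.Decomposition 𝓜] {i : ℤ} {a : M}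
    (ha : a ∈ 𝓜 i) : parity 𝓜 a = Int.negOnePow i • a := by
  have h : DirectSum.decomposeLinearEquiv 𝓜 a = DirectSum.lof k ℤ (fun i => 𝓜 i) i ⟨a, ha⟩ := by
    rw [DirectSum.decomposeLinearEquiv_apply, DirectSum.decompose_of_mem 𝓜 ha,
      DirectSum.lof_eq_of]
  simp only [parity, LinearMap.comp_apply, LinearEquiv.coe_coe, h, DirectSum.toModule_lof]
  simp [Units.smul_def]

/-- The map `M[1]^{⊗ n} → N[1]` induced by an `n`-linear map `φ` from `M` to `N`.
With the desuspension `↓ : M → M[1]` of degree `-1`, it is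
`(-1)^{n(n-1)/2} ↓ ∘ φ ∘ ↑^{⊗ n}`; by the Koszul sign convention this is
`↓ a_1, …, ↓ a_n ↦ (-1)^{(n-1)|a_1| + (n-2)|a_2| + ⋯ + |a_{n-1}|} ↓ φ(a_1, …, a_n)`.
The modules underlying `M[1]` and `M` are identified by `↓`, so that `a` of degree `p` in `M`
has degree `p - 1` in `M[1]`. -/
def shiftMap (𝓜 : ℤ → Submodule k M) [DirectSum.Decomposition 𝓜] {n : ℕ}
    (φ : MultilinearMap k (fun _ : Fin n => M) N) : MultilinearMap k (fun _ : Fin n => M) N :=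
  φ.compLinearMap fun i => parity 𝓜 ^ (n - 1 - (i : ℕ))

/-- The sum `∑_{i+l=n+1} ∑_{σ ∈ Sh(i,n)} ε(σ) G_l(Q_i(w_{σ(1)}, …, w_{σ(i)}), w_{σ(i+1)}, …, w_{σ(n)})`
for elements `w_j` of degree `q j`, i.e. the component with values in `N` of `G ∘ Q`, where `Q` is
the coderivation of the symmetric coalgebra determined by the maps `Q_i`. -/
def insertionSum (G : ∀ n : ℕ, MultilinearMap k (fun _ : Fin n => M) N)
    (Q : ∀ n : ℕ, MultilinearMap k (fun _ : Fin n => M) M)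
    {n : ℕ} (q : Fin n → ℤ) (w : Fin n → M) : N :=
  ∑ i : Fin (n + 1), ∑ σ ∈ shuffles (i : ℕ) n, koszulSign q σ •
    G (n - i + 1) (Fin.cons
      (Q i fun j : Fin (i : ℕ) => w (σ (Fin.castLE i.is_le j)))
      (fun j : Fin (n - (i : ℕ)) => w (σ ⟨(i : ℕ) + (j : ℕ), by omega⟩)))

/-- The sum `∑_r ∑_{i_1+⋯+i_r=n} (Q'_r ∘ F_I)(w_1, …, w_n)` with
`F_I = 1/(r! i_1! ⋯ i_r!) (F_{i_1} ⊙ ⋯ ⊙ F_{i_r}) ∘ ∑_{σ ∈ Σ_n} ε(σ) σ`, all `i_j ≥ 1`, for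
elements `w_j` of degree `q j` and maps `F_i` of degree `0`, i.e. the component with values in `N`
of `Q' ∘ F`, where `F` is the morphism of symmetric coalgebras determined by the maps `F_i`. -/
def compositionSum [Algebra ℚ k] (Q' : ∀ n : ℕ, MultilinearMap k (fun _ : Fin n => N) N)
    (F : ∀ n : ℕ, MultilinearMap k (fun _ : Fin n => M) N)
    {n : ℕ} (q : Fin n → ℤ) (w : Fin n → M) : N :=
  ∑ c : Composition n,
    algebraMap ℚ k (((c.length.factorial * ∏ r, (c.blocksFun r).factorial : ℕ) : ℚ)⁻¹) •
      ∑ σ : Equiv.Perm (Fin n), koszulSign q σ •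
        Q' c.length fun r => F (c.blocksFun r) fun j => w (σ (c.embedding r j))

end Decalage

end LInfty

open LInfty

/-- An `L_∞`-algebra `(L, μ_n)_{n ≥ 1}` over `k`: a `ℤ`-graded module `L = ⨁ L^i` with maps
`μ_n : ⋀^n L → L` of degree `2 - n` such that the coderivation `Q` of `S(L[1])`, determined by
`Q_n = (-1)^{n(n-1)/2} ↓ ∘ μ_n ∘ ↑^n`, satisfies `Q² = 0`.  (There is no `μ_0`: it is set to `0`.) -/
structure LInftyAlgebra (k : Type u) [CommRing k] where
  carrier : Type v
  [addCommGroup : AddCommGroup carrier]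
  [module : Module k carrier]
  grading : ℤ → Submodule k carrier
  [decomposition : DirectSum.Decomposition grading]
  μ : ∀ n : ℕ, MultilinearMap k (fun _ : Fin n => carrier) carrier
  μ_zero : μ 0 = 0
  μ_mem : ∀ (n : ℕ) (p : Fin n → ℤ) (a : Fin n → carrier), (∀ i, a i ∈ grading (p i)) →
    μ n a ∈ grading ((∑ i, p i) + 2 - n)
  μ_antisymm : ∀ (n : ℕ) (p : Fin n → ℤ) (a : Fin n → carrier), (∀ i, a i ∈ grading (p i)) →
    ∀ σ : Equiv.Perm (Fin n), μ n (fun i => a (σ i)) = antiKoszulSign p σ • μ n a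
  sq_zero : ∀ (n : ℕ) (p : Fin n → ℤ) (a : Fin n → carrier), (∀ i, a i ∈ grading (p i)) →
    insertionSum (fun m => shiftMap grading (μ m)) (fun m => shiftMap grading (μ m))
      (fun i => p i - 1) a = 0

namespace LInftyAlgebra

attribute [instance] addCommGroup module decomposition

variable {k : Type u} [CommRing k]

/-- The component `Q_n : L[1]^{⊙ n} → L[1]` of the codifferential. -/
def Q (L : LInftyAlgebra.{u, v} k) (n : ℕ) :
    MultilinearMap k (fun _ : Fin n => L.carrier) L.carrier :=
  shiftMap L.grading (L.μ n)

/-- The differential `μ_1`. -/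
def d (L : LInftyAlgebra.{u, v} k) : L.carrier →ₗ[k] L.carrier :=
  (MultilinearMap.ofSubsingleton k L.carrier L.carrier (0 : Fin 1)).symm (L.μ 1)

/-- The complex `(L, μ_1)` is split: there is a map `η` of degree `-1` with `d η d = d`. -/
def IsSplit (L : LInftyAlgebra.{u, v} k) : Prop :=
  ∃ η : L.carrier →ₗ[k] L.carrier,
    (∀ (i : ℤ), ∀ a ∈ L.grading i, η a ∈ L.grading (i - 1)) ∧ L.d ∘ₗ η ∘ₗ L.d = L.d

/-- The homology `ker μ_1 / im μ_1`. -/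
abbrev Homology (L : LInftyAlgebra.{u, v} k) : Type v :=
  LinearMap.ker L.d ⧸ (LinearMap.range L.d).submoduleOf (LinearMap.ker L.d)

/-- An `L_∞`-morphism `L → L'`: maps `f_n : ⋀^n L → L'`, `n ≥ 1`, of degree `1 - n` such that the
morphism of coalgebras `F : S(L[1]) → S(L'[1])`, determined by
`F_n = (-1)^{n(n-1)/2} ↓ ∘ f_n ∘ ↑^n`, satisfies `Q' ∘ F = F ∘ Q`. -/
structure Hom [Algebra ℚ k] (L : LInftyAlgebra.{u, v} k) (L' : LInftyAlgebra.{u, w} k) where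
  f : ∀ n : ℕ, MultilinearMap k (fun _ : Fin n => L.carrier) L'.carrier
  f_zero : f 0 = 0
  f_mem : ∀ (n : ℕ) (p : Fin n → ℤ) (a : Fin n → L.carrier), (∀ i, a i ∈ L.grading (p i)) →
    f n a ∈ L'.grading ((∑ i, p i) + 1 - n)
  f_antisymm : ∀ (n : ℕ) (p : Fin n → ℤ) (a : Fin n → L.carrier), (∀ i, a i ∈ L.grading (p i)) →
    ∀ σ : Equiv.Perm (Fin n), f n (fun i => a (σ i)) = antiKoszulSign p σ • f n a
  map_codifferential : ∀ (n : ℕ) (p : Fin n → ℤ) (a : Fin n → L.carrier),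
    (∀ i, a i ∈ L.grading (p i)) →
    compositionSum L'.Q (fun m => shiftMap L.grading (f m)) (fun i => p i - 1) a =
      insertionSum (fun m => shiftMap L.grading (f m)) L.Q (fun i => p i - 1) a

namespace Hom

variable [Algebra ℚ k] {L : LInftyAlgebra.{u, v} k} {L' : LInftyAlgebra.{u, w} k}

/-- The linear part `f_1 : L → L'`. -/
def linear (f : L.Hom L') : L.carrier →ₗ[k] L'.carrier :=
  (MultilinearMap.ofSubsingleton k L.carrier L'.carrier (0 : Fin 1)).symm (f.f 1)

theorem d_linear_of_mem (f : L.Hom L') {p : ℤ} {a : L.carrier} (ha : a ∈ L.grading p) :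
    L'.d (f.linear a) = f.linear (L.d a) := by
  have h := f.map_codifferential 1 (fun _ => p) (fun _ => a) (fun _ => ha)
  have hs : shuffles 1 1 = Finset.univ := by
    ext σ
    simp [shuffles, IsShuffle]
  have hc : Subsingleton (Composition 1) :=
    Fintype.card_le_one_iff_subsingleton.mp (by simp [composition_card])
  have h0 : ∀ b : Fin 1 → L.carrier, shiftMap L.grading (f.f 2) (Fin.cons 0 b) = 0 := fun b =>
    MultilinearMap.map_coord_zero _ (0 : Fin 2) (by simp)
  have hQ : L.Q 0 = 0 := by
    ext
    simp [Q, shiftMap, L.μ_zero]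
  have h1 : (Fin.cons (L.μ 1 fun _ => a) (fun _ : Fin 0 => a) : Fin 1 → L.carrier) =
      fun _ => L.μ 1 fun _ => a := by
    ext i
    rw [show i = 0 from Fin.fin_one_eq_zero i, Fin.cons_zero]
  have hb : ∀ r, (Composition.single 1 one_pos).blocksFun r = 1 := fun r => by simp
  have hl : algebraMap ℚ k ((((Composition.single 1 one_pos).length.factorial *
      ∏ r, ((Composition.single 1 one_pos).blocksFun r).factorial : ℕ) : ℚ)⁻¹) = 1 := by
    rw [Finset.prod_eq_one fun r _ => by rw [hb, Nat.factorial_one]]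
    simp
  have hF : ∀ m, m = 1 → shiftMap L.grading (f.f m) (fun _ => a) = f.f 1 fun _ => a := by
    rintro m rfl
    simp [shiftMap]
  simp only [compositionSum, insertionSum] at h
  rw [Fintype.sum_subsingleton _ (Composition.single 1 one_pos), hl, one_smul,
    Fintype.sum_subsingleton _ (1 : Equiv.Perm (Fin 1))] at h
  simp only [fun r => hF _ (hb r)] at h
  change koszulSign _ _ • L'.Q 1 (fun _ => f.f 1 fun _ => a) = _ at h
  simp [hs, hQ, h0, koszulSign] at h
  simpa [Q, shiftMap, h1, d, linear, MultilinearMap.ofSubsingleton] using h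

theorem d_linear (f : L.Hom L') (a : L.carrier) : L'.d (f.linear a) = f.linear (L.d a) := by
  induction a using DirectSum.Decomposition.inductionOn L.grading with
  | zero => simp
  | homogeneous a => exact f.d_linear_of_mem a.2
  | add a b ha hb => simp [ha, hb]

/-- The map `H(L, μ_1) → H(L', μ'_1)` induced by `f_1`. -/
def homologyMap (f : L.Hom L') : L.Homology →ₗ[k] L'.Homology :=
  Submodule.mapQ _ _
    (f.linear.restrict (p := LinearMap.ker L.d) (q := LinearMap.ker L'.d) fun a ha => by
      rw [LinearMap.mem_ker] at ha ⊢
      rw [d_linear, ha, map_zero])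
    (by
      rintro ⟨a, ha⟩ ⟨b, hb⟩
      exact ⟨f.linear b, by rw [d_linear, hb]; rfl⟩)

/-- `f` is an `L_∞`-quasi-isomorphism: `f_1` induces an isomorphism on homology. -/
def IsQuasiIso (f : L.Hom L') : Prop :=
  Function.Bijective f.homologyMap

end Hom

end LInftyAlgebra

end

noncomputable section

/-! ### Koszul signs and the signs of décalage. -/

namespace LInfty

/-! Over a ring containing `ℚ`, a sequence of graded symmetric maps is a formal power series,
determined by its values on even points with coefficients in a Grassmann algebra. On such points the
Koszul signs disappear (`sum_perm_tmul`), and polarization recovers the graded symmetrization from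
the diagonal (`koszul_sum_eq_zero`, `ext_diag_eq_zero`). At a nilpotent point x = hy all series are
finite sums. In this language a codifferential is an odd vector field Q. With an odd parameter θ,
the equation Q² = 0 reads Q(x + θQ(x)) = Q(x), and a morphism is a map F with F(x + θQ(x)) = F(x) +
θQ'(F(x)) (`ev_add_odd`, `IsLInf.ev_sq`, `ev_comm`). Identities between coderivations and coalgebra
morphisms thus become substitutions.

The core is `exists_retraction`. Let F : B → A be a morphism whose linear part φ has a left inverse
r that is a chain map, together with a homotopy H such that dH + Hd = 1 - φr and Hφ = 0. A morphism
G with GF = id and linear part r is built arity by arity. A correction of G factoring through r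
achieves GF = id in the next arity. Once this holds, the failure E of G to be a morphism in that
arity vanishes on the image of φ (`defect_comp`) and is a cocycle (`defect_d`). With π = φr, the
usual tensor power homotopy K = ∑ E(H, π, …, π, 1, …, 1) bounds E up to E(π, …, π) = 0
(`homotopySum_one_add`). Since Hφ = 0, K vanishes on the image of φ, so adding it to G repairs the
morphism equation without spoiling GF = id.

For a quasi-isomorphism f : L → L' of split complexes the linear part has a homotopy inverse g
(`Hom.exists_linear_inverse`), but it need not be injective. So L' is enlarged to L' ⊕ cone(L), and
f is supplemented by the canonical map to the cone. The new linear part has a strict left inverse,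
made from g and the null homotopy of 1 - gf (`LInfty.exists_inverse`). Restricting the resulting
retraction to L' gives a morphism with linear part g.

The shuffle sums in the definitions are matched with power series by `compositionSum_eq` and
`insertionSum_eq`; `isLInf`, `isMor_coeffs` and `ofIsMor` carry the structures across. Over a field
every complex is split, which gives symmetry of the relation; reflexivity and transitivity come from
the identity and from `IsMor.comp`. -/

theorem prod_lt_comp_perm {α : Type*} [CommMonoid α] {n : ℕ} (f : Fin n → Fin n → α)
    (hf : ∀ a b, f a b = f b a) (τ : Equiv.Perm (Fin n)) :
    ∏ x : Fin n × Fin n with x.1 < x.2, f (τ x.1) (τ x.2) =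
      ∏ x : Fin n × Fin n with x.1 < x.2, f x.1 x.2 := by
  refine Finset.prod_nbij'
    (fun x => if τ x.1 < τ x.2 then (τ x.1, τ x.2) else (τ x.2, τ x.1))
    (fun x => if τ.symm x.1 < τ.symm x.2 then (τ.symm x.1, τ.symm x.2)
      else (τ.symm x.2, τ.symm x.1)) ?_ ?_ ?_ ?_ ?_
  · rintro ⟨a, b⟩ h
    simp only [Finset.mem_filter, Finset.mem_univ, true_and] at h ⊢
    have : τ a ≠ τ b := fun e => h.ne (τ.injective e)
    split_ifs with h1
    · exact h1
    · exact lt_of_le_of_ne (not_lt.mp h1) this.symm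
  · rintro ⟨a, b⟩ h
    simp only [Finset.mem_filter, Finset.mem_univ, true_and] at h ⊢
    have : τ.symm a ≠ τ.symm b := fun e => h.ne (τ.symm.injective e)
    split_ifs with h1
    · exact h1
    · exact lt_of_le_of_ne (not_lt.mp h1) this.symm
  · rintro ⟨a, b⟩ h
    simp only [Finset.mem_filter, Finset.mem_univ, true_and] at h
    by_cases h1 : τ a < τ b
    · simp [h1, h]
    · simp [h1, h.le]
  · rintro ⟨a, b⟩ h
    simp only [Finset.mem_filter, Finset.mem_univ, true_and] at h
    by_cases h1 : τ.symm a < τ.symm b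
    · simp [h1, h]
    · simp [h1, h.le]
  · rintro ⟨a, b⟩ h
    by_cases h1 : τ a < τ b
    · simp [h1]
    · simp [h1, hf (τ a) (τ b)]

/-- On pairs with `x.1 < x.2` the biconditional only says that the pair is inverted. Unlike the
original condition it is symmetric in the two indices, so that `prod_lt_comp_perm` applies. -/
theorem koszulSign_eq_prod_lt {n : ℕ} (p : Fin n → ℤ) (σ : Equiv.Perm (Fin n)) :
    koszulSign p σ = ∏ x : Fin n × Fin n with x.1 < x.2,
      if (σ x.2 < σ x.1 ↔ x.1 < x.2) then Int.negOnePow (p (σ x.1) * p (σ x.2)) else 1 := by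
  rw [koszulSign, Finset.prod_filter, Fintype.prod_prod_type]
  refine Finset.prod_congr rfl fun i _ => Finset.prod_congr rfl fun j _ => ?_
  by_cases h : i < j <;> simp [h]

theorem koszulSign_one {n : ℕ} (p : Fin n → ℤ) : koszulSign p 1 = 1 := by
  refine Finset.prod_eq_one fun i _ => Finset.prod_eq_one fun j _ => if_neg fun h => ?_
  exact lt_asymm h.1 h.2

/-- A pair is inverted by `σ * τ` exactly when one, but not both, of the two steps inverts it.
Comparing the steps pair by pair, after reindexing by `τ`, makes the Koszul sign a crossed
homomorphism. -/
theorem koszulSign_mul {n : ℕ} (p : Fin n → ℤ) (σ τ : Equiv.Perm (Fin n)) :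
    koszulSign p (σ * τ) = koszulSign p σ * koszulSign (p ∘ σ) τ := by
  have h := prod_lt_comp_perm (fun a b =>
    if (σ b < σ a ↔ a < b) then Int.negOnePow (p (σ a) * p (σ b)) else 1) (fun a b => by
      rcases eq_or_ne a b with rfl | hab
      · rfl
      · have h2 : σ a ≠ σ b := fun e => hab (σ.injective e)
        rw [mul_comm (p (σ a))]
        refine if_congr ?_ rfl rfl
        rcases lt_or_gt_of_ne hab with h | h <;> rcases lt_or_gt_of_ne h2 with h' | h' <;>
          simp [h, h', h.not_gt, h'.not_gt]) τ
  rw [koszulSign_eq_prod_lt, koszulSign_eq_prod_lt, koszulSign_eq_prod_lt, ← h,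
    ← Finset.prod_mul_distrib]
  refine Finset.prod_congr rfl ?_
  rintro ⟨a, b⟩ hab
  simp only [Finset.mem_filter, Finset.mem_univ, true_and] at hab
  have h1 : τ a ≠ τ b := fun e => hab.ne (τ.injective e)
  have h2 : σ (τ a) ≠ σ (τ b) := fun e => h1 (σ.injective e)
  rcases lt_or_gt_of_ne h1 with h | h <;> rcases lt_or_gt_of_ne h2 with h' | h' <;>
    simp [h, h', hab, h.not_gt, h'.not_gt]

theorem koszulSign_mul_self {n : ℕ} (p : Fin n → ℤ) (σ : Equiv.Perm (Fin n)) :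
    koszulSign p σ * koszulSign p σ = 1 := Int.units_mul_self _

/-- Allows degrees to be replaced by the representatives 0 and 1, so that the finite sum `symm`
serves all degrees at once. -/
theorem koszulSign_congr {n : ℕ} {p q : Fin n → ℤ} (h : ∀ i, (p i : ZMod 2) = q i)
    (σ : Equiv.Perm (Fin n)) : koszulSign p σ = koszulSign q σ := by
  have h' : ∀ i, Even (p i) ↔ Even (q i) := fun i => by
    have key : ∀ a : ℤ, Even a ↔ (a : ZMod 2) = 0 := fun a => by
      rw [ZMod.intCast_zmod_eq_zero_iff_dvd, even_iff_two_dvd]; rfl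
    rw [key, key, h]
  refine Finset.prod_congr rfl fun i _ => Finset.prod_congr rfl fun j _ => if_congr Iff.rfl ?_ rfl
  rw [Int.negOnePow_eq_iff, Int.even_sub]
  simp [Int.even_mul, h']

/-- The Koszul sign of the transposition of two neighbours. -/
theorem koszulSign_swap {n : ℕ} (p : Fin (n + 1) → ℤ) (i : Fin n) :
    koszulSign p (Equiv.swap i.castSucc i.succ) = Int.negOnePow (p i.castSucc * p i.succ) := by
  rw [koszulSign, Finset.prod_eq_single i.castSucc, Finset.prod_eq_single i.succ]
  · simp [mul_comm]
  · intro j _ hj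
    refine if_neg fun h => ?_
    rw [Equiv.swap_apply_left] at h
    rcases eq_or_ne j i.castSucc with rfl | hj'
    · exact lt_irrefl _ h.1
    · rw [Equiv.swap_apply_of_ne_of_ne hj' hj] at h
      have h1 := h.1
      have h2 := h.2
      simp only [Fin.lt_def, Fin.val_castSucc, Fin.val_succ] at h1 h2
      omega
  · simp
  · intro a _ ha
    refine Finset.prod_eq_one fun b _ => if_neg fun h => ?_
    obtain ⟨h1, h2⟩ := h
    rw [Equiv.swap_apply_def, Equiv.swap_apply_def] at h2
    split_ifs at h2 <;> simp_all only [Fin.lt_def, Fin.ext_iff, Fin.val_castSucc,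
      Fin.val_succ] <;> omega
  · simp

/-- To prove a statement about all permutations of `Fin n`, it suffices to be able to multiply with
transpositions of neighbours. -/
theorem perm_induction {n : ℕ} {P : Equiv.Perm (Fin (n + 1)) → Prop} (one : P 1)
    (mul : ∀ (σ : Equiv.Perm (Fin (n + 1))) (i : Fin n), P σ →
      P (σ * Equiv.swap i.castSucc i.succ)) (σ : Equiv.Perm (Fin (n + 1))) : P σ := by
  have h : σ ∈ Submonoid.closure
      (Set.range fun i : Fin n ↦ Equiv.swap i.castSucc i.succ) := by
    rw [Equiv.Perm.mclosure_swap_castSucc_succ]; trivial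
  induction h using Submonoid.closure_induction_right with
  | one => exact one
  | mul_right x _ y hy ih =>
    obtain ⟨i, rfl⟩ := hy
    exact mul x i ih

/-- The sign relating `φ` and `shiftMap φ` on elements of degrees `p`. -/
def shiftSign {n : ℕ} (p : Fin n → ℤ) : ℤˣ :=
  ∏ i : Fin n, Int.negOnePow ((n - 1 - (i : ℕ) : ℕ) * p i)

/-- The weights of two neighbours differ by one, so exchanging their degrees changes the exponent by
the sum of the two degrees modulo 2. -/
theorem shiftSign_swap {n : ℕ} (p : Fin (n + 1) → ℤ) (i : Fin n) :
    shiftSign (p ∘ Equiv.swap i.castSucc i.succ) =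
      Int.negOnePow (p i.castSucc + p i.succ) * shiftSign p := by
  have h1 : i.castSucc ≠ i.succ := by simp [Fin.ext_iff]
  have key : ∀ q : Fin (n + 1) → ℤ, shiftSign q =
      (Int.negOnePow ((n - (i : ℕ) : ℕ) * q i.castSucc) *
        Int.negOnePow ((n - 1 - (i : ℕ) : ℕ) * q i.succ)) *
      ∏ j ∈ (Finset.univ.erase i.castSucc).erase i.succ,
        Int.negOnePow ((n - (j : ℕ) : ℕ) * q j) := by
    intro q
    rw [shiftSign, ← Finset.mul_prod_erase _ _ (Finset.mem_univ i.castSucc),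
      ← Finset.mul_prod_erase _ _ (Finset.mem_erase.mpr ⟨h1.symm, Finset.mem_univ i.succ⟩),
      ← mul_assoc]
    have : n - 1 - (i : ℕ) = n - ((i : ℕ) + 1) := by omega
    simp [this]
  rw [key, key p, ← mul_assoc]
  congr 1
  · simp only [Function.comp_apply, Equiv.swap_apply_left, Equiv.swap_apply_right,
      ← Int.negOnePow_add]
    rw [Int.negOnePow_eq_iff]
    have : n - (i : ℕ) = (n - 1 - (i : ℕ)) + 1 := by omega
    rw [this]
    refine ⟨-p i.castSucc , ?_⟩
    push_cast
    ring
  · refine Finset.prod_congr rfl fun j hj => ?_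
    simp only [Finset.mem_erase] at hj
    rw [Function.comp_apply, Equiv.swap_apply_of_ne_of_ne hj.2.1 hj.1]

/-- The sign of décalage. For one transposition it is (a - 1)(b - 1) ≡ ab + a + b + 1 modulo 2: the
term 1 is the sign of the transposition, ab its Koszul sign, and a + b is the change of `shiftSign`.
Both sides are multiplicative along words in neighbour transpositions. -/
theorem koszulSign_sub_one {n : ℕ} (p : Fin n → ℤ) (σ : Equiv.Perm (Fin n)) :
    koszulSign (fun i => p i - 1) σ =
      antiKoszulSign p σ * (shiftSign (p ∘ σ) * shiftSign p) := by
  obtain _ | n := n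
  · rw [Subsingleton.elim σ 1, antiKoszulSign, koszulSign_one, koszulSign_one]
    simp [shiftSign]
  induction σ using perm_induction with
  | one => simp [antiKoszulSign, koszulSign_one, Int.units_mul_self]
  | mul σ i ih =>
    have h1 : i.castSucc ≠ i.succ := by simp [Fin.ext_iff]
    rw [koszulSign_mul, ih, antiKoszulSign, antiKoszulSign, koszulSign_mul, koszulSign_swap,
      Equiv.Perm.sign_mul, Equiv.Perm.sign_swap h1, koszulSign_swap,
      Equiv.Perm.coe_mul, ← Function.comp_assoc, shiftSign_swap]
    simp only [Function.comp_apply]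
    set a := p (σ i.castSucc)
    set b := p (σ i.succ)
    have : ((a - 1) * (b - 1)).negOnePow = -1 * ((a * b).negOnePow * (a + b).negOnePow) := by
      rw [← Int.negOnePow_add, ← Int.negOnePow_one, ← Int.negOnePow_add, Int.negOnePow_eq_iff]
      exact ⟨-a-b, by ring⟩
    rw [this]
    simp only [mul_assoc, mul_left_comm, mul_comm]

/-- Reordering a product of elements which commute up to Koszul signs. -/
theorem prod_ofFn_perm {R : Type*} [Ring R] {n : ℕ} (p : Fin n → ℤ) (t : Fin n → R)
    (ht : ∀ i j, i ≠ j → t j * t i = Int.negOnePow (p i * p j) • (t i * t j)) (σ : Equiv.Perm (Fin n)) :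
    (List.ofFn (t ∘ σ)).prod = koszulSign p σ • (List.ofFn t).prod := by
  obtain _ | n := n
  · rw [Subsingleton.elim σ 1, koszulSign_one]
    simp
  induction σ using perm_induction with
  | one => simp [koszulSign_one]
  | mul σ i ih =>
    have key : ∀ (n : ℕ) (i : Fin n) (t : Fin (n + 1) → R) (ε : ℤˣ)
        (_ : t i.succ * t i.castSucc = ε • (t i.castSucc * t i.succ)),
        (List.ofFn (t ∘ Equiv.swap i.castSucc i.succ)).prod = ε • (List.ofFn t).prod := by
      intro n
      induction n with
      | zero => exact fun i => i.elim0
      | succ n ihn =>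
        intro i t ε h
        induction i using Fin.cases with
        | zero =>
          have : ∀ j : Fin n, (Equiv.swap (0 : Fin (n + 2)) 1) j.succ.succ = j.succ.succ := by
            intro j
            exact Equiv.swap_apply_of_ne_of_ne (by simp [Fin.ext_iff]) (by simp [Fin.ext_iff])
          simp only [Fin.castSucc_zero, Fin.succ_zero_eq_one] at h
          simp only [List.ofFn_succ, List.prod_cons, Function.comp_apply, Fin.castSucc_zero,
            Fin.succ_zero_eq_one, Equiv.swap_apply_left, Equiv.swap_apply_right, ← mul_assoc, this,
            h, smul_mul_assoc]
        | succ i =>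
          have h0 : (Equiv.swap (i.succ.castSucc) i.succ.succ) 0 = 0 :=
            Equiv.swap_apply_of_ne_of_ne (by simp [Fin.ext_iff]) (by simp [Fin.ext_iff])
          have h1 : ∀ j : Fin (n + 1), (Equiv.swap (i.succ.castSucc) i.succ.succ) j.succ =
              (Equiv.swap i.castSucc i.succ j).succ := by
            intro j
            simp only [Equiv.swap_apply_def, ← Fin.succ_castSucc, Fin.succ_inj]
            split_ifs <;> rfl
          have := ihn i (fun j => t j.succ) ε (by simpa using h)
          rw [List.ofFn_succ, List.ofFn_succ (f := t), List.prod_cons, List.prod_cons,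
            ← mul_smul_comm, ← this]
          simp only [Function.comp_apply, h0, h1, Function.comp_def]
    have h1 : i.castSucc ≠ i.succ := by simp [Fin.ext_iff]
    rw [Equiv.Perm.coe_mul, ← Function.comp_assoc, key n i (t ∘ σ) _
      (ht _ _ (fun e => h1 (σ.injective e))), ih, smul_smul, koszulSign_mul, koszulSign_swap, mul_comm]
    rfl

end LInfty

/-! ### The Grassmann algebra as a supply of even and odd parameters. -/

namespace LInfty

open CliffordAlgebra (evenOdd)

section Grassmann

variable (k : Type u) [CommRing k]

/-- The Grassmann algebra on countably many odd generators. -/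
abbrev Grassmann : Type u := ExteriorAlgebra k (ℕ →₀ k)

variable {k}

namespace Grassmann

/-- The elements of degree `p` modulo two. -/
abbrev part (p : ZMod 2) : Submodule k (Grassmann k) :=
  evenOdd (0 : QuadraticForm k (ℕ →₀ k)) p

theorem mul_mem_part {p q : ZMod 2} {a b : Grassmann k} (ha : a ∈ part p) (hb : b ∈ part q) :
    a * b ∈ part (p + q) :=
  SetLike.mul_mem_graded ha hb

theorem one_mem_part : (1 : Grassmann k) ∈ part 0 := SetLike.GradedOne.one_mem

theorem pow_mem_part {a : Grassmann k} (ha : a ∈ part 0) (n : ℕ) : a ^ n ∈ part 0 := by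
  have := SetLike.pow_mem_graded n ha
  simpa using this

theorem prod_mem_part {n : ℕ} {p : Fin n → ZMod 2} {t : Fin n → Grassmann k}
    (ht : ∀ i, t i ∈ part (p i)) : (List.ofFn t).prod ∈ part (∑ i, p i) := by
  induction n with
  | zero => simpa using one_mem_part
  | succ n ih =>
    rw [List.ofFn_succ, List.prod_cons, Fin.sum_univ_succ]
    exact mul_mem_part (ht 0) (ih fun i => ht i.succ)

theorem ι_mul (v : ℕ →₀ k) (a : Grassmann k) :
    ExteriorAlgebra.ι k v * a = CliffordAlgebra.involute a * ExteriorAlgebra.ι k v := by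
  induction a using ExteriorAlgebra.induction with
  | algebraMap r => rw [AlgHom.commutes, Algebra.commutes]
  | ι x =>
    have h := ExteriorAlgebra.ι_add_mul_swap (R := k) v x
    rw [show CliffordAlgebra.involute (ExteriorAlgebra.ι k x) = -ExteriorAlgebra.ι k x from
      CliffordAlgebra.involute_ι _, neg_mul]
    exact eq_neg_of_add_eq_zero_left h
  | mul a b ha hb => rw [← mul_assoc, ha, mul_assoc, hb, map_mul, mul_assoc]
  | add a b ha hb => rw [mul_add, ha, hb, map_add, add_mul]

theorem ι_mul_ι_mul (v w : ℕ →₀ k) (a : Grassmann k) :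
    ExteriorAlgebra.ι k v * ExteriorAlgebra.ι k w * a =
      a * (ExteriorAlgebra.ι k v * ExteriorAlgebra.ι k w) := by
  rw [mul_assoc, ι_mul w a, ← mul_assoc, ι_mul v, CliffordAlgebra.involute_involute, mul_assoc]

theorem even_mul_mem {p : ZMod 2} {a b : Grassmann k} (ha : a ∈ part 0) (hb : b ∈ part p) :
    a * b ∈ part p := by
  have h := mul_mem_part ha hb
  rwa [zero_add] at h

theorem odd_mul_odd_mem {a b : Grassmann k} (ha : a ∈ part 1) (hb : b ∈ part 1) :
    a * b ∈ part 0 := by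
  have h := mul_mem_part ha hb
  rwa [show (1 : ZMod 2) + 1 = 0 from rfl] at h

theorem even_mul {a : Grassmann k} (ha : a ∈ part 0) (b : Grassmann k) : a * b = b * a := by
  induction a, ha using CliffordAlgebra.even_induction with
  | algebraMap r => exact Algebra.commutes r b
  | add x y hx hy ihx ihy => rw [add_mul, ihx, ihy, mul_add]
  | ι_mul_ι_mul m₁ m₂ x hx ih =>
    change ExteriorAlgebra.ι k m₁ * ExteriorAlgebra.ι k m₂ * x * b = _
    rw [mul_assoc, ih, ← mul_assoc, ι_mul_ι_mul, mul_assoc]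

theorem odd_mul {a : Grassmann k} (ha : a ∈ part 1) (b : Grassmann k) :
    a * b = CliffordAlgebra.involute b * a := by
  induction a, ha using CliffordAlgebra.odd_induction with
  | ι v => exact ι_mul v b
  | add x y hx hy ihx ihy => rw [add_mul, ihx, ihy, mul_add]
  | ι_mul_ι_mul m₁ m₂ x hx ih =>
    change ExteriorAlgebra.ι k m₁ * ExteriorAlgebra.ι k m₂ * x * b = _
    rw [mul_assoc, ih, ← mul_assoc, ι_mul_ι_mul, mul_assoc]

theorem involute_of_mem {p : ℤ} {a : Grassmann k} (ha : a ∈ part (p : ZMod 2)) :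
    CliffordAlgebra.involute a = Int.negOnePow p • a := by
  rcases Int.even_or_odd p with h | h
  · rw [Int.negOnePow_even _ h, one_smul]
    exact CliffordAlgebra.involute_eq_of_mem_even (by rwa [h.intCast_zmod_two] at ha)
  · rw [Int.negOnePow_odd _ h]
    rw [show ((p : ℤ) : ZMod 2) = 1 by
      obtain ⟨m, rfl⟩ := h
      push_cast
      rw [show (2 : ZMod 2) = 0 from rfl, zero_mul, zero_add]] at ha
    simpa [Units.smul_def] using CliffordAlgebra.involute_eq_of_mem_odd ha

theorem mul_comm_of_mem {p q : ℤ} {a b : Grassmann k} (ha : a ∈ part (p : ZMod 2))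
    (hb : b ∈ part (q : ZMod 2)) : b * a = Int.negOnePow (p * q) • (a * b) := by
  rcases Int.even_or_odd q with h | h
  · rw [Int.negOnePow_even _ (h.mul_left p), one_smul]
    exact even_mul (by rwa [h.intCast_zmod_two] at hb) a
  · have hq : ((q : ℤ) : ZMod 2) = 1 := by
      obtain ⟨m, rfl⟩ := h
      push_cast
      rw [show (2 : ZMod 2) = 0 from rfl, zero_mul, zero_add]
    have : Int.negOnePow (p * q) = Int.negOnePow p := by
      rw [Int.negOnePow_eq_iff]
      obtain ⟨m, rfl⟩ := h
      exact ⟨p * m, by ring⟩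
    rw [odd_mul (by rwa [hq] at hb) a, involute_of_mem ha, this, smul_mul_assoc]

/-- An odd element anticommutes with itself, and 2 is invertible. -/
theorem odd_mul_self [Algebra ℚ k] {a : Grassmann k} (ha : a ∈ part 1) : a * a = 0 := by
  have h : a * a = -(a * a) := by
    conv_lhs => rw [odd_mul ha, CliffordAlgebra.involute_eq_of_mem_odd ha, neg_mul]
  have h2 : (2 : k) • (a * a) = 0 := by
    rw [two_smul]
    exact add_eq_zero_iff_eq_neg.mpr h
  have h3 : (algebraMap ℚ k (1 / 2)) * 2 = 1 := by
    rw [← map_ofNat (algebraMap ℚ k) 2, ← map_mul]; norm_num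
  rw [← one_smul k (a * a), ← h3, mul_smul, h2, smul_zero]

theorem ι_mem (v : ℕ →₀ k) : ExteriorAlgebra.ι k v ∈ (part 1 : Submodule k (Grassmann k)) :=
  CliffordAlgebra.ι_mem_evenOdd_one _ _

/-- The generators. -/
def gen (i : ℕ) : Grassmann k := ExteriorAlgebra.ι k (Finsupp.single i 1)

theorem gen_mem (i : ℕ) : (gen i : Grassmann k) ∈ part 1 := ι_mem _

theorem map_mem_part (f : (ℕ →₀ k) →ₗ[k] (ℕ →₀ k)) {p : ZMod 2} {a : Grassmann k}
    (ha : a ∈ part p) : ExteriorAlgebra.map f a ∈ part p := by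
  have h : ∀ p : ZMod 2, p = 0 ∨ p = 1 := by decide
  rcases h p with rfl | rfl
  · induction a, ha using CliffordAlgebra.even_induction with
    | algebraMap r =>
      change ExteriorAlgebra.map f (algebraMap k (Grassmann k) r) ∈ _
      rw [AlgHom.commutes, Algebra.algebraMap_eq_smul_one]
      exact Submodule.smul_mem _ _ one_mem_part
    | add x y hx hy ihx ihy => rw [map_add]; exact Submodule.add_mem _ ihx ihy
    | ι_mul_ι_mul m₁ m₂ x hx ih =>
      change ExteriorAlgebra.map f (ExteriorAlgebra.ι k m₁ * ExteriorAlgebra.ι k m₂ * x) ∈ _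
      rw [map_mul, map_mul, ExteriorAlgebra.map_apply_ι, ExteriorAlgebra.map_apply_ι]
      exact even_mul_mem (odd_mul_odd_mem (ι_mem _) (ι_mem _)) ih
  · induction a, ha using CliffordAlgebra.odd_induction with
    | ι v =>
      change ExteriorAlgebra.map f (ExteriorAlgebra.ι k v) ∈ _
      rw [ExteriorAlgebra.map_apply_ι]
      exact ι_mem _
    | add x y hx hy ihx ihy => rw [map_add]; exact Submodule.add_mem _ ihx ihy
    | ι_mul_ι_mul m₁ m₂ x hx ih =>
      change ExteriorAlgebra.map f (ExteriorAlgebra.ι k m₁ * ExteriorAlgebra.ι k m₂ * x) ∈ _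
      rw [map_mul, map_mul, ExteriorAlgebra.map_apply_ι, ExteriorAlgebra.map_apply_ι]
      exact even_mul_mem (odd_mul_odd_mem (ι_mem _) (ι_mem _)) ih

/-- The endomorphism which makes room for a new generator. -/
def shift : Grassmann k →ₐ[k] Grassmann k :=
  ExteriorAlgebra.map (Finsupp.lmapDomain k k Nat.succ)

theorem shift_mem {p : ZMod 2} {a : Grassmann k} (ha : a ∈ part p) : shift a ∈ part p :=
  map_mem_part _ ha

/-- The coefficient of the first generator. -/
def coeffZero : Grassmann k →ₗ[k] Grassmann k :=
  (ExteriorAlgebra.map (Finsupp.lcomapDomain (R := k) (M := k) Nat.succ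
    Nat.succ_injective)).toLinearMap ∘ₗ
    CliffordAlgebra.contractLeft (Finsupp.lapply 0)

/-- Contraction with the dual of generator 0 removes `gen 0` and kills everything in the image of
`shift`; the remaining factor is then shifted back. Hence `gen 0` is a parameter independent of all
shifted elements. -/
theorem coeffZero_gen_mul_shift (a : Grassmann k) : coeffZero (gen 0 * shift a) = a := by
  have h : ∀ b : Grassmann k, CliffordAlgebra.contractLeft (Q := (0 : QuadraticForm k (ℕ →₀ k)))
      (Finsupp.lapply 0 : (ℕ →₀ k) →ₗ[k] k) (shift b) = 0 := by
    intro b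
    induction b using CliffordAlgebra.left_induction with
    | algebraMap r => rw [AlgHom.commutes]; exact CliffordAlgebra.contractLeft_algebraMap (Q := 0) _ _
    | add x y hx hy => rw [map_add, map_add, hx, hy, add_zero]
    | ι_mul x m hx =>
      rw [map_mul, shift, show ExteriorAlgebra.map (Finsupp.lmapDomain k k Nat.succ)
        (CliffordAlgebra.ι 0 m) = CliffordAlgebra.ι 0 (Finsupp.lmapDomain k k Nat.succ m) from
        ExteriorAlgebra.map_apply_ι _ _, CliffordAlgebra.contractLeft_ι_mul]
      rw [shift] at hx
      have h0 : (Finsupp.lapply 0 : (ℕ →₀ k) →ₗ[k] k) (Finsupp.lmapDomain k k Nat.succ m) = 0 := by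
        simp only [Finsupp.lapply_apply, Finsupp.lmapDomain_apply]
        exact Finsupp.mapDomain_of_notMem_range _ _ (by simp)
      rw [hx, h0, zero_smul, mul_zero, sub_zero]
  have hs : (ExteriorAlgebra.map (Finsupp.lcomapDomain (R := k) (M := k)
      Nat.succ Nat.succ_injective)) (shift a) = a := by
    rw [shift, ← AlgHom.comp_apply, ExteriorAlgebra.map_comp_map]
    have : (Finsupp.lcomapDomain (R := k) (M := k) Nat.succ Nat.succ_injective) ∘ₗ
        (Finsupp.lmapDomain k k Nat.succ) = LinearMap.id := by
      refine LinearMap.ext fun x => Finsupp.ext fun i => ?_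
      simp only [LinearMap.comp_apply, Finsupp.lmapDomain_apply, LinearMap.id_apply]
      exact Finsupp.mapDomain_apply Nat.succ_injective _ _
    rw [this, ExteriorAlgebra.map_id]
    rfl
  rw [coeffZero, LinearMap.comp_apply, gen]
  rw [show CliffordAlgebra.contractLeft (Q := (0 : QuadraticForm k (ℕ →₀ k)))
      (Finsupp.lapply 0 : (ℕ →₀ k) →ₗ[k] k) (ExteriorAlgebra.ι k (Finsupp.single 0 1) * shift a) = shift a by
    rw [show ExteriorAlgebra.ι k (Finsupp.single 0 (1 : k)) = CliffordAlgebra.ι 0 _ from rfl,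
      CliffordAlgebra.contractLeft_ι_mul, h]
    simp]
  exact hs

theorem add_pow_of_mul_self_eq_zero {R : Type*} [Ring R] {x g : R} (h : Commute x g)
    (hg : g * g = 0) (n : ℕ) : (x + g) ^ (n + 1) = x ^ (n + 1) + (n + 1) • (g * x ^ n) := by
  induction n with
  | zero => simp
  | succ n ih =>
    have h1 : g * x ^ n * x = g * x ^ (n + 1) := by rw [mul_assoc, ← pow_succ]
    have h2 : x ^ (n + 1) * g = g * x ^ (n + 1) := (h.pow_left _).eq
    have h3 : g * x ^ n * g = 0 := by rw [mul_assoc, (h.pow_left n).eq, ← mul_assoc, hg, zero_mul]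
    rw [pow_succ, ih, mul_add, add_mul, add_mul, ← pow_succ, smul_mul_assoc, smul_mul_assoc, h1,
      h2, h3, smul_zero, add_zero, add_assoc, ← succ_nsmul]

/-- The element `h` is a sum of N products of two fresh generators. Each summand is even with square
zero, so h^N is N! times the product of all of them and h^(N+1) = 0. The map `s` moves given
coefficients away from these generators, and `c` reads off the coefficient of h^N, dividing by N!.
-/
theorem exists_nilpotent [Algebra ℚ k] (N : ℕ) : ∃ (s : Grassmann k →ₐ[k] Grassmann k)
    (h : Grassmann k) (c : Grassmann k →ₗ[k] Grassmann k), (∀ p, ∀ a ∈ part p, s a ∈ part p) ∧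
      h ∈ part 0 ∧ h ^ (N + 1) = 0 ∧ ∀ a, c (h ^ N * s a) = a := by
  induction N with
  | zero => exact ⟨AlgHom.id k _, 0, LinearMap.id, fun _ _ h => h, zero_mem _, by simp, by simp⟩
  | succ N ih =>
    obtain ⟨s, h, c, hs, h0, hN, hc⟩ := ih
    set g : Grassmann k := gen 0 * shift (gen 0)
    have hg : g ∈ part 0 := odd_mul_odd_mem (gen_mem 0) (shift_mem (gen_mem 0))
    have hgg : g * g = 0 := by
      have h1 := even_mul hg (gen 0)
      simp only [g] at h1 ⊢
      rw [← mul_assoc, h1, ← mul_assoc, odd_mul_self (gen_mem 0), zero_mul, zero_mul]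
    set x : Grassmann k := shift (shift h)
    have hx : x ∈ part 0 := shift_mem (shift_mem h0)
    have hxN : x ^ (N + 1) = 0 := by simp only [x]; rw [← map_pow, ← map_pow, hN, map_zero, map_zero]
    have hcomm : Commute x g := even_mul hx g
    refine ⟨(shift.comp shift).comp s, x + g,
      -- The factor N + 1 comes from (x + g)^(N+1) = (N + 1) g x^N, where x^(N+1) = 0 and g² = 0.
      (algebraMap ℚ k ((N + 1 : ℚ)⁻¹)) • (c ∘ₗ coeffZero ∘ₗ coeffZero), ?_,
      Submodule.add_mem _ hx hg, ?_, ?_⟩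
    · exact fun p a ha => shift_mem (shift_mem (hs p a ha))
    · rw [add_pow_of_mul_self_eq_zero hcomm hgg, pow_succ x, hxN, zero_mul, mul_zero, smul_zero,
        zero_add]
    · intro a
      have h1 : g * x ^ N * ((shift.comp shift).comp s) a =
          gen 0 * shift (gen 0 * shift (h ^ N * s a)) := by
        simp [g, x, mul_assoc]
      rw [add_pow_of_mul_self_eq_zero hcomm hgg, hxN, zero_add, smul_mul_assoc, h1]
      simp only [LinearMap.smul_apply, LinearMap.comp_apply, map_nsmul, coeffZero_gen_mul_shift,
        hc]
      rw [← Nat.cast_smul_eq_nsmul k, smul_smul, ← map_natCast (algebraMap ℚ k), ← map_mul,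
        Nat.cast_succ, mul_inv_cancel₀ (by positivity), map_one, one_smul]

/-- New odd parameters `θ`, `θ'` and a new even parameter `h` with `h ^ (N + 1) = 0`. -/
structure Params (k : Type u) [CommRing k] (N : ℕ) where
  s : Grassmann k →ₐ[k] Grassmann k
  h : Grassmann k
  θ : Grassmann k
  θ' : Grassmann k
  c : Grassmann k →ₗ[k] Grassmann k
  s_mem : ∀ p, ∀ a ∈ part p, s a ∈ part p
  h_mem : h ∈ part 0
  θ_mem : θ ∈ part 1
  θ'_mem : θ' ∈ part 1
  h_pow : h ^ (N + 1) = 0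
  c_mul : ∀ a, c (θ' * (θ * (h ^ N * s a))) = a

theorem exists_params [Algebra ℚ k] (N : ℕ) : Nonempty (Params k N) := by
  obtain ⟨s, h, c, hs, h0, hN, hc⟩ := exists_nilpotent (k := k) N
  exact ⟨{
    s := (shift.comp shift).comp s
    h := shift (shift h)
    θ := shift (gen 0)
    θ' := gen 0
    c := c ∘ₗ coeffZero ∘ₗ coeffZero
    s_mem := fun p a ha => shift_mem (shift_mem (hs p a ha))
    h_mem := shift_mem (shift_mem h0)
    θ_mem := shift_mem (gen_mem 0)
    θ'_mem := gen_mem 0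
    h_pow := by rw [← map_pow, ← map_pow, hN, map_zero, map_zero]
    c_mul := fun a => by
      have : gen 0 * (shift (gen 0) * (shift (shift h) ^ N * ((shift.comp shift).comp s) a)) =
          gen 0 * shift (gen 0 * shift (h ^ N * s a)) := by
        simp
      rw [this]
      simp only [LinearMap.comp_apply, coeffZero_gen_mul_shift, hc] }⟩

/-- An odd degree receives a fresh generator, an even degree the coefficient 1. The product of the
coefficients is then detected by iterated contractions. -/
theorem exists_independent {n : ℕ} (q : Fin n → ℤ) : ∃ (t : Fin n → Grassmann k)
    (c : Grassmann k →ₗ[k] k), (∀ i, t i ∈ part (q i : ZMod 2)) ∧ c (List.ofFn t).prod = 1 := by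
  induction n with
  | zero =>
    exact ⟨Fin.elim0, ExteriorAlgebra.algebraMapInv.toLinearMap, fun i => i.elim0, by simp⟩
  | succ n ih =>
    obtain ⟨t, c, ht, hc⟩ := ih (fun i => q i.succ)
    rcases Int.even_or_odd (q 0) with h | h
    · refine ⟨Fin.cons 1 t, c, fun i => ?_, by simpa [List.ofFn_succ] using hc⟩
      induction i using Fin.cases with
      | zero => rw [Fin.cons_zero, h.intCast_zmod_two]; exact one_mem_part
      | succ i => exact ht i
    · refine ⟨Fin.cons (gen 0) (shift ∘ t), c ∘ₗ coeffZero, fun i => ?_, ?_⟩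
      · induction i using Fin.cases with
        | zero =>
          have : ((q 0 : ℤ) : ZMod 2) = 1 := by
            obtain ⟨m, hm⟩ := h
            rw [hm]
            push_cast
            rw [show (2 : ZMod 2) = 0 from rfl, zero_mul, zero_add]
          rw [Fin.cons_zero, this]
          exact gen_mem 0
        | succ i => exact shift_mem (ht i)
      · have : (List.ofFn (shift ∘ t)).prod = shift (List.ofFn t).prod := by
          rw [map_list_prod, List.map_ofFn]
        simp only [List.ofFn_succ, List.prod_cons, Fin.cons_zero, Fin.cons_succ]
        rw [this, LinearMap.comp_apply, coeffZero_gen_mul_shift, hc]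

end Grassmann

end Grassmann

end LInfty

/-! ### Extension of multilinear maps to points with Grassmann coefficients. -/

namespace LInfty

open scoped TensorProduct

section Extension

variable {k : Type u} [CommRing k] {A B C : Type*} [AddCommGroup A] [Module k A]
  [AddCommGroup B] [Module k B] [AddCommGroup C] [Module k C]

/-- Span induction in one argument at a time, by currying. This reduces statements about points to
homogeneous pure tensors. -/
theorem MultilinearMap.mem_of_mem_span {n : ℕ} (f : MultilinearMap k (fun _ : Fin n => A) B)
    (S : Fin n → Set A) (N : Submodule k B) (h : ∀ x, (∀ i, x i ∈ S i) → f x ∈ N)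
    (x : Fin n → A) (hx : ∀ i, x i ∈ Submodule.span k (S i)) : f x ∈ N := by
  induction n with
  | zero => exact h x fun i => i.elim0
  | succ n ih =>
    rw [← Fin.cons_self_tail x]
    have h0 := hx 0
    generalize x 0 = z at h0
    induction h0 using Submodule.span_induction with
    | mem a ha =>
      refine ih (f.curryLeft a) (fun i => S i.succ) (fun y hy => ?_) _ fun i => hx i.succ
      refine h _ fun i => ?_
      induction i using Fin.cases with
      | zero => exact ha
      | succ i => exact hy i
    | zero => rw [← MultilinearMap.curryLeft_apply, map_zero]; exact zero_mem _
    | add a b _ _ ha hb =>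
      rw [← MultilinearMap.curryLeft_apply, map_add]; exact add_mem ha hb
    | smul r a _ ha =>
      rw [← MultilinearMap.curryLeft_apply, map_smul]; exact Submodule.smul_mem _ _ ha

/-- The points of `A` with values in the Grassmann algebra. -/
abbrev Pt (k : Type u) [CommRing k] (A : Type*) [AddCommGroup A] [Module k A] :=
  Grassmann k ⊗[k] A

/-- One more variable for an extension `E` of `n`-linear maps to points. -/
def extSucc {n : ℕ} (E : MultilinearMap k (fun _ : Fin n => A) B →ₗ[k]
      MultilinearMap k (fun _ : Fin n => Pt k A) (Pt k B))
    (ψ : A →ₗ[k] MultilinearMap k (fun _ : Fin n => A) B) :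
    Pt k A →ₗ[k] MultilinearMap k (fun _ : Fin n => Pt k A) (Pt k B) :=
  TensorProduct.lift (LinearMap.mk₂ k
    (fun t v => (Algebra.lsmul k k (Pt k B) t).compMultilinearMap (E (ψ v)))
    (fun t t' v => MultilinearMap.ext fun x => add_smul t t' (E (ψ v) x))
    (fun r t v => MultilinearMap.ext fun x => smul_assoc r t (E (ψ v) x))
    (fun t v v' => by ext x; simp) (fun r t v => MultilinearMap.ext fun x => by
      rw [map_smul, map_smul]; exact smul_comm t r (E (ψ v) x)))

theorem extSucc_tmul {n : ℕ} (E : MultilinearMap k (fun _ : Fin n => A) B →ₗ[k]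
      MultilinearMap k (fun _ : Fin n => Pt k A) (Pt k B))
    (ψ : A →ₗ[k] MultilinearMap k (fun _ : Fin n => A) B) (t : Grassmann k) (a : A)
    (x : Fin n → Pt k A) : extSucc E ψ (t ⊗ₜ a) x = t • E (ψ a) x := rfl

/-- The linear extension of multilinear maps to points. -/
def extLin : ∀ n : ℕ, MultilinearMap k (fun _ : Fin n => A) B →ₗ[k]
    MultilinearMap k (fun _ : Fin n => Pt k A) (Pt k B)
  | 0 =>
    { toFun := fun φ => MultilinearMap.constOfIsEmpty k _ (1 ⊗ₜ φ Fin.elim0)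
      map_add' := fun φ ψ => by ext; simp [TensorProduct.tmul_add]
      map_smul' := fun r φ => by ext; simp }
  | n + 1 =>
    { toFun := fun φ => (extSucc (extLin n) φ.curryLeft).uncurryLeft
      map_add' := fun φ ψ => by
        have : extSucc (extLin n) (φ + ψ).curryLeft =
            extSucc (extLin n) φ.curryLeft + extSucc (extLin n) ψ.curryLeft :=
          TensorProduct.ext' fun t v => MultilinearMap.ext fun x => by
            have h : (φ + ψ).curryLeft v = φ.curryLeft v + ψ.curryLeft v := rfl
            change extSucc (extLin n) (φ + ψ).curryLeft (t ⊗ₜ v) x =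
              extSucc (extLin n) φ.curryLeft (t ⊗ₜ v) x + extSucc (extLin n) ψ.curryLeft (t ⊗ₜ v) x
            rw [extSucc_tmul, extSucc_tmul, extSucc_tmul, h, map_add, _root_.add_apply, smul_add]
        rw [this]
        rfl
      map_smul' := fun r φ => by
        have : extSucc (extLin n) (r • φ).curryLeft = r • extSucc (extLin n) φ.curryLeft :=
          TensorProduct.ext' fun t v => MultilinearMap.ext fun x => by
            have h : (r • φ).curryLeft v = r • φ.curryLeft v := rfl
            change extSucc (extLin n) (r • φ).curryLeft (t ⊗ₜ v) x =
              r • extSucc (extLin n) φ.curryLeft (t ⊗ₜ v) x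
            rw [extSucc_tmul, extSucc_tmul, h, map_smul, _root_.smul_apply, smul_comm]
        rw [this]
        rfl }

/-- The extension of a multilinear map to points:
`(t₁ ⊗ a₁, …, tₙ ⊗ aₙ) ↦ t₁ ⋯ tₙ ⊗ φ(a₁, …, aₙ)`. -/
def ext {n : ℕ} (φ : MultilinearMap k (fun _ : Fin n => A) B) :
    MultilinearMap k (fun _ : Fin n => Pt k A) (Pt k B) :=
  extLin n φ

theorem ext_cons_tmul {n : ℕ} (φ : MultilinearMap k (fun _ : Fin (n + 1) => A) B)
    (t : Grassmann k) (a : A) (x : Fin n → Pt k A) :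
    ext φ (Fin.cons (t ⊗ₜ a) x) = t • ext (φ.curryLeft a) x := by
  simp [ext, extLin, extSucc_tmul]

theorem ext_tmul {n : ℕ} (φ : MultilinearMap k (fun _ : Fin n => A) B)
    (t : Fin n → Grassmann k) (a : Fin n → A) :
    ext φ (fun i => t i ⊗ₜ a i) = (List.ofFn t).prod ⊗ₜ φ a := by
  induction n with
  | zero =>
    rw [Subsingleton.elim a Fin.elim0]
    simp [ext, extLin]
  | succ n ih =>
    have : (fun i => t i ⊗ₜ[k] a i) = (Fin.cons (t 0 ⊗ₜ a 0) fun i : Fin n => t i.succ ⊗ₜ a i.succ :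
        Fin (n + 1) → Pt k A) := by
      funext i; induction i using Fin.cases <;> rfl
    rw [this, ext_cons_tmul, ih, TensorProduct.smul_tmul', List.ofFn_succ, List.prod_cons,
      MultilinearMap.curryLeft_apply, smul_eq_mul]
    congr 2
    funext i; induction i using Fin.cases <;> rfl

/-- Multilinear maps on points agree if they agree on pure tensors. -/
theorem Pt.multilinear_ext {n : ℕ} {f g : MultilinearMap k (fun _ : Fin n => Pt k A) B}
    (h : ∀ (t : Fin n → Grassmann k) (a : Fin n → A),
      f (fun i => t i ⊗ₜ a i) = g (fun i => t i ⊗ₜ a i)) : f = g := by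
  refine MultilinearMap.ext fun x => ?_
  have := MultilinearMap.mem_of_mem_span (f - g) (fun _ => {y | ∃ t a, t ⊗ₜ[k] a = y}) ⊥ ?_ x
    fun i => by rw [TensorProduct.span_tmul_eq_top]; trivial
  · rwa [Submodule.mem_bot, sub_apply, sub_eq_zero] at this
  · intro y hy
    choose t a hta using hy
    obtain rfl : (fun i => t i ⊗ₜ a i) = y := funext hta
    rw [Submodule.mem_bot, sub_apply, h, sub_self]

@[simp]
theorem ext_add {n : ℕ} (φ ψ : MultilinearMap k (fun _ : Fin n => A) B) :
    ext (φ + ψ) = ext φ + ext ψ := map_add _ _ _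

@[simp]
theorem ext_sub {n : ℕ} (φ ψ : MultilinearMap k (fun _ : Fin n => A) B) :
    ext (φ - ψ) = ext φ - ext ψ :=
  Pt.multilinear_ext fun t a => by simp [ext_tmul, TensorProduct.tmul_sub]

@[simp]
theorem ext_zero {n : ℕ} : ext (0 : MultilinearMap k (fun _ : Fin n => A) B) = 0 := map_zero _

@[simp]
theorem ext_smul {n : ℕ} (r : k) (φ : MultilinearMap k (fun _ : Fin n => A) B) :
    ext (r • φ) = r • ext φ := map_smul _ _ _

theorem ext_nsmul {n : ℕ} (r : ℕ) (φ : MultilinearMap k (fun _ : Fin n => A) B) :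
    ext (r • φ) = r • ext φ := map_nsmul _ _ _

theorem ext_sum {n : ℕ} {ι : Type*} (s : Finset ι)
    (φ : ι → MultilinearMap k (fun _ : Fin n => A) B) :
    ext (∑ i ∈ s, φ i) = ∑ i ∈ s, ext (φ i) := map_sum _ _ _

/-- No parity of `a` is required: the coefficient of the first argument stands leftmost and crosses
nothing. -/
theorem ext_cons_smul {n : ℕ} (φ : MultilinearMap k (fun _ : Fin (n + 1) => A) B)
    (a : Grassmann k) (z : Pt k A) (x : Fin n → Pt k A) :
    ext φ (Fin.cons (a • z) x) = a • ext φ (Fin.cons z x) := by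
  induction z using TensorProduct.induction_on with
  | zero => simp only [← MultilinearMap.curryLeft_apply, smul_zero, map_zero,
      zero_apply]
  | tmul t v =>
    rw [TensorProduct.smul_tmul', ext_cons_tmul, ext_cons_tmul, smul_smul, smul_eq_mul]
  | add z z' h h' =>
    simp only [← MultilinearMap.curryLeft_apply, smul_add, map_add,
      add_apply] at h h' ⊢
    rw [h, h']

/-- Even parameters can be pulled out of the extension. -/
theorem ext_pow_smul {n : ℕ} (φ : MultilinearMap k (fun _ : Fin n => A) B) {h : Grassmann k}
    (hh : h ∈ Grassmann.part 0) (e : Fin n → ℕ) (x : Fin n → Pt k A) :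
    ext φ (fun i => h ^ e i • x i) = h ^ (∑ i, e i) • ext φ x := by
  have : ∀ (y : Fin n → Pt k A), ext φ (fun i => h ^ e i • y i) = h ^ (∑ i, e i) • ext φ y := by
    let L (m : ℕ) : Pt k A →ₗ[k] Pt k A := Algebra.lsmul k k (Pt k A) (h ^ m)
    have key : (ext φ).compLinearMap (fun i => L (e i)) =
        (Algebra.lsmul k k (Pt k B) (h ^ (∑ i, e i))).compMultilinearMap (ext φ) := by
      refine Pt.multilinear_ext fun t a => ?_
      simp only [MultilinearMap.compLinearMap_apply, L, Algebra.lsmul_coe,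
        TensorProduct.smul_tmul', ext_tmul, LinearMap.compMultilinearMap_apply]
      congr 1
      clear a φ
      induction n with
      | zero => simp
      | succ n ih =>
        have h1 := ih (fun i => e i.succ) (fun i => x i.succ) (fun i => t i.succ)
        simp only [smul_eq_mul, List.ofFn_succ, List.prod_cons, Fin.sum_univ_succ] at h1 ⊢
        rw [h1, mul_assoc, ← mul_assoc (t 0), ← Grassmann.even_mul (Grassmann.pow_mem_part hh _),
          pow_add, mul_assoc, mul_assoc]
    intro y
    exact congrArg (fun f => f y) key
  exact this x

theorem ext_smul_same {n : ℕ} (φ : MultilinearMap k (fun _ : Fin n => A) B) {h : Grassmann k}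
    (hh : h ∈ Grassmann.part 0) (x : Fin n → Pt k A) :
    ext φ (fun i => h • x i) = h ^ n • ext φ x := by
  simpa using ext_pow_smul φ hh (fun _ => 1) x

/-- The action of an endomorphism of the Grassmann algebra on points. -/
def Pt.map (s : Grassmann k →ₐ[k] Grassmann k) : Pt k A →ₗ[k] Pt k A :=
  LinearMap.rTensor A s.toLinearMap

@[simp]
theorem Pt.map_tmul (s : Grassmann k →ₐ[k] Grassmann k) (t : Grassmann k) (a : A) :
    Pt.map s (t ⊗ₜ[k] a) = s t ⊗ₜ a := rfl

theorem ext_map {n : ℕ} (φ : MultilinearMap k (fun _ : Fin n => A) B)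
    (s : Grassmann k →ₐ[k] Grassmann k) (x : Fin n → Pt k A) :
    ext φ (fun i => Pt.map s (x i)) = Pt.map s (ext φ x) := by
  have key : (ext φ).compLinearMap (fun _ => Pt.map s) =
      (Pt.map s).compMultilinearMap (ext φ) := by
    refine Pt.multilinear_ext fun t a => ?_
    simp only [MultilinearMap.compLinearMap_apply, Pt.map_tmul, ext_tmul,
      LinearMap.compMultilinearMap_apply, map_list_prod, List.map_ofFn]
    rfl
  exact congrArg (fun f => f x) key

/-- The extension of a linear map to points. -/
abbrev lin (f : A →ₗ[k] B) : Pt k A →ₗ[Grassmann k] Pt k B := f.baseChange (Grassmann k)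

theorem lin_map (f : A →ₗ[k] B) (s : Grassmann k →ₐ[k] Grassmann k) (x : Pt k A) :
    lin f (Pt.map s x) = Pt.map s (lin f x) := by
  induction x using TensorProduct.induction_on with
  | zero => simp
  | tmul t a => simp
  | add x y hx hy => rw [map_add, map_add, map_add, map_add, hx, hy]

theorem ext_compLinearMap {n : ℕ} (φ : MultilinearMap k (fun _ : Fin n => B) C)
    (f : Fin n → A →ₗ[k] B) (x : Fin n → Pt k A) :
    ext (φ.compLinearMap f) x = ext φ (fun i => lin (f i) (x i)) := by
  have key : ext (φ.compLinearMap f) =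
      (ext φ).compLinearMap (fun i => (lin (f i)).restrictScalars k) := by
    refine Pt.multilinear_ext fun t a => ?_
    simp [MultilinearMap.compLinearMap_apply, ext_tmul]
  rw [key]
  rfl

theorem ext_compMultilinearMap {n : ℕ} (g : B →ₗ[k] C)
    (φ : MultilinearMap k (fun _ : Fin n => A) B) (x : Fin n → Pt k A) :
    ext (g.compMultilinearMap φ) x = lin g (ext φ x) := by
  have key : ext (g.compMultilinearMap φ) =
      ((lin g).restrictScalars k).compMultilinearMap (ext φ) := by
    refine Pt.multilinear_ext fun t a => ?_
    simp [ext_tmul]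
  rw [key]
  rfl

/-- The linear map underlying a multilinear map in one variable. -/
def unary (φ : MultilinearMap k (fun _ : Fin 1 => A) B) : A →ₗ[k] B :=
  (MultilinearMap.ofSubsingleton k A B (0 : Fin 1)).symm φ

theorem unary_apply (φ : MultilinearMap k (fun _ : Fin 1 => A) B) (a : A) :
    unary φ a = φ fun _ => a := rfl

theorem ext_unary (φ : MultilinearMap k (fun _ : Fin 1 => A) B) (x : Fin 1 → Pt k A) :
    ext φ x = lin (unary φ) (x 0) := by
  have key : ext φ = MultilinearMap.ofSubsingleton k _ _ (0 : Fin 1)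
      ((lin (unary φ)).restrictScalars k) := by
    refine Pt.multilinear_ext fun t a => ?_
    rw [ext_tmul]
    simp [unary_apply, MultilinearMap.ofSubsingleton]
    congr 1
    exact congrArg _ (funext fun i => by rw [Fin.fin_one_eq_zero i])
  rw [key]
  rfl

/-- Blocks of a composition are consecutive, so the coefficients are only rebracketed. For this
reason `ext_compAlong` needs neither signs nor parity assumptions. -/
theorem prod_ofFn_composition {R : Type*} [Monoid R] {n : ℕ} (c : Composition n) (t : Fin n → R) :
    (List.ofFn fun r => (List.ofFn (t ∘ c.embedding r)).prod).prod = (List.ofFn t).prod := by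
  have h1 : (List.ofFn t).splitWrtComposition c =
      List.ofFn fun r => List.ofFn (t ∘ c.embedding r) := by
    refine List.ext_getElem (by simp) fun i hi hi' => ?_
    rw [List.getElem_splitWrtComposition, List.getElem_ofFn]
    have hlen : i < c.length := by simpa using hi'
    have hle : c.sizeUpTo (i + 1) ≤ n := c.sizeUpTo_le _
    have hs : c.sizeUpTo (i + 1) = c.sizeUpTo i + c.blocksFun ⟨i, hlen⟩ := c.sizeUpTo_succ' ⟨i, hlen⟩
    refine List.ext_getElem ?_ fun j hj hj' => ?_
    · simp
      omega
    · simp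
      congr 1
  have h2 := List.flatten_splitWrtCompositionAux (ns := c.blocks) (l := List.ofFn t) (by simp)
  have h3 : ((List.ofFn t).splitWrtComposition c).flatten = List.ofFn t := h2
  rw [← h3, List.prod_flatten, h1, List.map_ofFn]
  rfl

/-- The composite of a multilinear map with one multilinear map for every block of `c`. -/
def compAlong {n : ℕ} (c : Composition n) (φ : MultilinearMap k (fun _ : Fin c.length => B) C)
    (f : ∀ r, MultilinearMap k (fun _ : Fin (c.blocksFun r) => A) B) :
    MultilinearMap k (fun _ : Fin n => A) C :=
  (φ.compMultilinearMap f).domDomCongr c.blocksFinEquiv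

theorem compAlong_apply {n : ℕ} (c : Composition n)
    (φ : MultilinearMap k (fun _ : Fin c.length => B) C)
    (f : ∀ r, MultilinearMap k (fun _ : Fin (c.blocksFun r) => A) B) (a : Fin n → A) :
    compAlong c φ f a = φ fun r => f r fun j => a (c.embedding r j) := rfl

theorem ext_compAlong {n : ℕ} (c : Composition n)
    (φ : MultilinearMap k (fun _ : Fin c.length => B) C)
    (f : ∀ r, MultilinearMap k (fun _ : Fin (c.blocksFun r) => A) B) (x : Fin n → Pt k A) :
    ext (compAlong c φ f) x = ext φ fun r => ext (f r) fun j => x (c.embedding r j) := by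
  have key : ext (compAlong c φ f) = compAlong c (ext φ) fun r => ext (f r) := by
    refine Pt.multilinear_ext fun t a => ?_
    rw [compAlong_apply, ext_tmul, compAlong_apply]
    simp_rw [ext_tmul]
    rw [← prod_ofFn_composition c]
    rfl
  rw [key]
  rfl

theorem prod_ofFn_castLE {R : Type*} [Monoid R] {n : ℕ} (i : Fin (n + 1)) (t : Fin n → R) :
    (List.ofFn fun j : Fin (i : ℕ) => t (Fin.castLE i.is_le j)).prod *
      (List.ofFn fun j : Fin (n - (i : ℕ)) => t ⟨(i : ℕ) + (j : ℕ), by omega⟩).prod =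
      (List.ofFn t).prod := by
  rw [← List.prod_append, ← List.ofFn_fin_append]
  have h : (i : ℕ) + (n - i) = n := Nat.add_sub_of_le i.is_le
  rw [List.ofFn_congr h]
  congr 2
  funext j
  rcases lt_or_ge (j : ℕ) i with hj | hj
  · rw [show Fin.cast h.symm j = Fin.castAdd _ ⟨j, hj⟩ from rfl, Fin.append_left]
    rfl
  · rw [show Fin.cast h.symm j = Fin.natAdd _ ⟨j - i, by omega⟩ from Fin.ext (by simp; omega),
      Fin.append_right]
    congr 1
    exact Fin.ext (by simp; omega)

/-- The insertion of `δ` into the first argument of `φ`. -/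
def insertFirst {n : ℕ} (i : Fin (n + 1))
    (φ : MultilinearMap k (fun _ : Fin (n - i + 1) => A) B)
    (δ : MultilinearMap k (fun _ : Fin (i : ℕ) => A) A) :
    MultilinearMap k (fun _ : Fin n => A) B :=
  (MultilinearMap.uncurrySum (φ.curryLeft.compMultilinearMap δ)).domDomCongr
    (finSumFinEquiv.trans (finCongr (Nat.add_sub_of_le i.is_le)))

theorem insertFirst_apply {n : ℕ} (i : Fin (n + 1))
    (φ : MultilinearMap k (fun _ : Fin (n - i + 1) => A) B)
    (δ : MultilinearMap k (fun _ : Fin (i : ℕ) => A) A) (a : Fin n → A) :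
    insertFirst i φ δ a = φ (Fin.cons (δ fun j => a (Fin.castLE i.is_le j))
      fun j : Fin (n - (i : ℕ)) => a ⟨(i : ℕ) + (j : ℕ), by omega⟩) := rfl

theorem ext_insertFirst {n : ℕ} (i : Fin (n + 1))
    (φ : MultilinearMap k (fun _ : Fin (n - i + 1) => A) B)
    (δ : MultilinearMap k (fun _ : Fin (i : ℕ) => A) A) (x : Fin n → Pt k A) :
    ext (insertFirst i φ δ) x = ext φ (Fin.cons (ext δ fun j => x (Fin.castLE i.is_le j))
      fun j : Fin (n - (i : ℕ)) => x ⟨(i : ℕ) + (j : ℕ), by omega⟩) := by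
  have key : ext (insertFirst i φ δ) = insertFirst i (ext φ) (ext δ) := by
    refine Pt.multilinear_ext fun t a => ?_
    rw [insertFirst_apply, ext_tmul, insertFirst_apply, ext_tmul, ext_cons_tmul, ext_tmul,
      TensorProduct.smul_tmul', smul_eq_mul, prod_ofFn_castLE]
    rfl
  rw [key]
  rfl

end Extension

end LInfty

/-! ### Even points and polarization. -/

namespace LInfty

open scoped TensorProduct

section Points

variable {k : Type u} [CommRing k] {A B C : Type*} [AddCommGroup A] [Module k A]
  [AddCommGroup B] [Module k B] [AddCommGroup C] [Module k C]

/-- Adding or removing a fixed index outside `R` is a sign-reversing involution on the sets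
containing `R`. -/
theorem sum_neg_one_pow_of_subset {n : ℕ} (R : Finset (Fin n)) (hR : R ≠ Finset.univ) :
    ∑ T : Finset (Fin n), (if R ⊆ T then (-1 : ℤ) ^ T.card else 0) = 0 := by
  obtain ⟨i, hi⟩ : ∃ i, i ∉ R := by
    by_contra! h
    exact hR (Finset.eq_univ_iff_forall.mpr h)
  refine Finset.sum_involution (fun T _ => if i ∈ T then T.erase i else insert i T) ?_ ?_ ?_ ?_
  · intro T _
    by_cases hT : i ∈ T
    · have h1 : R ⊆ T.erase i ↔ R ⊆ T :=
        ⟨fun h => h.trans (Finset.erase_subset _ _), fun h => Finset.subset_erase.mpr ⟨h, hi⟩⟩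
      have h2 : T.card = (T.erase i).card + 1 := (Finset.card_erase_add_one hT).symm
      simp only [hT, if_true, h1, h2, pow_succ]
      split_ifs <;> ring
    · have h1 : R ⊆ insert i T ↔ R ⊆ T := by
        rw [Finset.subset_insert_iff, Finset.erase_eq_of_notMem hi]
      simp only [hT, if_false, h1, Finset.card_insert_of_notMem hT, pow_succ]
      split_ifs <;> ring
  · intro T _ _ h
    by_cases hT : i ∈ T
    · simp only [hT, if_true] at h
      exact Finset.notMem_erase i T (by rw [h]; exact hT)
    · simp only [hT, if_false] at h
      exact hT (by rw [← h]; exact Finset.mem_insert_self i T)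
  · exact fun _ _ => Finset.mem_univ _
  · intro T _
    by_cases hT : i ∈ T
    · simp [hT, Finset.insert_erase]
    · simp [hT]

/-- Polarization: a multilinear map which vanishes on the diagonal has vanishing symmetrization. -/
theorem MultilinearMap.sum_perm_eq_zero {n : ℕ} (f : MultilinearMap k (fun _ : Fin n => A) B)
    (S : Submodule k A) (hf : ∀ x ∈ S, f (fun _ => x) = 0) (y : Fin n → A) (hy : ∀ i, y i ∈ S) :
    ∑ σ : Equiv.Perm (Fin n), f (fun i => y (σ i)) = 0 := by
  have h1 : ∀ T : Finset (Fin n), f (fun _ => ∑ i ∈ T, y i) =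
      ∑ g : Fin n → Fin n, if Finset.univ.image g ⊆ T then f (fun i => y (g i)) else 0 := by
    intro T
    rw [MultilinearMap.map_sum_finset f (fun _ => y) (fun _ => T), ← Finset.sum_filter]
    refine Finset.sum_congr (Finset.ext fun g => ?_) fun _ _ => rfl
    simp [Fintype.mem_piFinset, Finset.subset_iff]
  -- Inclusion-exclusion: the alternating sum of the diagonal values f(y_T, …, y_T), where y_T is
  -- the sum of y_i over i in T, cancels every term whose index function is not surjective. Only
  -- permutations survive, with the common sign (-1)^n.
  have h2 : ∑ g : Fin n → Fin n, (∑ T : Finset (Fin n),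
      if Finset.univ.image g ⊆ T then (-1 : ℤ) ^ T.card else 0) • f (fun i => y (g i)) = 0 := by
    calc _ = ∑ T : Finset (Fin n), (-1 : ℤ) ^ T.card • f (fun _ => ∑ i ∈ T, y i) := by
          simp_rw [h1, Finset.smul_sum, Finset.sum_smul]
          rw [Finset.sum_comm]
          refine Finset.sum_congr rfl fun T _ => Finset.sum_congr rfl fun g _ => ?_
          split_ifs <;> simp
      _ = 0 := Finset.sum_eq_zero fun T _ => by
          rw [hf _ (Submodule.sum_mem _ fun i _ => hy i), smul_zero]
  have h3 : ∑ g : Fin n → Fin n, (∑ T : Finset (Fin n),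
      if Finset.univ.image g ⊆ T then (-1 : ℤ) ^ T.card else 0) • f (fun i => y (g i)) =
      ∑ σ : Equiv.Perm (Fin n), (-1 : ℤ) ^ n • f (fun i => y (σ i)) := by
    symm
    refine Finset.sum_of_injOn (fun σ => (σ : Fin n → Fin n)) ?_ ?_ ?_ ?_
    · exact fun σ _ τ _ h => Equiv.ext (congrFun h)
    · exact fun _ _ => Finset.mem_coe.mpr (Finset.mem_univ _)
    · intro g _ hg
      rw [sum_neg_one_pow_of_subset, zero_smul]
      intro h
      apply hg
      have hs : Function.Surjective g := fun b => by
        have := Finset.mem_univ b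
        rw [← h] at this
        simpa using this
      exact ⟨Equiv.ofBijective g (Finite.surjective_iff_bijective.mp hs), by simp, rfl⟩
    · intro σ _
      have : Finset.univ.image (σ : Fin n → Fin n) = Finset.univ :=
        Finset.image_univ_of_surjective σ.surjective
      simp only [this, Finset.univ_subset_iff]
      rw [Finset.sum_ite_eq' Finset.univ (Finset.univ : Finset (Fin n))]
      simp
  rw [h3, ← Finset.smul_sum] at h2
  rcases neg_one_pow_eq_or ℤ n with h | h <;> rw [h] at h2 <;> simpa using h2

theorem smul_factorial_inv [Algebra ℚ k] (n : ℕ) (x : A) :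
    algebraMap ℚ k ((n.factorial : ℚ)⁻¹) • (n.factorial • x) = x := by
  rw [← Nat.cast_smul_eq_nsmul k, smul_smul, ← map_natCast (algebraMap ℚ k), ← map_mul,
    inv_mul_cancel₀ (by exact_mod_cast n.factorial_ne_zero), map_one, one_smul]

theorem eq_zero_of_factorial_smul [Algebra ℚ k] {n : ℕ} {x : A} (h : n.factorial • x = 0) :
    x = 0 := by
  rw [← smul_factorial_inv (k := k) n x, h, smul_zero]

/-- A family of submodules, the elements of degree `i`, together with a projection to the part of
even degree. -/
structure Grading (k : Type u) [CommRing k] (A : Type*) [AddCommGroup A] [Module k A] where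
  deg : ℤ → Submodule k A
  even : A →ₗ[k] A
  even_of_even : ∀ i, Even i → ∀ a ∈ deg i, even a = a
  even_of_odd : ∀ i, Odd i → ∀ a ∈ deg i, even a = 0

/-- `φ` is homogeneous of degree `d`. -/
def HasDeg (𝒜 : Grading k A) (ℬ : Grading k B) (d : ℤ) {n : ℕ}
    (φ : MultilinearMap k (fun _ : Fin n => A) B) : Prop :=
  ∀ (p : Fin n → ℤ) (a : Fin n → A), (∀ i, a i ∈ 𝒜.deg (p i)) → φ a ∈ ℬ.deg (∑ i, p i + d)

/-- `φ` is graded symmetric. -/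
def IsSymm (𝒜 : Grading k A) {n : ℕ} (φ : MultilinearMap k (fun _ : Fin n => A) B) : Prop :=
  ∀ (p : Fin n → ℤ) (a : Fin n → A), (∀ i, a i ∈ 𝒜.deg (p i)) → ∀ σ : Equiv.Perm (Fin n),
    φ (fun i => a (σ i)) = koszulSign p σ • φ a

/-- The points of parity `e`. -/
def Grading.pts (𝒜 : Grading k A) (e : ZMod 2) : Submodule k (Pt k A) :=
  Submodule.span k {x | ∃ (i : ℤ) (t : Grassmann k) (a : A),
    t ∈ Grassmann.part ((i : ZMod 2) + e) ∧ a ∈ 𝒜.deg i ∧ t ⊗ₜ a = x}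

variable {𝒜 : Grading k A} {ℬ : Grading k B}

theorem smul_mem_pts {e p : ZMod 2} {t : Grassmann k} {x : Pt k A} (ht : t ∈ Grassmann.part p)
    (hx : x ∈ 𝒜.pts e) : t • x ∈ 𝒜.pts (p + e) := by
  induction hx using Submodule.span_induction with
  | mem x hx =>
    obtain ⟨i, t', a, ht', ha, rfl⟩ := hx
    refine Submodule.subset_span ⟨i, t * t', a, ?_, ha, rfl⟩
    rw [add_left_comm]
    exact Grassmann.mul_mem_part ht ht'
  | zero => rw [smul_zero]; exact zero_mem _
  | add x y _ _ hx hy => rw [smul_add]; exact add_mem hx hy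
  | smul r x _ hx => rw [smul_comm]; exact Submodule.smul_mem _ _ hx

theorem even_smul_mem_pts {e : ZMod 2} {t : Grassmann k} {x : Pt k A} (ht : t ∈ Grassmann.part 0)
    (hx : x ∈ 𝒜.pts e) : t • x ∈ 𝒜.pts e := by
  have := smul_mem_pts ht hx
  rwa [zero_add] at this

theorem odd_smul_mem_pts {t : Grassmann k} {x : Pt k A} (ht : t ∈ Grassmann.part 1)
    (hx : x ∈ 𝒜.pts 1) : t • x ∈ 𝒜.pts 0 := by
  have := smul_mem_pts ht hx
  rwa [show (1 : ZMod 2) + 1 = 0 from rfl] at this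

theorem map_mem_pts {e : ZMod 2} {s : Grassmann k →ₐ[k] Grassmann k}
    (hs : ∀ p, ∀ a ∈ Grassmann.part p, s a ∈ Grassmann.part p) {x : Pt k A} (hx : x ∈ 𝒜.pts e) :
    Pt.map s x ∈ 𝒜.pts e := by
  induction hx using Submodule.span_induction with
  | mem x hx =>
    obtain ⟨i, t', a, ht', ha, rfl⟩ := hx
    exact Submodule.subset_span ⟨i, s t', a, hs _ _ ht', ha, rfl⟩
  | zero => rw [map_zero]; exact zero_mem _
  | add x y _ _ hx hy => rw [map_add]; exact add_mem hx hy
  | smul r x _ hx => rw [map_smul]; exact Submodule.smul_mem _ _ hx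

theorem ext_mem_pts {d : ℤ} {n : ℕ} {φ : MultilinearMap k (fun _ : Fin n => A) B}
    (hφ : HasDeg 𝒜 ℬ d φ) {x : Fin n → Pt k A} (hx : ∀ i, x i ∈ 𝒜.pts 0) :
    ext φ x ∈ ℬ.pts d := by
  refine MultilinearMap.mem_of_mem_span (ext φ) (fun _ => _) _ (fun y hy => ?_) x hx
  choose p t a ht ha hy using hy
  obtain rfl : (fun i => t i ⊗ₜ a i) = y := funext hy
  rw [ext_tmul]
  refine Submodule.subset_span ⟨_, _, _, ?_, hφ p a ha, rfl⟩
  have h2 : ∀ d : ZMod 2, d + d = 0 := by decide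
  have := Grassmann.prod_mem_part ht
  simpa [add_assoc, h2] using this

theorem lin_mem_pts {d : ℤ} {f : A →ₗ[k] B} (hf : ∀ i, ∀ a ∈ 𝒜.deg i, f a ∈ ℬ.deg (i + d))
    {e : ZMod 2} {x : Pt k A} (hx : x ∈ 𝒜.pts e) : lin f x ∈ ℬ.pts (e + d) := by
  induction hx using Submodule.span_induction with
  | mem x hx =>
    obtain ⟨i, t', a, ht', ha, rfl⟩ := hx
    refine Submodule.subset_span ⟨i + d, t', f a, ?_, hf i a ha, rfl⟩
    have h2 : ∀ i d e : ZMod 2, i + d + (e + d) = i + e := by decide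
    push_cast
    rwa [h2]
  | zero => rw [map_zero]; exact zero_mem _
  | add x y _ _ hx hy => rw [map_add]; exact add_mem hx hy
  | smul r x _ hx =>
    rw [LinearMap.map_smul_of_tower]; exact Submodule.smul_mem _ _ hx

/-- Restoring the order of the coefficients after a permutation produces exactly its Koszul sign,
because each coefficient has the parity of its element. -/
theorem sum_perm_tmul {n : ℕ} (φ : MultilinearMap k (fun _ : Fin n => A) B) {p : Fin n → ℤ}
    {t : Fin n → Grassmann k} (ht : ∀ i, t i ∈ Grassmann.part (p i : ZMod 2)) (a : Fin n → A) :
    ∑ σ : Equiv.Perm (Fin n), ext φ (fun i => t (σ i) ⊗ₜ a (σ i)) =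
      (List.ofFn t).prod ⊗ₜ ∑ σ : Equiv.Perm (Fin n), koszulSign p σ • φ fun i => a (σ i) := by
  rw [TensorProduct.tmul_sum]
  refine Finset.sum_congr rfl fun σ _ => ?_
  rw [ext_tmul]
  have := prod_ofFn_perm p t (fun i j _ => Grassmann.mul_comm_of_mem (ht i) (ht j)) σ
  rw [show (fun i => t (σ i)) = t ∘ σ from rfl, this, Units.smul_def, Units.smul_def,
    ← Int.cast_smul_eq_zsmul k, ← Int.cast_smul_eq_zsmul k, TensorProduct.tmul_smul,
    TensorProduct.smul_tmul']

theorem part_of_add_zero {i : ℤ} {t : Grassmann k}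
    (ht : t ∈ Grassmann.part ((i : ZMod 2) + 0)) : t ∈ Grassmann.part (i : ZMod 2) := by
  rwa [add_zero] at ht

/-- The multilinear map `∑_σ φ(x_{σ(1)}, …, x_{σ(n)})`. -/
def sumPerm {n : ℕ} (φ : MultilinearMap k (fun _ : Fin n => A) B) :
    MultilinearMap k (fun _ : Fin n => A) B :=
  ∑ σ : Equiv.Perm (Fin n), φ.domDomCongr σ

theorem sumPerm_apply {n : ℕ} (φ : MultilinearMap k (fun _ : Fin n => A) B) (x : Fin n → A) :
    sumPerm φ x = ∑ σ : Equiv.Perm (Fin n), φ (fun i => x (σ i)) := by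
  simp [sumPerm]

theorem sumPerm_diag {n : ℕ} (φ : MultilinearMap k (fun _ : Fin n => A) B) (x : A) :
    sumPerm φ (fun _ => x) = n.factorial • φ (fun _ => x) := by
  simp [sumPerm_apply, Fintype.card_perm]

/-- Multilinear identities on even points can be checked on homogeneous elements. -/
theorem sumPerm_ext_mem {n : ℕ} (φ : MultilinearMap k (fun _ : Fin n => A) B)
    (ψ : MultilinearMap k (fun _ : Fin n => A) B)
    (h : ∀ (p : Fin n → ℤ) (a : Fin n → A), (∀ i, a i ∈ 𝒜.deg (p i)) →
      ∑ σ : Equiv.Perm (Fin n), koszulSign p σ • φ (fun i => a (σ i)) = ψ a)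
    {x : Fin n → Pt k A} (hx : ∀ i, x i ∈ 𝒜.pts 0) :
    ∑ σ : Equiv.Perm (Fin n), ext φ (fun i => x (σ i)) = ext ψ x := by
  have := MultilinearMap.mem_of_mem_span (sumPerm (ext φ) - ext ψ) (fun _ => _) ⊥ ?_ x hx
  · rw [Submodule.mem_bot] at this
    rw [← sumPerm_apply]
    exact sub_eq_zero.mp this
  · intro y hy
    choose p t a ht ha hy using hy
    obtain rfl : (fun i => t i ⊗ₜ a i) = y := funext hy
    rw [Submodule.mem_bot]
    refine sub_eq_zero.mpr ?_
    rw [sumPerm_apply, sum_perm_tmul φ (fun i => part_of_add_zero (ht i)), h p a ha, ext_tmul]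

/-- By multilinearity it suffices to test pure tensors, where the sum over permutations is the
Koszul-signed sum. On the diagonal that sum has n! equal terms, and n! is invertible. The converse
direction is `koszul_sum_eq_zero`. -/
theorem ext_diag_eq_zero [Algebra ℚ k] {n : ℕ} {φ : MultilinearMap k (fun _ : Fin n => A) B}
    (h : ∀ (p : Fin n → ℤ) (a : Fin n → A), (∀ i, a i ∈ 𝒜.deg (p i)) →
      ∑ σ : Equiv.Perm (Fin n), koszulSign p σ • φ (fun i => a (σ i)) = 0)
    {x : Pt k A} (hx : x ∈ 𝒜.pts 0) : ext φ (fun _ => x) = 0 := by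
  have := sumPerm_ext_mem φ 0 (fun p a ha => h p a ha) (x := fun _ => x) fun _ => hx
  refine eq_zero_of_factorial_smul (k := k) (n := n) ?_
  rw [← sumPerm_diag, sumPerm_apply, this, ext_zero]
  rfl

/-- The sign from reordering the coefficients cancels the sign from graded symmetry. -/
theorem ext_perm_of_isSymm {n : ℕ} {φ : MultilinearMap k (fun _ : Fin n => A) B}
    (hφ : IsSymm 𝒜 φ) {x : Fin n → Pt k A} (hx : ∀ i, x i ∈ 𝒜.pts 0)
    (σ : Equiv.Perm (Fin n)) : ext φ (fun i => x (σ i)) = ext φ x := by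
  have := MultilinearMap.mem_of_mem_span ((ext φ).domDomCongr σ - ext φ) (fun _ => _) ⊥ ?_ x hx
  · exact sub_eq_zero.mp ((Submodule.mem_bot k).mp this)
  · intro y hy
    choose p t a ht ha hy using hy
    obtain rfl : (fun i => t i ⊗ₜ a i) = y := funext hy
    rw [Submodule.mem_bot]
    refine sub_eq_zero.mpr ?_
    rw [MultilinearMap.domDomCongr_apply, ext_tmul, ext_tmul]
    have := prod_ofFn_perm p t (fun i j _ => Grassmann.mul_comm_of_mem
      (part_of_add_zero (ht i)) (part_of_add_zero (ht j))) σ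
    rw [show (fun i => t (σ i)) = t ∘ σ from rfl, this, hφ p a ha, Units.smul_def, Units.smul_def,
      ← Int.cast_smul_eq_zsmul k, ← Int.cast_smul_eq_zsmul k, TensorProduct.tmul_smul,
      ← TensorProduct.smul_tmul', smul_smul, ← Int.cast_mul, ← Units.val_mul,
      Int.units_mul_self, Units.val_one, Int.cast_one, one_smul]

theorem tmul_mem_pts {i : ℤ} {t : Grassmann k} {a : A} (ht : t ∈ Grassmann.part (i : ZMod 2))
    (ha : a ∈ 𝒜.deg i) : t ⊗ₜ a ∈ 𝒜.pts 0 :=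
  Submodule.subset_span ⟨i, t, a, by rwa [add_zero], ha, rfl⟩

/-- A multilinear map which vanishes on the diagonal of the even points has vanishing graded
symmetrization. -/
theorem koszul_sum_eq_zero {n : ℕ} {φ : MultilinearMap k (fun _ : Fin n => A) B}
    (h : ∀ x ∈ 𝒜.pts 0, ext φ (fun _ => x) = 0) (p : Fin n → ℤ) (a : Fin n → A)
    (ha : ∀ i, a i ∈ 𝒜.deg (p i)) :
    ∑ σ : Equiv.Perm (Fin n), koszulSign p σ • φ (fun i => a (σ i)) = 0 := by
  -- Coefficients of the right parity turn the given elements into even points; the functional `c`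
  -- takes their product to 1 and so recovers the identity over `k`.
  obtain ⟨t, c, ht, hc⟩ := Grassmann.exists_independent (k := k) p
  have := MultilinearMap.sum_perm_eq_zero (ext φ) (𝒜.pts 0) h (fun i => t i ⊗ₜ a i)
    fun i => tmul_mem_pts (ht i) (ha i)
  rw [sum_perm_tmul φ ht a] at this
  have := congrArg (TensorProduct.lid k B ∘ LinearMap.rTensor B c) this
  simpa [hc] using this

section Symmetrization

/-- The projections to the even and the odd part. -/
def Grading.proj (𝒜 : Grading k A) (e : Fin 2) : A →ₗ[k] A :=
  if e = 0 then 𝒜.even else LinearMap.id - 𝒜.even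

theorem Grading.proj_apply (𝒜 : Grading k A) (e : Fin 2) {i : ℤ} {a : A} (ha : a ∈ 𝒜.deg i) :
    𝒜.proj e a = if ((e : ℕ) : ZMod 2) = i then a else 0 := by
  rcases Int.even_or_odd i with h | h
  · rw [h.intCast_zmod_two]
    fin_cases e
    · simp [Grading.proj, 𝒜.even_of_even i h a ha]
    · simp [Grading.proj, 𝒜.even_of_even i h a ha]
  · have : ((i : ℤ) : ZMod 2) = 1 := by
      obtain ⟨m, rfl⟩ := h
      push_cast
      rw [show (2 : ZMod 2) = 0 from rfl, zero_mul, zero_add]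
    rw [this]
    fin_cases e
    · simp [Grading.proj, 𝒜.even_of_odd i h a ha]
    · simp [Grading.proj, 𝒜.even_of_odd i h a ha]

/-- The sum of all permutations of a multilinear map, with Koszul signs. -/
def symm (𝒜 : Grading k A) {n : ℕ} (φ : MultilinearMap k (fun _ : Fin n => A) B) :
    MultilinearMap k (fun _ : Fin n => A) B :=
  ∑ q : Fin n → Fin 2, ∑ σ : Equiv.Perm (Fin n),
    ((koszulSign (fun i => ((q i : ℕ) : ℤ)) σ : ℤˣ) : ℤ) •
      (φ.domDomCongr σ).compLinearMap fun i => 𝒜.proj (q i)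

/-- Of all parity patterns `q`, only that of the degrees `p` survives the projections, and for it
the two Koszul signs agree. -/
theorem symm_apply {n : ℕ} (φ : MultilinearMap k (fun _ : Fin n => A) B) {p : Fin n → ℤ}
    {a : Fin n → A} (ha : ∀ i, a i ∈ 𝒜.deg (p i)) :
    symm 𝒜 φ a = ∑ σ : Equiv.Perm (Fin n), koszulSign p σ • φ (fun i => a (σ i)) := by
  have hq : ∀ i : ℤ, ∃ e : Fin 2, ((e : ℕ) : ZMod 2) = i := fun i => by
    have : ∀ z : ZMod 2, ∃ e : Fin 2, ((e : ℕ) : ZMod 2) = z := by decide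
    exact this _
  have hinj : ∀ e e' : Fin 2, ((e : ℕ) : ZMod 2) = ((e' : ℕ) : ZMod 2) → e = e' := by decide
  choose q hq using fun i => hq (p i)
  rw [symm, _root_.sum_apply, Finset.sum_eq_single q]
  · rw [_root_.sum_apply]
    refine Finset.sum_congr rfl fun σ _ => ?_
    rw [koszulSign_congr (p := fun i => ((q i : ℕ) : ℤ)) (q := p)
      (fun i => by rw [← hq]; push_cast; rfl), Units.smul_def,
      _root_.smul_apply]
    change _ • φ (fun i => 𝒜.proj (q (σ i)) (a (σ i))) = _
    congr 2
    funext i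
    rw [𝒜.proj_apply _ (ha _), if_pos (hq _)]
  · intro q' _ hq'
    obtain ⟨i, hi⟩ : ∃ i, q' i ≠ q i := by
      by_contra! h
      exact hq' (funext h)
    rw [_root_.sum_apply]
    refine Finset.sum_eq_zero fun σ _ => ?_
    rw [_root_.smul_apply]
    change _ • φ (fun i => 𝒜.proj (q' (σ i)) (a (σ i))) = _
    rw [φ.map_coord_zero (σ.symm i), smul_zero]
    rw [Equiv.apply_symm_apply, 𝒜.proj_apply _ (ha _), if_neg]
    intro h
    exact hi (hinj _ _ (h.trans (hq i).symm))
  · simp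

theorem units_smul_mem {S : Submodule k A} {a : A} (ha : a ∈ S) (ε : ℤˣ) : ε • a ∈ S := by
  rw [Units.smul_def]
  exact zsmul_mem ha _

variable [Algebra ℚ k]

/-- The graded symmetric part of a multilinear map. -/
def avg (𝒜 : Grading k A) {n : ℕ} (φ : MultilinearMap k (fun _ : Fin n => A) B) :
    MultilinearMap k (fun _ : Fin n => A) B :=
  algebraMap ℚ k ((n.factorial : ℚ)⁻¹) • symm 𝒜 φ

theorem hasDeg_avg {d : ℤ} {n : ℕ} {φ : MultilinearMap k (fun _ : Fin n => A) B}
    (hφ : HasDeg 𝒜 ℬ d φ) : HasDeg 𝒜 ℬ d (avg 𝒜 φ) := by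
  intro p a ha
  refine Submodule.smul_mem _ _ ?_
  rw [symm_apply φ ha]
  refine Submodule.sum_mem _ fun σ _ => units_smul_mem ?_ _
  have := hφ (fun i => p (σ i)) (fun i => a (σ i)) fun i => ha (σ i)
  rwa [Equiv.sum_comp σ p] at this

/-- The cocycle rule `koszulSign_mul` together with the reindexing σ ↦ ρσ. -/
theorem isSymm_avg {n : ℕ} (φ : MultilinearMap k (fun _ : Fin n => A) B) :
    IsSymm 𝒜 (avg 𝒜 φ) := by
  intro p a ha ρ
  rw [avg, _root_.smul_apply, _root_.smul_apply, symm_apply φ ha, symm_apply φ (p := fun i => p (ρ i)) fun i => ha (ρ i), smul_comm]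
  congr 1
  rw [Finset.smul_sum]
  refine Fintype.sum_equiv (Equiv.mulLeft ρ) _ _ fun σ => ?_
  rw [Equiv.coe_mulLeft, koszulSign_mul, smul_smul, ← mul_assoc, koszulSign_mul_self, one_mul]
  rfl

/-- Averaging is invisible on the diagonal of even points. Correction terms can therefore be written
down without symmetry and symmetrized afterwards at no cost. -/
theorem ext_avg_diag {n : ℕ} (φ : MultilinearMap k (fun _ : Fin n => A) B) {x : Pt k A}
    (hx : x ∈ 𝒜.pts 0) : ext (avg 𝒜 φ) (fun _ => x) = ext φ (fun _ => x) := by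
  have := sumPerm_ext_mem φ (symm 𝒜 φ) (fun p a ha => (symm_apply φ ha).symm)
    (x := fun _ => x) fun _ => hx
  rw [avg, ext_smul, _root_.smul_apply, ← this, Finset.sum_const, Finset.card_univ, Fintype.card_perm, Fintype.card_fin,
    smul_factorial_inv]

/-- A multilinear map which is symmetric on the even points and vanishes on their diagonal is
zero there. -/
theorem MultilinearMap.eq_zero_of_diag {n : ℕ} (f : MultilinearMap k (fun _ : Fin n => A) B)
    (S : Submodule k A) (hf : ∀ x ∈ S, f (fun _ => x) = 0)
    (hs : ∀ y : Fin n → A, (∀ i, y i ∈ S) → ∀ σ : Equiv.Perm (Fin n),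
      f (fun i => y (σ i)) = f y) (y : Fin n → A) (hy : ∀ i, y i ∈ S) : f y = 0 := by
  have := MultilinearMap.sum_perm_eq_zero f S hf y hy
  simp_rw [hs y hy] at this
  rw [Finset.sum_const, Finset.card_univ, Fintype.card_perm, Fintype.card_fin] at this
  exact eq_zero_of_factorial_smul (k := k) this

end Symmetrization

end Points

end LInfty

/-! ### Power series evaluated at nilpotent points. -/

namespace LInfty

open scoped TensorProduct

section Sequences

variable {k : Type u} [CommRing k] {A B C : Type*} [AddCommGroup A] [Module k A]
  [AddCommGroup B] [Module k B] [AddCommGroup C] [Module k C]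

/-- Sequences of multilinear maps. -/
abbrev MSeq (k : Type u) [CommRing k] (A B : Type*) [AddCommGroup A] [Module k A]
    [AddCommGroup B] [Module k B] :=
  ∀ n : ℕ, MultilinearMap k (fun _ : Fin n => A) B

/-- The composite of sequences of multilinear maps, considered as power series. -/
def compSeq (Φ : MSeq k B C) (F : MSeq k A B) : MSeq k A C := fun n =>
  ∑ c : Composition n, compAlong c (Φ c.length) fun r => F (c.blocksFun r)

/-- The derivative of the power series `Φ` in the direction of the vector field `D`. -/
def insSeq (Φ : MSeq k A B) (D : MSeq k A A) : MSeq k A B := fun n =>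
  ∑ i : Fin (n + 1), (n - (i : ℕ) + 1) • insertFirst i (Φ (n - i + 1)) (D i)

/-- The value of the extension of a multilinear map on the diagonal. -/
abbrev diag {n : ℕ} (φ : MultilinearMap k (fun _ : Fin n => A) B) (x : Pt k A) : Pt k B :=
  ext φ fun _ => x

theorem diag_compSeq (Φ : MSeq k B C) (F : MSeq k A B) (n : ℕ) (x : Pt k A) :
    diag (compSeq Φ F n) x =
      ∑ c : Composition n, ext (Φ c.length) fun r => diag (F (c.blocksFun r)) x := by
  rw [diag, compSeq, ext_sum, _root_.sum_apply]
  exact Finset.sum_congr rfl fun c _ => ext_compAlong _ _ _ _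

theorem diag_insSeq (Φ : MSeq k A B) (D : MSeq k A A) (n : ℕ) (x : Pt k A) :
    diag (insSeq Φ D n) x = ∑ i ∈ Finset.range (n + 1),
      (n - i + 1) • ext (Φ (n - i + 1)) (Fin.cons (diag (D i) x) fun _ => x) := by
  rw [diag, insSeq, ext_sum, _root_.sum_apply,
    ← Fin.sum_univ_eq_sum_range fun i =>
      (n - i + 1) • ext (Φ (n - i + 1)) (Fin.cons (diag (D i) x) fun _ => x)]
  refine Finset.sum_congr rfl fun i _ => ?_
  rw [ext_nsmul, _root_.smul_apply, ext_insertFirst]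

theorem hasDeg_compSeq {𝒜 : Grading k A} {ℬ : Grading k B} {𝒞 : Grading k C} {d : ℤ}
    {Φ : MSeq k B C} {F : MSeq k A B} (hΦ : ∀ n, HasDeg ℬ 𝒞 d (Φ n))
    (hF : ∀ n, HasDeg 𝒜 ℬ 0 (F n)) (n : ℕ) : HasDeg 𝒜 𝒞 d (compSeq Φ F n) := by
  intro p a ha
  rw [compSeq, _root_.sum_apply]
  refine Submodule.sum_mem _ fun c _ => ?_
  have h1 := hΦ c.length (fun r => ∑ j, p (c.embedding r j) + 0)
    (fun r => F _ fun j => a (c.embedding r j)) fun r => hF _ _ _ fun j => ha _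
  have h2 : ∑ i, p i = ∑ r, (∑ j, p (c.embedding r j) + 0) := by
    simp_rw [add_zero]
    rw [← c.blocksFinEquiv.sum_comp, Fintype.sum_sigma]
    rfl
  rw [h2]
  exact h1

theorem hasDeg_insertFirst {𝒜 : Grading k A} {ℬ : Grading k B} {d e : ℤ} {n : ℕ} (i : Fin (n + 1))
    {φ : MultilinearMap k (fun _ : Fin (n - i + 1) => A) B}
    {δ : MultilinearMap k (fun _ : Fin (i : ℕ) => A) A}
    (hφ : HasDeg 𝒜 ℬ d φ) (hδ : HasDeg 𝒜 𝒜 e δ) : HasDeg 𝒜 ℬ (e + d) (insertFirst i φ δ) := by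
  intro p a ha
  have h1 := hφ (Fin.cons (∑ j : Fin (i : ℕ), p (Fin.castLE i.is_le j) + e)
    fun j : Fin (n - (i : ℕ)) => p ⟨(i : ℕ) + (j : ℕ), by omega⟩)
    (Fin.cons (δ fun j => a (Fin.castLE i.is_le j))
      fun j : Fin (n - (i : ℕ)) => a ⟨(i : ℕ) + (j : ℕ), by omega⟩) (fun j => by
        induction j using Fin.cases with
        | zero => exact hδ _ _ fun j => ha _
        | succ j => exact ha _)
  have h2 : ∑ j, p j = ∑ j : Fin (i : ℕ), p (Fin.castLE i.is_le j) +
      ∑ j : Fin (n - (i : ℕ)), p ⟨(i : ℕ) + (j : ℕ), by omega⟩ := by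
    rw [← (finSumFinEquiv.trans (finCongr (Nat.add_sub_of_le i.is_le))).sum_comp,
      Fintype.sum_sum_type]
    rfl
  rw [Fin.sum_univ_succ, Fin.cons_zero] at h1
  simp only [Fin.cons_succ] at h1
  rw [h2, add_assoc, add_left_comm _ e d, ← add_assoc, ← add_assoc]
  exact h1

theorem hasDeg_sum {𝒜 : Grading k A} {ℬ : Grading k B} {d : ℤ} {n : ℕ} {ι : Type*} (s : Finset ι)
    {φ : ι → MultilinearMap k (fun _ : Fin n => A) B} (h : ∀ i ∈ s, HasDeg 𝒜 ℬ d (φ i)) :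
    HasDeg 𝒜 ℬ d (∑ i ∈ s, φ i) := by
  intro p a ha
  rw [_root_.sum_apply]
  exact Submodule.sum_mem _ fun i hi => h i hi p a ha

theorem hasDeg_insSeq {𝒜 : Grading k A} {ℬ : Grading k B} {d e : ℤ}
    {Φ : MSeq k A B} {D : MSeq k A A} (hΦ : ∀ n, HasDeg 𝒜 ℬ d (Φ n))
    (hD : ∀ n, HasDeg 𝒜 𝒜 e (D n)) (n : ℕ) : HasDeg 𝒜 ℬ (e + d) (insSeq Φ D n) := by
  refine hasDeg_sum _ fun i _ p a ha => ?_
  rw [_root_.smul_apply]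
  exact Submodule.smul_of_tower_mem _ _ (hasDeg_insertFirst i (hΦ _) (hD _) p a ha)

/-- The value of the power series `Φ`, up to order `N`. -/
def ev (N : ℕ) (Φ : MSeq k A B) (x : Pt k A) : Pt k B :=
  ∑ n ∈ Finset.range (N + 1), diag (Φ n) x

theorem pow_eq_zero_of_lt {N : ℕ} {h : Grassmann k} (hN : h ^ (N + 1) = 0) {n : ℕ} (hn : N < n) :
    h ^ n = 0 := by
  obtain ⟨m, rfl⟩ := Nat.exists_eq_add_of_lt hn
  rw [add_right_comm, pow_add, hN, zero_mul]

theorem diag_smul {h : Grassmann k} (h0 : h ∈ Grassmann.part 0) {n : ℕ}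
    (φ : MultilinearMap k (fun _ : Fin n => A) B) (y : Pt k A) :
    diag φ (h • y) = h ^ n • diag φ y :=
  ext_smul_same φ h0 _

theorem ev_smul {h : Grassmann k} (h0 : h ∈ Grassmann.part 0) (N : ℕ) (Φ : MSeq k A B)
    (y : Pt k A) : ev N Φ (h • y) = ∑ n ∈ Finset.range (N + 1), h ^ n • diag (Φ n) y :=
  Finset.sum_congr rfl fun _ _ => diag_smul h0 _ _

theorem ext_congr_index (Φ : MSeq k A B) {m n : ℕ} (h : m = n) (x : Fin m → Pt k A)
    (y : Fin n → Pt k A) (hxy : ∀ i (hi : i < m) (hi' : i < n), x ⟨i, hi⟩ = y ⟨i, hi'⟩) :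
    ext (Φ m) x = ext (Φ n) y := by
  subst h
  exact congrArg _ (funext fun i => hxy i i.2 i.2)

/-- Substitution of power series: expanding every argument by multilinearity gives a sum over tuples
of positive block sizes, that is, over compositions. The condition `F 0 = 0` keeps the blocks
nonempty, and h^(N+1) = 0 makes the truncations harmless. -/
theorem ev_ev {h : Grassmann k} (h0 : h ∈ Grassmann.part 0) {N : ℕ} (hN : h ^ (N + 1) = 0)
    (Φ : MSeq k B C) {F : MSeq k A B} (hF : F 0 = 0) (y : Pt k A) :
    ev N Φ (ev N F (h • y)) = ev N (compSeq Φ F) (h • y) := by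
  set g : ℕ → Pt k B := fun j => h ^ j • diag (F j) y with hg
  have e1 : ev N F (h • y) = ∑ j ∈ Finset.Ico 1 (N + 1), g j := by
    rw [ev_smul h0, Finset.range_eq_Ico, Finset.sum_eq_sum_Ico_succ_bot (Nat.succ_pos N)]
    simp [hF, diag, hg]
  have e2 : ev N Φ (ev N F (h • y)) =
      ∑ e ∈ FormalMultilinearSeries.compPartialSumSource 0 (N + 1) (N + 1),
        ext (Φ e.1) fun i => g (e.2 i) := by
    rw [e1, FormalMultilinearSeries.compPartialSumSource, Finset.sum_sigma, ev,
      Finset.range_eq_Ico]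
    exact Finset.sum_congr rfl fun r _ =>
      MultilinearMap.map_sum_finset (ext (Φ r)) (fun _ => g) fun _ => Finset.Ico 1 (N + 1)
  -- Tuples of block sizes correspond to compositions by the change of variables known from
  -- composing formal multilinear series.
  rw [e2, FormalMultilinearSeries.compChangeOfVariables_sum 0 (N + 1) (N + 1) _
    (fun c => ext (Φ c.2.length) fun r => g (c.2.blocksFun r))]
  · have e3 : ∀ c : Σ n, Composition n, (ext (Φ c.2.length) fun r => g (c.2.blocksFun r)) =
        h ^ c.1 • ext (Φ c.2.length) fun r => diag (F (c.2.blocksFun r)) y := by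
      rintro ⟨n, c⟩
      rw [hg, ext_pow_smul _ h0, c.sum_blocksFun]
    have e4 : ev N (compSeq Φ F) (h • y) = ∑ c ∈ (Finset.range (N + 1)).sigma
        fun n => (Finset.univ : Finset (Composition n)),
        ext (Φ c.2.length) fun r => g (c.2.blocksFun r) := by
      rw [ev_smul h0, Finset.sum_sigma]
      refine Finset.sum_congr rfl fun n _ => ?_
      rw [diag_compSeq, Finset.smul_sum]
      exact Finset.sum_congr rfl fun c _ => (e3 ⟨n, c⟩).symm
    rw [e4]
    symm
    refine Finset.sum_subset ?_ ?_
    · rintro ⟨n, c⟩ hc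
      simp only [Finset.mem_sigma, Finset.mem_range, Finset.mem_univ, and_true] at hc
      rw [FormalMultilinearSeries.mem_compPartialSumTarget_iff]
      refine ⟨Nat.zero_le _, lt_of_le_of_lt c.length_le hc, fun j => lt_of_le_of_lt ?_ hc⟩
      exact c.blocks_le (c.blocksFun_mem_blocks j)
    · rintro ⟨n, c⟩ _ hc
      simp only [Finset.mem_sigma, Finset.mem_range, Finset.mem_univ, and_true] at hc
      rw [e3, pow_eq_zero_of_lt hN (show N < n from Nat.lt_of_succ_le (not_lt.mp hc)), zero_smul]
  · intro e he
    refine ext_congr_index Φ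
      (FormalMultilinearSeries.compChangeOfVariables_length 0 (N + 1) (N + 1) he).symm _ _ ?_
    intro i hi hi'
    rw [FormalMultilinearSeries.compChangeOfVariables_blocksFun 0 (N + 1) (N + 1) he ⟨i, hi⟩]

/-- Under `c`, the arguments of a multilinear map matter only modulo elements annihilated
by `c`. -/
theorem smul_ext_add_smul {c b : Grassmann k} (hc : ∀ t, ∃ t', c * t = t' * c) (hcb : c * b = 0)
    {n : ℕ} (φ : MultilinearMap k (fun _ : Fin n => A) B) (u z : Fin n → Pt k A) :
    c • ext φ (fun i => u i + b • z i) = c • ext φ u := by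
  induction n with
  | zero => rw [Subsingleton.elim (fun i => u i + b • z i) u]
  | succ n ih =>
    have e : ∀ w : Fin (n + 1) → Pt k A, w = Fin.cons (w 0) fun i => w i.succ := fun w =>
      (Fin.cons_self_tail w).symm
    rw [e u, e fun i => (Fin.cons (u 0) (fun i => u i.succ) : Fin (n + 1) → Pt k A) i + b • z i]
    simp only [Fin.cons_zero, Fin.cons_succ]
    have h1 : c • ext φ (Fin.cons (u 0 + b • z 0) fun i => u i.succ + b • z i.succ) =
        c • ext φ (Fin.cons (u 0) fun i => u i.succ + b • z i.succ) := by
      rw [← MultilinearMap.curryLeft_apply, map_add, _root_.add_apply,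
        MultilinearMap.curryLeft_apply, MultilinearMap.curryLeft_apply, ext_cons_smul, smul_add,
        smul_smul, hcb, zero_smul, add_zero]
    rw [h1]
    generalize u 0 = x
    induction x using TensorProduct.induction_on with
    | zero => simp only [← MultilinearMap.curryLeft_apply, map_zero, _root_.zero_apply]
    | tmul t a =>
      obtain ⟨t', ht⟩ := hc t
      rw [ext_cons_tmul, ext_cons_tmul, smul_smul, smul_smul, ht, mul_smul, mul_smul, ih]
    | add x y hx hy =>
      simp only [← MultilinearMap.curryLeft_apply, map_add, _root_.add_apply, smul_add]
        at hx hy ⊢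
      rw [hx, hy]

/-- In front of a factor θ, every further multiple of θ may be dropped: θ can be moved past any
coefficient at the cost of the grading involution, and then meets the other θ. -/
theorem odd_smul_ext_add {θ : Grassmann k} (hθ : θ ∈ Grassmann.part 1) (hθθ : θ * θ = 0) {n : ℕ}
    (φ : MultilinearMap k (fun _ : Fin n => A) B) (u z : Fin n → Pt k A) :
    θ • ext φ (fun i => u i + θ • z i) = θ • ext φ u :=
  smul_ext_add_smul (fun t => ⟨_, Grassmann.odd_mul hθ t⟩) hθθ φ u z

/-- Used at top order, where a factor h^N makes corrections of order h in the argument irrelevant.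
-/
theorem pow_smul_diag_add {h : Grassmann k} (h0 : h ∈ Grassmann.part 0) {N i j : ℕ}
    (hN : h ^ (N + 1) = 0) (hij : N < i + j) {n : ℕ}
    (φ : MultilinearMap k (fun _ : Fin n => A) B) (u z : Pt k A) :
    h ^ i • diag φ (u + h ^ j • z) = h ^ i • diag φ u :=
  smul_ext_add_smul (fun t => ⟨t, Grassmann.even_mul (Grassmann.pow_mem_part h0 i) t⟩)
    (by rw [← pow_add, pow_eq_zero_of_lt hN hij]) φ _ _

variable {𝒜 : Grading k A} {ℬ : Grading k B} {𝒞 : Grading k C}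

theorem ext_update_of_isSymm {n : ℕ} {φ : MultilinearMap k (fun _ : Fin (n + 1) => A) B}
    (hφ : IsSymm 𝒜 φ) (a : Fin (n + 1)) {z : Pt k A} (hz : z ∈ 𝒜.pts 0) {y : Fin n → Pt k A}
    (hy : ∀ i, y i ∈ 𝒜.pts 0) : ext φ (a.insertNth z y) = ext φ (Fin.cons z y) := by
  have h := ext_perm_of_isSymm hφ (x := Fin.cons z y) (fun i => by
    induction i using Fin.cases with
    | zero => exact hz
    | succ i => exact hy i) a.cycleRange
  rw [← h]
  congr 1
  funext i
  rw [Fin.cons_apply_cycleRange]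

/-- The difference of two values on the diagonal as a telescoping sum. -/
theorem diag_sub_diag {n : ℕ} {φ : MultilinearMap k (fun _ : Fin (n + 1) => A) B}
    (hφ : IsSymm 𝒜 φ) {x w : Pt k A} (hx : x ∈ 𝒜.pts 0) (hw : w ∈ 𝒜.pts 0) :
    diag φ w - diag φ x = ∑ a : Fin (n + 1),
      ext φ (Fin.cons (w - x) fun i : Fin n => if (i : ℕ) < (a : ℕ) then x else w) := by
  set u : ℕ → Fin (n + 1) → Pt k A := fun m i => if (i : ℕ) < m then x else w with hu
  have h1 : ∀ a : Fin (n + 1),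
      ext φ (Fin.cons (w - x) fun i : Fin n => if (i : ℕ) < (a : ℕ) then x else w) =
        ext φ (u a) - ext φ (u (a + 1)) := by
    intro a
    have hy : ∀ i : Fin n, (if (i : ℕ) < (a : ℕ) then x else w) ∈ 𝒜.pts 0 := fun i => by
      split_ifs <;> assumption
    have hins : ∀ m (z : Pt k A), (∀ i : Fin n, u m (a.succAbove i) =
        if (i : ℕ) < (a : ℕ) then x else w) → u m a = z → u m =
        a.insertNth z fun i : Fin n => if (i : ℕ) < (a : ℕ) then x else w := by
      intro m z h h'
      symm
      rw [Fin.insertNth_eq_iff]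
      exact ⟨h'.symm, (funext h).symm⟩
    have hs1 : ∀ i : Fin n, u a (a.succAbove i) = if (i : ℕ) < (a : ℕ) then x else w := fun i => by
      simp only [hu, Fin.succAbove, Fin.lt_def, Fin.val_castSucc]
      by_cases h : (i : ℕ) < a
      · simp [h]
      · simp only [h, if_false, Fin.val_succ]
        exact if_neg (by omega)
    have hs2 : ∀ i : Fin n, u (a + 1) (a.succAbove i) =
        if (i : ℕ) < (a : ℕ) then x else w := fun i => by
      simp only [hu, Fin.succAbove, Fin.lt_def, Fin.val_castSucc]
      by_cases h : (i : ℕ) < a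
      · simp only [h, if_true, Fin.val_castSucc]
        exact if_pos (by omega)
      · simp only [h, if_false, Fin.val_succ]
        exact if_neg (by omega)
    rw [hins a w hs1 (by simp [hu]), hins (a + 1) x hs2 (by simp [hu]),
      ext_update_of_isSymm hφ a hw hy, ext_update_of_isSymm hφ a hx hy,
      ← MultilinearMap.curryLeft_apply, map_sub]
    rfl
  simp_rw [h1]
  rw [Fin.sum_univ_eq_sum_range (fun m => ext φ (u m) - ext φ (u (m + 1))),
    Finset.sum_range_sub']
  have h2 : u 0 = fun _ => w := funext fun i => by simp [hu]
  have h3 : u (n + 1) = fun _ => x := funext fun i => if_pos i.2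
  rw [h2, h3]

/-- The first order Taylor formula is exact because θ² = 0. The telescoping sum has one term for
each of the n + 1 slots, and these agree by symmetry once θ stands in front; this is the origin of
the numerical factor in `insSeq`. -/
theorem diag_add_odd [Algebra ℚ k] {θ : Grassmann k} (hθ : θ ∈ Grassmann.part 1) {n : ℕ}
    {φ : MultilinearMap k (fun _ : Fin (n + 1) => A) B} (hφ : IsSymm 𝒜 φ) {x z : Pt k A}
    (hx : x ∈ 𝒜.pts 0) (hz : z ∈ 𝒜.pts 1) :
    diag φ (x + θ • z) = diag φ x + θ • (n + 1) • ext φ (Fin.cons z fun _ => x) := by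
  have hθθ := Grassmann.odd_mul_self hθ
  have h := diag_sub_diag hφ hx (add_mem hx (odd_smul_mem_pts hθ hz))
  rw [sub_eq_iff_eq_add'] at h
  rw [h, add_sub_cancel_left]
  congr 1
  have : ∀ a : Fin (n + 1), ext φ (Fin.cons (θ • z) fun i : Fin n =>
      if (i : ℕ) < (a : ℕ) then x else x + θ • z) = θ • ext φ (Fin.cons z fun _ => x) := by
    intro a
    rw [ext_cons_smul]
    have := odd_smul_ext_add hθ hθθ φ (Fin.cons z fun _ => x)
      (Fin.cons 0 fun i : Fin n => if (i : ℕ) < (a : ℕ) then 0 else z)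
    rw [← this]
    congr 2
    funext i
    induction i using Fin.cases with
    | zero => simp
    | succ i => simp only [Fin.cons_succ]; split_ifs <;> simp
  simp_rw [this]
  rw [Finset.sum_const, Finset.card_univ, Fintype.card_fin, smul_comm]

theorem ev_mem_pts {d : ℤ} {Φ : MSeq k A B} (hΦ : ∀ n, HasDeg 𝒜 ℬ d (Φ n)) (N : ℕ)
    {x : Pt k A} (hx : x ∈ 𝒜.pts 0) : ev N Φ x ∈ ℬ.pts d :=
  Submodule.sum_mem _ fun n _ => ext_mem_pts (hΦ n) fun _ => hx

theorem exists_ev_eq_smul {h : Grassmann k} (h0 : h ∈ Grassmann.part 0) {d : ℤ} {Φ : MSeq k A B}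
    (hz : Φ 0 = 0) (hΦ : ∀ n, HasDeg 𝒜 ℬ d (Φ n)) (N : ℕ) {y : Pt k A} (hy : y ∈ 𝒜.pts 0) :
    ∃ w ∈ ℬ.pts d, ev N Φ (h • y) = h • w := by
  refine ⟨∑ n ∈ Finset.range N, h ^ n • diag (Φ (n + 1)) y, Submodule.sum_mem _ fun n _ =>
    even_smul_mem_pts (Grassmann.pow_mem_part h0 n) (ext_mem_pts (hΦ _) fun _ => hy), ?_⟩
  rw [ev_smul h0, Finset.sum_range_succ', hz, Finset.smul_sum]
  simp [diag, smul_smul, pow_succ']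

theorem diag_one (φ : MultilinearMap k (fun _ : Fin 1 => A) B) (x : Pt k A) :
    diag φ x = lin (unary φ) x := ext_unary φ _

theorem exists_ev_eq_smul_lin {h : Grassmann k} (h0 : h ∈ Grassmann.part 0) {d : ℤ}
    {Φ : MSeq k A B} (hz : Φ 0 = 0) (hΦ : ∀ n, HasDeg 𝒜 ℬ d (Φ n)) {N : ℕ} (hN : 1 ≤ N)
    {y : Pt k A} (hy : y ∈ 𝒜.pts 0) :
    ∃ u ∈ ℬ.pts d, ev N Φ (h • y) = h • (lin (unary (Φ 1)) y + h • u) := by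
  obtain ⟨N, rfl⟩ := Nat.exists_eq_add_of_le' hN
  refine ⟨∑ n ∈ Finset.range N, h ^ n • diag (Φ (n + 2)) y, Submodule.sum_mem _ fun n _ =>
    even_smul_mem_pts (Grassmann.pow_mem_part h0 n) (ext_mem_pts (hΦ _) fun _ => hy), ?_⟩
  rw [ev_smul h0, Finset.sum_range_succ', Finset.sum_range_succ', hz, Finset.smul_sum, smul_add,
    Finset.smul_sum]
  simp [smul_smul, pow_succ', diag_one]
  rw [show diag (0 : MultilinearMap k (fun _ : Fin 0 => A) B) y = 0 by
    rw [diag, ext_zero, _root_.zero_apply], add_zero, add_comm]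

/-- The perturbation already has order N, so a term of arity at least two would carry another factor
h and vanish. Only the linear term sees it. -/
theorem ev_add_top {h : Grassmann k} (h0 : h ∈ Grassmann.part 0) {N : ℕ} (hN : h ^ (N + 1) = 0)
    (hN1 : 1 ≤ N) (Φ : MSeq k A B) (v e : Pt k A) :
    ev N Φ (h • v + h ^ N • e) = ev N Φ (h • v) + h ^ N • lin (unary (Φ 1)) e := by
  obtain ⟨N, rfl⟩ := Nat.exists_eq_add_of_le' hN1
  rw [ev, ev, Finset.sum_range_succ', Finset.sum_range_succ', Finset.sum_range_succ' _ (N + 1),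
    Finset.sum_range_succ' _ N]
  have h1 : ∀ n, diag (Φ (n + 1 + 1)) (h • v + h ^ (N + 1) • e) =
      diag (Φ (n + 1 + 1)) (h • v) := by
    intro n
    rw [pow_succ', mul_smul, ← smul_add, diag_smul h0, diag_smul h0,
      pow_smul_diag_add h0 hN (by omega)]
  simp_rw [h1]
  rw [zero_add, diag_one, diag_one, map_add, map_smul (lin (unary (Φ 1))) (h ^ (N + 1)),
    show diag (Φ 0) (h • v + h ^ (N + 1) • e) = diag (Φ 0) (h • v) from
      congrArg (ext (Φ 0)) (Subsingleton.elim (α := Fin 0 → Pt k A) _ _)]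
  abel

theorem ev_update {h : Grassmann k} (h0 : h ∈ Grassmann.part 0) {N : ℕ} {Φ : MSeq k A B}
    (ψ : MultilinearMap k (fun _ : Fin N => A) B) (y : Pt k A) :
    ev N (Function.update Φ N (Φ N + ψ)) (h • y) = ev N Φ (h • y) + h ^ N • diag ψ y := by
  rw [ev_smul h0, ev_smul h0, Finset.sum_range_succ, Finset.sum_range_succ, add_assoc]
  congr 1
  · refine Finset.sum_congr rfl fun n hn => ?_
    rw [Function.update_of_ne (Finset.mem_range.mp hn).ne]
  · rw [Function.update_self, diag, ext_add, _root_.add_apply, smul_add]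

theorem ext_cons_smul_smul {h : Grassmann k} (h0 : h ∈ Grassmann.part 0) (i : ℕ) {n : ℕ}
    (φ : MultilinearMap k (fun _ : Fin (n + 1) => A) B) (z x : Pt k A) :
    ext φ (Fin.cons (h ^ i • z) fun _ => h • x) = h ^ (i + n) • ext φ (Fin.cons z fun _ => x) := by
  have := ext_pow_smul φ h0 (Fin.cons i fun _ => 1) (Fin.cons z fun _ => x)
  rw [Fin.sum_univ_succ] at this
  simp only [Fin.cons_zero, Fin.cons_succ, Finset.sum_const, Finset.card_univ, Fintype.card_fin,
    smul_eq_mul, mul_one] at this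
  rw [← this]
  congr 1
  funext j
  induction j using Fin.cases with
  | zero => simp
  | succ j => simp

/-- Translation by θD(x) acts on a series as 1 + θD. This converts the coderivation terms of all
arities into a single substitution. -/
theorem ev_add_odd [Algebra ℚ k] {h θ : Grassmann k} (h0 : h ∈ Grassmann.part 0)
    (hθ : θ ∈ Grassmann.part 1) {N : ℕ} (hN : h ^ (N + 1) = 0) {Φ : MSeq k A B} {D : MSeq k A A}
    (hΦ : ∀ n, IsSymm 𝒜 (Φ n)) (hD : ∀ n, HasDeg 𝒜 𝒜 1 (D n)) (hD0 : D 0 = 0) {y : Pt k A}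
    (hy : y ∈ 𝒜.pts 0) :
    ev N Φ (h • y + θ • ev N D (h • y)) =
      ev N Φ (h • y) + θ • ev N (insSeq Φ D) (h • y) := by
  have hx : h • y ∈ 𝒜.pts 0 := even_smul_mem_pts h0 hy
  have hz : ev N D (h • y) ∈ 𝒜.pts 1 := by exact_mod_cast ev_mem_pts hD N hx
  set f : ℕ → ℕ → Pt k B := fun i m =>
    h ^ (i + m) • (m + 1) • ext (Φ (m + 1)) (Fin.cons (diag (D i) y) fun _ => y) with hf
  have e1 : ∀ m, (m + 1) • ext (Φ (m + 1)) (Fin.cons (ev N D (h • y)) fun _ => h • y) =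
      ∑ i ∈ Finset.range (N + 1), f i m := by
    intro m
    rw [ev_smul h0, ← MultilinearMap.curryLeft_apply, map_sum, _root_.sum_apply, Finset.smul_sum]
    refine Finset.sum_congr rfl fun i _ => ?_
    rw [MultilinearMap.curryLeft_apply, ext_cons_smul_smul h0, hf]
    exact smul_comm _ _ _
  have e2 : ev N (insSeq Φ D) (h • y) =
      ∑ i ∈ Finset.range (N + 1), ∑ m ∈ Finset.range (N + 1 - i), f i m := by
    rw [ev_smul h0, ← Finset.sum_range_diag_flip]
    refine Finset.sum_congr rfl fun n _ => ?_
    rw [diag_insSeq, Finset.smul_sum]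
    refine Finset.sum_congr rfl fun i hi => ?_
    rw [Finset.mem_range] at hi
    simp only [hf]
    rw [Nat.add_sub_of_le (by omega)]
  -- The triangle of pairs (i, m) is replaced by a rectangle: for i = 0 all terms vanish since `D 0
  -- = 0`, and for i ≥ 1 the added terms have i + m > N.
  have e3 : ∀ i ∈ Finset.range (N + 1), ∑ m ∈ Finset.range (N + 1 - i), f i m =
      ∑ m ∈ Finset.range N, f i m := by
    intro i hi
    rw [Finset.mem_range] at hi
    rcases Nat.eq_zero_or_pos i with rfl | hpos
    · rw [Nat.sub_zero, Finset.sum_range_succ, add_eq_left]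
      simp only [hf, hD0, diag, ext_zero, _root_.zero_apply]
      rw [← MultilinearMap.curryLeft_apply, map_zero, _root_.zero_apply, smul_zero, smul_zero]
    · refine Finset.sum_subset (Finset.range_subset_range.mpr (by omega)) fun m _ hm => ?_
      rw [Finset.mem_range] at hm
      simp only [hf]
      rw [pow_eq_zero_of_lt hN (by omega), zero_smul]
  rw [e2, Finset.sum_congr rfl e3, Finset.sum_comm]
  simp only [ev.eq_def N Φ]
  rw [Finset.sum_range_succ',
    Finset.sum_range_succ' (fun n => diag (Φ n) (h • y)), add_right_comm, Finset.smul_sum,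
    ← Finset.sum_add_distrib]
  congr 1
  refine Finset.sum_congr rfl fun m _ => ?_
  rw [diag_add_odd hθ (hΦ _) hx hz, e1]

theorem Params.eq_of_smul {N : ℕ} (p : Grassmann.Params k N) {z w : Pt k B}
    (h : p.θ' • p.θ • p.h ^ N • Pt.map p.s z = p.θ' • p.θ • p.h ^ N • Pt.map p.s w) : z = w := by
  have h2 : ∀ z : Pt k B, LinearMap.rTensor B p.c
      (p.θ' • p.θ • p.h ^ N • Pt.map p.s z) = z := by
    intro z
    induction z using TensorProduct.induction_on with
    | zero => simp
    | tmul t b => simp [TensorProduct.smul_tmul', p.c_mul]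
    | add x y hx hy => simp only [map_add, smul_add, hx, hy]
  rw [← h2 z, ← h2 w, h]

theorem diag_map {n : ℕ} (φ : MultilinearMap k (fun _ : Fin n => A) B)
    (s : Grassmann k →ₐ[k] Grassmann k) (x : Pt k A) :
    diag φ (Pt.map s x) = Pt.map s (diag φ x) := ext_map φ s _

theorem ev_congr {N : ℕ} {h : Grassmann k} (h0 : h ∈ Grassmann.part 0) {Φ Ψ : MSeq k A B}
    {y : Pt k A} (H : ∀ n ≤ N, diag (Φ n) y = diag (Ψ n) y) :
    ev N Φ (h • y) = ev N Ψ (h • y) := by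
  rw [ev_smul h0, ev_smul h0]
  exact Finset.sum_congr rfl fun n hn => by
    rw [H n (Nat.lt_succ_iff.mp (Finset.mem_range.mp hn))]

/-- After the lower terms are cancelled, only the coefficient of h^N is left, and
`Params.eq_of_smul` extracts it from fresh parameters. The extra factors θ and θ' are allowed
because some identities are only available after multiplication by them. -/
theorem diag_eq_of_ev_of_lt [Algebra ℚ k] {Φ Ψ : MSeq k A B} {N : ℕ}
    (h : ∀ m < N, ∀ y ∈ 𝒜.pts 0, diag (Φ m) y = diag (Ψ m) y)
    (H : ∀ p : Grassmann.Params k N, ∀ y ∈ 𝒜.pts 0,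
      p.θ' • p.θ • ev N Φ (p.h • y) = p.θ' • p.θ • ev N Ψ (p.h • y)) :
    ∀ y ∈ 𝒜.pts 0, diag (Φ N) y = diag (Ψ N) y := by
  intro y hy
  obtain ⟨p⟩ := Grassmann.exists_params (k := k) N
  have h1 := H p _ (map_mem_pts p.s_mem hy)
  rw [ev_smul p.h_mem, ev_smul p.h_mem, Finset.sum_range_succ, Finset.sum_range_succ,
    Finset.sum_congr rfl fun m hm => by
      rw [h m (Finset.mem_range.mp hm) _ (map_mem_pts p.s_mem hy)], smul_add, smul_add,
    smul_add, smul_add, add_left_cancel_iff, diag_map, diag_map] at h1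
  exact Params.eq_of_smul p h1

/-- Power series agree if their values agree. -/
theorem diag_eq_of_ev [Algebra ℚ k] {Φ Ψ : MSeq k A B}
    (H : ∀ (N : ℕ) (p : Grassmann.Params k N), ∀ y ∈ 𝒜.pts 0,
      p.θ' • p.θ • ev N Φ (p.h • y) = p.θ' • p.θ • ev N Ψ (p.h • y)) (n : ℕ) :
    ∀ y ∈ 𝒜.pts 0, diag (Φ n) y = diag (Ψ n) y := by
  induction n using Nat.strong_induction_on with
  | _ n ih => exact diag_eq_of_ev_of_lt ih (H n)

theorem ev_avg [Algebra ℚ k] (N : ℕ) (Φ : MSeq k A B) {x : Pt k A} (hx : x ∈ 𝒜.pts 0) :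
    ev N (fun n => avg 𝒜 (Φ n)) x = ev N Φ x :=
  Finset.sum_congr rfl fun _ _ => ext_avg_diag _ hx

end Sequences

end LInfty

/-! ### Codifferentials as odd vector fields, morphisms as maps respecting them. -/

namespace LInfty

open scoped TensorProduct

section Morphisms

variable {k : Type u} [CommRing k] {A B C : Type*} [AddCommGroup A] [Module k A]
  [AddCommGroup B] [Module k B] [AddCommGroup C] [Module k C]

theorem compSeq_congr {Φ Φ' : MSeq k B C} {F F' : MSeq k A B} {n : ℕ}
    (h : ∀ m ≤ n, Φ m = Φ' m) (h' : ∀ m ≤ n, F m = F' m) :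
    compSeq Φ F n = compSeq Φ' F' n := by
  refine Finset.sum_congr rfl fun c _ => ?_
  rw [h _ c.length_le]
  congr 1
  funext r
  rw [h' _ (c.blocks_le (c.blocksFun_mem_blocks r))]

theorem insertFirst_zero {n : ℕ} (i : Fin (n + 1))
    (φ : MultilinearMap k (fun _ : Fin (n - i + 1) => A) B) :
    insertFirst i φ 0 = 0 :=
  MultilinearMap.ext fun a => by
    rw [insertFirst_apply]
    exact φ.map_coord_zero 0 rfl

/-- Without `D 0 = 0` the arity n part of the derivative would also involve the coefficient of arity
n + 1. -/
theorem insSeq_congr {Φ Φ' : MSeq k A B} {D : MSeq k A A} (hD : D 0 = 0) {n : ℕ}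
    (h : ∀ m ≤ n, Φ m = Φ' m) : insSeq Φ D n = insSeq Φ' D n := by
  refine Finset.sum_congr rfl fun i _ => ?_
  induction i using Fin.cases with
  | zero =>
    change _ • insertFirst 0 _ (D 0) = _ • insertFirst 0 _ (D 0)
    rw [hD]
    erw [insertFirst_zero, insertFirst_zero]
  | succ i => rw [h _ (by have := i.2; rw [Fin.val_succ]; omega)]

theorem compSeq_zero {Φ : MSeq k B C} (h : Φ 0 = 0) (F : MSeq k A B) : compSeq Φ F 0 = 0 := by
  refine Finset.sum_eq_zero fun c _ => MultilinearMap.ext fun a => ?_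
  have hc : c.length = 0 := Nat.le_zero.mp c.length_le
  have : Φ c.length = 0 := by
    have : ∀ m, m = 0 → Φ m = 0 := by rintro m rfl; exact h
    exact this _ hc
  rw [compAlong_apply, this]
  rfl

theorem insSeq_zero (Φ : MSeq k A B) {D : MSeq k A A} (h : D 0 = 0) : insSeq Φ D 0 = 0 := by
  rw [insSeq, Fin.sum_univ_one]
  change _ • insertFirst 0 _ (D 0) = 0
  rw [h]
  erw [insertFirst_zero]
  rw [smul_zero]

theorem compSeq_one_apply (Φ : MSeq k B C) (F : MSeq k A B) (a : Fin 1 → A) :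
    compSeq Φ F 1 a = unary (Φ 1) (unary (F 1) (a 0)) := by
  have hc : Subsingleton (Composition 1) :=
    Fintype.card_le_one_iff_subsingleton.mp (by simp [composition_card])
  rw [compSeq, Fintype.sum_subsingleton _ (Composition.single 1 one_pos), compAlong_apply,
    unary_apply, unary_apply]
  change (Φ 1 fun r => F ((Composition.single 1 one_pos).blocksFun r) _) = _
  congr 1
  funext r
  have : ∀ m (hm : m = 1) (b : Fin m → A), (∀ j, b j = a 0) → F m b = F 1 fun _ => a 0 := by
    rintro m rfl b hb
    rw [funext hb]
  exact this _ (Composition.single_blocksFun _ _) _ fun j => congrArg a (Subsingleton.elim _ _)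

theorem insSeq_one_apply (Φ : MSeq k A B) {D : MSeq k A A} (h : D 0 = 0) (a : Fin 1 → A) :
    insSeq Φ D 1 a = unary (Φ 1) (unary (D 1) (a 0)) := by
  rw [insSeq, Fin.sum_univ_two]
  have h0 : insertFirst (0 : Fin 2) (Φ (1 - ((0 : Fin 2) : ℕ) + 1)) (D ((0 : Fin 2) : ℕ)) = 0 := by
    change insertFirst 0 _ (D 0) = 0
    rw [h]
    exact insertFirst_zero _ _
  rw [h0, smul_zero, zero_add, _root_.smul_apply, insertFirst_apply]
  change 1 • Φ 1 _ = _
  rw [one_smul, unary_apply, unary_apply]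
  congr 1
  funext i
  rw [Fin.fin_one_eq_zero i]
  exact congrArg (D 1) (funext fun j => congrArg a (Subsingleton.elim _ _))

/-- A linear map, as a power series. -/
def linSeq (f : A →ₗ[k] B) : MSeq k A B
  | 1 => MultilinearMap.ofSubsingleton k A B 0 f
  | _ => 0

theorem unary_linSeq (f : A →ₗ[k] B) : unary (linSeq f 1) = f := rfl

theorem ev_linSeq {N : ℕ} (hN : 1 ≤ N) (f : A →ₗ[k] B) (x : Pt k A) :
    ev N (linSeq f) x = lin f x := by
  rw [ev, Finset.sum_eq_single 1, diag_one]
  · rfl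
  · intro n _ hn
    match n, hn with
    | 0, _ => simp [diag, linSeq]
    | n + 2, _ => simp [diag, linSeq]
  · intro h
    simp at h
    omega

theorem hasDeg_linSeq {𝒜 : Grading k A} {ℬ : Grading k B} {d : ℤ} {f : A →ₗ[k] B}
    (hf : ∀ i, ∀ a ∈ 𝒜.deg i, f a ∈ ℬ.deg (i + d)) (n : ℕ) : HasDeg 𝒜 ℬ d (linSeq f n) := by
  intro p a ha
  match n with
  | 0 => exact zero_mem _
  | 1 =>
    rw [Fin.sum_univ_one]
    exact hf _ _ (ha 0)
  | n + 2 => exact zero_mem _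

theorem isSymm_linSeq (𝒜 : Grading k A) (f : A →ₗ[k] B) (n : ℕ) : IsSymm 𝒜 (linSeq f n) := by
  intro p a ha σ
  match n with
  | 0 => exact (smul_zero _).symm
  | 1 =>
    rw [Subsingleton.elim σ 1, koszulSign_one, one_smul]
    rfl
  | n + 2 => exact (smul_zero _).symm

/-- The identity, as a power series. -/
abbrev idSeq (k : Type u) [CommRing k] (A : Type*) [AddCommGroup A] [Module k A] : MSeq k A A :=
  linSeq LinearMap.id

theorem ev_idSeq {N : ℕ} (hN : 1 ≤ N) (x : Pt k A) : ev N (idSeq k A) x = x := by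
  rw [ev_linSeq hN, lin, LinearMap.baseChange_id]
  rfl

theorem avg_zero [Algebra ℚ k] (𝒜 : Grading k A) {n : ℕ} :
    avg 𝒜 (0 : MultilinearMap k (fun _ : Fin n => A) B) = 0 := by
  have : symm 𝒜 (0 : MultilinearMap k (fun _ : Fin n => A) B) = 0 :=
    Finset.sum_eq_zero fun q _ => Finset.sum_eq_zero fun σ _ => by
      refine MultilinearMap.ext fun a => ?_
      rw [_root_.smul_apply]
      exact smul_zero _
  rw [avg, this, smul_zero]

theorem avg_one [Algebra ℚ k] (𝒜 : Grading k A) (φ : MultilinearMap k (fun _ : Fin 1 => A) B) :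
    avg 𝒜 φ = φ := by
  refine MultilinearMap.ext fun a => ?_
  rw [avg, Nat.factorial_one, Nat.cast_one, inv_one, map_one, one_smul, symm, _root_.sum_apply]
  have h1 : ∀ q : Fin 1 → Fin 2, (∑ σ : Equiv.Perm (Fin 1),
      ((koszulSign (fun i => ((q i : ℕ) : ℤ)) σ : ℤˣ) : ℤ) •
      (φ.domDomCongr σ).compLinearMap fun i => 𝒜.proj (q i)) a =
      unary φ (𝒜.proj (q 0) (a 0)) := by
    intro q
    rw [Fintype.sum_subsingleton _ (1 : Equiv.Perm (Fin 1)), koszulSign_one, Units.val_one,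
      one_smul, unary_apply]
    exact congrArg φ (funext fun i => by rw [Fin.fin_one_eq_zero i]; rfl)
  simp_rw [h1]
  rw [← (Equiv.funUnique (Fin 1) (Fin 2)).symm.sum_comp, Fin.sum_univ_two]
  simp only [Equiv.funUnique_symm_apply, uniqueElim_const]
  rw [← map_add]
  have : 𝒜.proj 0 (a 0) + 𝒜.proj 1 (a 0) = a 0 := by simp [Grading.proj]
  rw [this, unary_apply]
  exact congrArg φ (funext fun i => by rw [Fin.fin_one_eq_zero i])

/-- `Q` is the sequence of components of a codifferential of degree `1`, i.e. an odd vector field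
with square zero. -/
structure IsLInf (𝒜 : Grading k A) (Q : MSeq k A A) : Prop where
  zero : Q 0 = 0
  hasDeg : ∀ n, HasDeg 𝒜 𝒜 1 (Q n)
  isSymm : ∀ n, IsSymm 𝒜 (Q n)
  sq : ∀ n, ∀ y ∈ 𝒜.pts 0, diag (insSeq Q Q n) y = 0

/-- `F` is the sequence of components of a morphism of coalgebras compatible with the
codifferentials. -/
structure IsMor (𝒜 : Grading k A) (ℬ : Grading k B) (Q : MSeq k A A) (Q' : MSeq k B B)
    (F : MSeq k A B) : Prop where
  zero : F 0 = 0
  hasDeg : ∀ n, HasDeg 𝒜 ℬ 0 (F n)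
  isSymm : ∀ n, IsSymm 𝒜 (F n)
  comm : ∀ n, ∀ y ∈ 𝒜.pts 0, diag (compSeq Q' F n) y = diag (insSeq F Q n) y

variable {𝒜 : Grading k A} {ℬ : Grading k B} {𝒞 : Grading k C}

/-- The field Q is constant along its own odd flow x ↦ x + θQ(x), since its derivative in the
direction Q is Q² = 0. -/
theorem IsLInf.ev_sq [Algebra ℚ k] {h θ : Grassmann k} (h0 : h ∈ Grassmann.part 0) (hθ : θ ∈ Grassmann.part 1)
    {N : ℕ} (hN : h ^ (N + 1) = 0) {Q : MSeq k A A} (hQ : IsLInf 𝒜 Q) {y : Pt k A} (hy : y ∈ 𝒜.pts 0) :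
    ev N Q (h • y + θ • ev N Q (h • y)) = ev N Q (h • y) := by
  rw [ev_add_odd h0 hθ hN hQ.isSymm hQ.hasDeg hQ.zero hy,
    ev_congr (Φ := insSeq Q Q) (Ψ := fun _ => 0) h0 fun n _ => by
      rw [hQ.sq n y hy, diag, ext_zero]; rfl]
  simp [ev, diag]

/-- Compatibility with the codifferentials means that F intertwines the odd flows. Only the
equations in arity at most N matter, because h^(N+1) = 0. -/
theorem ev_comm [Algebra ℚ k] {h θ : Grassmann k} (h0 : h ∈ Grassmann.part 0) (hθ : θ ∈ Grassmann.part 1)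
    {N : ℕ} (hN : h ^ (N + 1) = 0)
    {Q : MSeq k A A} {Q' : MSeq k B B} {F : MSeq k A B} (hQ : IsLInf 𝒜 Q)
    (hF0 : F 0 = 0) (hF : ∀ n, IsSymm 𝒜 (F n))
    (hc : ∀ n ≤ N, ∀ y ∈ 𝒜.pts 0, diag (compSeq Q' F n) y = diag (insSeq F Q n) y)
    {y : Pt k A} (hy : y ∈ 𝒜.pts 0) :
    ev N F (h • y + θ • ev N Q (h • y)) = ev N F (h • y) + θ • ev N Q' (ev N F (h • y)) := by
  rw [ev_add_odd h0 hθ hN hF hQ.hasDeg hQ.zero hy, ev_ev h0 hN _ hF0,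
    ev_congr h0 fun n hn => (hc n hn y hy)]

/-- A point moved along the flow is again h times an even point, the form required by the evaluation
lemmas; its first order part is given by the linear part of Q. -/
theorem exists_point {h : Grassmann k} (h0 : h ∈ Grassmann.part 0) (θ : Grassmann k) {N : ℕ} (hN : 1 ≤ N) {Q : MSeq k A A}
    (hQ : IsLInf 𝒜 Q) {y : Pt k A} (hy : y ∈ 𝒜.pts 0) : ∃ u ∈ 𝒜.pts 1,
      h • y + θ • ev N Q (h • y) = h • (y + θ • (lin (unary (Q 1)) y + h • u)) := by
  obtain ⟨u, hu, he⟩ := exists_ev_eq_smul_lin h0 hQ.zero hQ.hasDeg hN hy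
  refine ⟨u, by exact_mod_cast hu, ?_⟩
  rw [he, smul_add h y, smul_smul θ h, smul_smul h θ, Grassmann.even_mul h0 θ]

end Morphisms

end LInfty

/-! ### Composition of morphisms, and the obstruction to extending a left inverse. -/

namespace LInfty

open scoped TensorProduct

section Composition

variable {k : Type u} [CommRing k] {A B C : Type*} [AddCommGroup A] [Module k A]
  [AddCommGroup B] [Module k B] [AddCommGroup C] [Module k C] [Algebra ℚ k]
  {𝒜 : Grading k A} {ℬ : Grading k B} {𝒞 : Grading k C}

/-- The composite of morphisms. -/
def comp (𝒜 : Grading k A) (G : MSeq k B C) (F : MSeq k A B) : MSeq k A C := fun n =>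
  avg 𝒜 (compSeq G F n)

/-- If F and G intertwine the odd flows, so does their composite. Averaging makes the composite
graded symmetric and does not change its values. -/
theorem IsMor.comp {QA : MSeq k A A} {QB : MSeq k B B} {QC : MSeq k C C} {G : MSeq k B C}
    {F : MSeq k A B} (hA : IsLInf 𝒜 QA) (hB : IsLInf ℬ QB) (hG : IsMor ℬ 𝒞 QB QC G)
    (hF : IsMor 𝒜 ℬ QA QB F) : IsMor 𝒜 𝒞 QA QC (comp 𝒜 G F) := by
  have hz : LInfty.comp 𝒜 G F 0 = 0 := by rw [LInfty.comp, compSeq_zero hG.zero, avg_zero]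
  have hs : ∀ n, IsSymm 𝒜 (LInfty.comp 𝒜 G F n) := fun n => isSymm_avg _
  refine ⟨hz, fun n => hasDeg_avg (hasDeg_compSeq hG.hasDeg hF.hasDeg n), hs, ?_⟩
  refine diag_eq_of_ev fun N p y hy => congrArg (p.θ' • ·) ?_
  have hev : ∀ z ∈ 𝒜.pts 0, ev N (LInfty.comp 𝒜 G F) (p.h • z) = ev N G (ev N F (p.h • z)) :=
    fun z hz => by
      rw [ev_ev p.h_mem p.h_pow _ hF.zero]
      exact ev_avg N _ (even_smul_mem_pts p.h_mem hz)
  obtain ⟨w, hw, hw'⟩ := exists_ev_eq_smul p.h_mem hA.zero hA.hasDeg N hy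
  obtain ⟨v, hv, hv'⟩ := exists_ev_eq_smul p.h_mem hF.zero hF.hasDeg N hy
  replace hw : w ∈ 𝒜.pts 1 := by exact_mod_cast hw
  replace hv : v ∈ ℬ.pts 0 := by exact_mod_cast hv
  have h1 := ev_add_odd p.h_mem p.θ_mem p.h_pow hs hA.hasDeg hA.zero hy
  have h2 : p.h • y + p.θ • ev N QA (p.h • y) = p.h • (y + p.θ • w) := by
    rw [hw', smul_add, smul_smul, smul_smul, Grassmann.even_mul p.h_mem]
  have h3 := ev_comm p.h_mem p.θ_mem p.h_pow hA hF.zero hF.isSymm (fun n _ => hF.comm n) hy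
  have h4 := ev_comm p.h_mem p.θ_mem p.h_pow hB hG.zero hG.isSymm (fun n _ => hG.comm n) hv
  rw [h2, hev _ (add_mem hy (odd_smul_mem_pts p.θ_mem hw)), ← h2, h3, hv', h4, hev _ hy, hv',
    add_left_cancel_iff] at h1
  rw [← h1, ← ev_ev p.h_mem p.h_pow _ hz, hev _ hy, hv']

theorem unary_comp (G : MSeq k B C) (F : MSeq k A B) :
    unary (comp 𝒜 G F 1) = unary (G 1) ∘ₗ unary (F 1) := by
  refine LinearMap.ext fun a => ?_
  rw [comp, avg_one, unary_apply, compSeq_one_apply]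
  rfl

end Composition

section Retraction

variable {k : Type u} [CommRing k] {A B C : Type*} [AddCommGroup A] [Module k A]
  [AddCommGroup B] [Module k B] [AddCommGroup C] [Module k C]
  {𝒜 : Grading k A} {ℬ : Grading k B}

theorem pow_smul_comm {h : Grassmann k} (h0 : h ∈ Grassmann.part 0) (n : ℕ) (t : Grassmann k)
    (x : Pt k A) : h ^ n • t • x = t • h ^ n • x := by
  rw [smul_smul, smul_smul, Grassmann.even_mul (Grassmann.pow_mem_part h0 n)]

/-- `r` is a homotopy inverse of `φ`, strict on one side. -/
structure IsContraction (𝒜 : Grading k A) (ℬ : Grading k B) (dA : A →ₗ[k] A) (dB : B →ₗ[k] B)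
    (φ : B →ₗ[k] A) (r : A →ₗ[k] B) (H : A →ₗ[k] A) : Prop where
  r_mem : ∀ i, ∀ a ∈ 𝒜.deg i, r a ∈ ℬ.deg i
  H_mem : ∀ i, ∀ a ∈ 𝒜.deg i, H a ∈ 𝒜.deg (i + -1)
  r_φ : ∀ b, r (φ b) = b
  r_d : ∀ a, r (dA a) = dB (r a)
  φ_d : ∀ b, φ (dB b) = dA (φ b)
  homotopy : ∀ a, dA (H a) + H (dA a) = a - φ (r a)
  H_φ : ∀ b, H (φ b) = 0

theorem lin_eq {f g : A →ₗ[k] B} (h : ∀ a, f a = g a) (x : Pt k A) : lin f x = lin g x := by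
  rw [LinearMap.ext h]

theorem lin_comp (f : B →ₗ[k] C) (g : A →ₗ[k] B) (x : Pt k A) :
    lin (f ∘ₗ g) x = lin f (lin g x) := by
  rw [lin, LinearMap.baseChange_comp]
  rfl

theorem unary_mem {d : ℤ} {φ : MultilinearMap k (fun _ : Fin 1 => A) B} (h : HasDeg 𝒜 ℬ d φ)
    (i : ℤ) (a : A) (ha : a ∈ 𝒜.deg i) : unary φ a ∈ ℬ.deg (i + d) := by
  have := h (fun _ => i) (fun _ => a) fun _ => ha
  simpa [unary_apply] using this

theorem hasDeg_sub {n : ℕ} {d : ℤ} {φ ψ : MultilinearMap k (fun _ : Fin n => A) B}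
    (h : HasDeg 𝒜 ℬ d φ) (h' : HasDeg 𝒜 ℬ d ψ) : HasDeg 𝒜 ℬ d (φ - ψ) := fun p a ha => by
  rw [_root_.sub_apply]
  exact sub_mem (h p a ha) (h' p a ha)

theorem hasDeg_add {n : ℕ} {d : ℤ} {φ ψ : MultilinearMap k (fun _ : Fin n => A) B}
    (h : HasDeg 𝒜 ℬ d φ) (h' : HasDeg 𝒜 ℬ d ψ) : HasDeg 𝒜 ℬ d (φ + ψ) := fun p a ha => by
  rw [_root_.add_apply]
  exact add_mem (h p a ha) (h' p a ha)

theorem isSymm_add {n : ℕ} {φ ψ : MultilinearMap k (fun _ : Fin n => A) B}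
    (h : IsSymm 𝒜 φ) (h' : IsSymm 𝒜 ψ) : IsSymm 𝒜 (φ + ψ) := fun p a ha σ => by
  rw [_root_.add_apply, _root_.add_apply, smul_add, h p a ha, h' p a ha]

/-- The homotopy `∑ E ∘ (π^a ⊗ H ⊗ 1^b)`. -/
def homotopySum {n : ℕ} (E : MultilinearMap k (fun _ : Fin (n + 1) => A) B) (H π : A →ₗ[k] A) :
    MultilinearMap k (fun _ : Fin (n + 1) => A) B :=
  ∑ a : Fin (n + 1), E.compLinearMap
    (Fin.cons H fun i : Fin n => if (i : ℕ) < (a : ℕ) then π else LinearMap.id)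

theorem diag_homotopySum {n : ℕ} (E : MultilinearMap k (fun _ : Fin (n + 1) => A) B) (H π : A →ₗ[k] A)
    (y : Pt k A) : diag (homotopySum E H π) y = ∑ a : Fin (n + 1),
      ext E (Fin.cons (lin H y) fun i : Fin n => if (i : ℕ) < (a : ℕ) then lin π y else y) := by
  rw [diag, homotopySum, ext_sum, _root_.sum_apply]
  refine Finset.sum_congr rfl fun a _ => ?_
  rw [ext_compLinearMap]
  congr 1
  funext i
  induction i using Fin.cases with
  | zero => rfl
  | succ i =>
    simp only [Fin.cons_succ]
    split_ifs
    · rfl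
    · simp [lin]

theorem hasDeg_homotopySum {n : ℕ} {E : MultilinearMap k (fun _ : Fin (n + 1) => A) B}
    (hE : HasDeg 𝒜 ℬ 1 E) {H π : A →ₗ[k] A} (hH : ∀ i, ∀ a ∈ 𝒜.deg i, H a ∈ 𝒜.deg (i + -1))
    (hπ : ∀ i, ∀ a ∈ 𝒜.deg i, π a ∈ 𝒜.deg i) : HasDeg 𝒜 ℬ 0 (homotopySum E H π) := by
  refine hasDeg_sum _ fun b _ p a ha => ?_
  have := hE (Fin.cons (p 0 + -1) fun i : Fin n => p i.succ)
    (fun i => (Fin.cons H fun i : Fin n => if (i : ℕ) < (b : ℕ) then π else LinearMap.id :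
      Fin (n + 1) → A →ₗ[k] A) i (a i)) fun i => by
    induction i using Fin.cases with
    | zero => exact hH _ _ (ha 0)
    | succ i =>
      simp only [Fin.cons_succ]
      split_ifs
      · exact hπ _ _ (ha _)
      · exact ha _
  rw [Fin.sum_univ_succ] at this ⊢
  simp only [Fin.cons_zero, Fin.cons_succ] at this
  rwa [show p 0 + -1 + ∑ i : Fin n, p i.succ + 1 = p 0 + ∑ i : Fin n, p i.succ + 0 by ring]
    at this

variable [Algebra ℚ k]

/-- Multilinear maps are determined by their multiples by parameters. -/
theorem diag_eq_of_smul {n N : ℕ} {φ ψ : MultilinearMap k (fun _ : Fin n => A) B}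
    (H : ∀ p : Grassmann.Params k N, ∀ y ∈ 𝒜.pts 0,
      p.θ' • p.θ • p.h ^ N • diag φ y = p.θ' • p.θ • p.h ^ N • diag ψ y) :
    ∀ y ∈ 𝒜.pts 0, diag φ y = diag ψ y := by
  intro y hy
  obtain ⟨p⟩ := Grassmann.exists_params (k := k) N
  have := H p _ (map_mem_pts p.s_mem hy)
  rw [diag_map, diag_map] at this
  exact Params.eq_of_smul p this

section Step

variable {QA : MSeq k A A} {QB : MSeq k B B} {F : MSeq k B A} {r : A →ₗ[k] B} {H : A →ₗ[k] A}
  {n : ℕ}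

/-- Failure of `G` to be a morphism in arity `n`. -/
def defect (𝒜 : Grading k A) (QA : MSeq k A A) (QB : MSeq k B B) (G : MSeq k A B) (n : ℕ) :
    MultilinearMap k (fun _ : Fin n => A) B :=
  avg 𝒜 (compSeq QB G n - insSeq G QA n)

theorem hasDeg_defect (hA : IsLInf 𝒜 QA) (hB : IsLInf ℬ QB) {G : MSeq k A B}
    (hG : ∀ n, HasDeg 𝒜 ℬ 0 (G n)) : HasDeg 𝒜 ℬ 1 (defect 𝒜 QA QB G n) :=
  hasDeg_avg (hasDeg_sub (hasDeg_compSeq hB.hasDeg hG n) (by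
    simpa using hasDeg_insSeq hG hA.hasDeg n))

theorem diag_defect {G : MSeq k A B} {y : Pt k A} (hy : y ∈ 𝒜.pts 0) :
    diag (defect 𝒜 QA QB G n) y = diag (compSeq QB G n) y - diag (insSeq G QA n) y := by
  refine (ext_avg_diag _ hy).trans ?_
  rw [ext_sub]
  rfl

/-- With the equations known below arity n, the two sides of the flow equation differ only in the
term of order h^n. -/
theorem ev_defect (hA : IsLInf 𝒜 QA) {G : MSeq k A B} (hG0 : G 0 = 0) (hG : ∀ n, IsSymm 𝒜 (G n))
    (hc : ∀ m < n, ∀ y ∈ 𝒜.pts 0, diag (compSeq QB G m) y = diag (insSeq G QA m) y)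
    {h θ : Grassmann k} (h0 : h ∈ Grassmann.part 0) (hθ : θ ∈ Grassmann.part 1)
    (hn : h ^ (n + 1) = 0) {y : Pt k A} (hy : y ∈ 𝒜.pts 0) :
    ev n G (h • y + θ • ev n QA (h • y)) + θ • h ^ n • diag (defect 𝒜 QA QB G n) y =
      ev n G (h • y) + θ • ev n QB (ev n G (h • y)) := by
  rw [ev_add_odd h0 hθ hn hG hA.hasDeg hA.zero hy, ev_ev h0 hn _ hG0, ev_smul h0 n (insSeq G QA),
    ev_smul h0 n (compSeq QB G), Finset.sum_range_succ, Finset.sum_range_succ,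
    Finset.sum_congr rfl fun m hm => congrArg (h ^ m • ·) (hc m (Finset.mem_range.mp hm) y hy).symm,
    diag_defect hy]
  simp only [smul_add, smul_sub]
  abel

/-- At a point F(hy), the flow of A is the image under F of the flow of B. Since GF = id up to arity
n inclusive, G intertwines the flows there, so the defect term vanishes; the argument of the defect
is φ(y) up to order h. -/
theorem defect_comp (hA : IsLInf 𝒜 QA) (hB : IsLInf ℬ QB) (hF : IsMor ℬ 𝒜 QB QA F)
    {G : MSeq k A B} (hG0 : G 0 = 0) (hG : ∀ n, IsSymm 𝒜 (G n)) (hn : 1 ≤ n)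
    (hc : ∀ m < n, ∀ y ∈ 𝒜.pts 0, diag (compSeq QB G m) y = diag (insSeq G QA m) y)
    (hGF : ∀ m ≤ n, ∀ y ∈ ℬ.pts 0, diag (compSeq G F m) y = diag (idSeq k B m) y) :
    ∀ y ∈ ℬ.pts 0, diag (defect 𝒜 QA QB G n) (lin (unary (F 1)) y) = 0 := by
  have key := diag_eq_of_smul (𝒜 := ℬ) (N := n)
    (φ := (defect 𝒜 QA QB G n).compLinearMap fun _ => unary (F 1)) (ψ := 0) fun p y hy => by
    congr 1
    rw [diag, ext_compLinearMap, diag, ext_zero, _root_.zero_apply, smul_zero, smul_zero]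
    obtain ⟨u, hu, hu'⟩ := exists_ev_eq_smul_lin p.h_mem hF.zero hF.hasDeg hn hy
    replace hu : u ∈ 𝒜.pts 0 := by exact_mod_cast hu
    have hw : lin (unary (F 1)) y + p.h • u ∈ 𝒜.pts 0 := by
      refine add_mem ?_ (even_smul_mem_pts p.h_mem hu)
      simpa using lin_mem_pts (unary_mem (hF.hasDeg 1)) hy
    have hev : ∀ z ∈ ℬ.pts 0, ev n G (ev n F (p.h • z)) = p.h • z := fun z hz => by
      rw [ev_ev p.h_mem p.h_pow _ hF.zero, ev_congr p.h_mem fun m hm => hGF m hm z hz, ev_idSeq hn]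
    have h1 := ev_defect (QB := QB) hA hG0 hG hc p.h_mem p.θ_mem p.h_pow hw
    obtain ⟨z, hz, hz'⟩ := exists_point p.h_mem p.θ hn hB hy
    have hy' : y + p.θ • (lin (unary (QB 1)) y + p.h • z) ∈ ℬ.pts 0 :=
      add_mem hy (odd_smul_mem_pts p.θ_mem (add_mem
        (by simpa using lin_mem_pts (unary_mem (hB.hasDeg 1)) hy)
        (even_smul_mem_pts p.h_mem hz)))
    rw [← hu', ← ev_comm p.h_mem p.θ_mem p.h_pow hB hF.zero hF.isSymm (fun m _ => hF.comm m) hy,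
      hz', hev _ hy', ← hz', hev _ hy, add_eq_left] at h1
    rw [← h1]
    congr 1
    have := pow_smul_diag_add p.h_mem (i := n) (j := 1) p.h_pow (by omega) (defect 𝒜 QA QB G n)
      (lin (unary (F 1)) y) u
    rw [pow_one] at this
    exact this.symm
  intro y hy
  have := key y hy
  rw [diag, ext_compLinearMap, diag, ext_zero, _root_.zero_apply] at this
  exact this

/-- The cocycle condition. Moving along the flow with θ and then with θ' is the same as moving with
θ + θ', because Q(x + θQ(x)) = Q(x). Applying `ev_defect` to the three moves and comparing the terms
in θ'θh^(n+1) gives the equation. -/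
theorem defect_d (hA : IsLInf 𝒜 QA) (hB : IsLInf ℬ QB)
    {G : MSeq k A B} (hG0 : G 0 = 0) (hGd : ∀ n, HasDeg 𝒜 ℬ 0 (G n)) (hG : ∀ n, IsSymm 𝒜 (G n))
    (hc : ∀ m < n + 1, ∀ y ∈ 𝒜.pts 0, diag (compSeq QB G m) y = diag (insSeq G QA m) y) :
    ∀ y ∈ 𝒜.pts 0, (n + 1) • ext (defect 𝒜 QA QB G (n + 1))
        (Fin.cons (lin (unary (QA 1)) y) fun _ => y) =
      -lin (unary (QB 1)) (diag (defect 𝒜 QA QB G (n + 1)) y) := by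
  set E := defect 𝒜 QA QB G (n + 1) with hE
  have hEs : IsSymm 𝒜 E := isSymm_avg _
  intro y hy
  obtain ⟨p⟩ := Grassmann.exists_params (k := k) (n + 1)
  -- It is enough to prove a multiple of the identity for all points, since it can then be applied
  -- to a point whose coefficients have been moved away from the parameters.
  suffices hs : ∀ y ∈ 𝒜.pts 0, p.θ' • p.θ • p.h ^ (n + 1) • ((n + 1) • ext E
        (Fin.cons (lin (unary (QA 1)) y) fun _ => y)) =
      p.θ' • p.θ • p.h ^ (n + 1) • -lin (unary (QB 1)) (diag E y) by
    have := hs _ (map_mem_pts p.s_mem hy)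
    rw [diag_map, lin_map, lin_map, ← map_neg] at this
    refine Params.eq_of_smul p ?_
    rw [← this, map_nsmul, ← ext_map]
    congr 6
    funext i
    induction i using Fin.cases <;> rfl
  clear hy y
  intro y hy
  have h0 := p.h_mem
  have hθ := p.θ_mem
  have hθ' := p.θ'_mem
  have hn := p.h_pow
  obtain ⟨u, hu, hy'⟩ := exists_point h0 p.θ (Nat.le_add_left 1 n) hA hy
  set w := lin (unary (QA 1)) y + p.h • u with hw
  have hwm : w ∈ 𝒜.pts 1 := add_mem
    (by simpa using lin_mem_pts (unary_mem (hA.hasDeg 1)) hy) (even_smul_mem_pts h0 hu)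
  have hym : y + p.θ • w ∈ 𝒜.pts 0 := add_mem hy (odd_smul_mem_pts hθ hwm)
  have f1 := ev_defect (QB := QB) hA hG0 hG hc h0 hθ hn hy
  have f2 := ev_defect (QB := QB) hA hG0 hG hc h0 hθ' hn hym
  have f3 := ev_defect (QB := QB) hA hG0 hG hc h0 (add_mem hθ hθ') hn hy
  rw [← hy', hA.ev_sq h0 hθ hn hy] at f2
  rw [add_smul, ← add_assoc] at f3
  rw [← hE] at f1 f2 f3
  obtain ⟨v, hv, hv'⟩ := exists_ev_eq_smul h0 hG0 hGd (n + 1) hy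
  replace hv : v ∈ ℬ.pts 0 := by exact_mod_cast hv
  obtain ⟨z, -, hz'⟩ := exists_point h0 p.θ (Nat.le_add_left 1 n) hB hv
  rw [← hv'] at hz'
  -- G sends the moved point to the moved image, up to the defect. The field of B is constant along
  -- its flow and sees the defect, of top order, only through its linear part.
  have f4 : ev (n + 1) QB (ev (n + 1) G (p.h • y + p.θ • ev (n + 1) QA (p.h • y))) =
      ev (n + 1) QB (ev (n + 1) G (p.h • y)) +
        p.h ^ (n + 1) • lin (unary (QB 1)) (-(p.θ • diag E y)) := by
    rw [eq_sub_of_add_eq f1, hz', ← pow_smul_comm h0, sub_eq_add_neg,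
      ← smul_neg (p.h ^ (n + 1)) (p.θ • diag E y),
      ev_add_top h0 hn (Nat.le_add_left 1 n), ← hz', hv', hB.ev_sq h0 hθ hn hv]
  rw [f4, eq_sub_of_add_eq f1] at f2
  rw [eq_sub_of_add_eq f3, diag_add_odd hθ hEs hy hwm] at f2
  have e1 : p.h ^ (n + 1) • (n + 1) • ext E (Fin.cons w fun _ => y) =
      p.h ^ (n + 1) • (n + 1) • ext E (Fin.cons (lin (unary (QA 1)) y) fun _ => y) := by
    rw [smul_comm, smul_comm _ (n + 1), hw, ← MultilinearMap.curryLeft_apply, map_add,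
      _root_.add_apply, MultilinearMap.curryLeft_apply, MultilinearMap.curryLeft_apply,
      ext_cons_smul, smul_add (p.h ^ (n + 1)), smul_smul (p.h ^ (n + 1)), ← pow_succ, hn,
      zero_smul, add_zero]
  rw [map_neg, map_smul] at f2
  rw [← e1]
  generalize (n + 1) • ext E (Fin.cons w fun _ => y) = X at f2 ⊢
  rw [smul_add (p.h ^ (n + 1)), pow_smul_comm h0 _ _ X, smul_neg (p.h ^ (n + 1)),
    pow_smul_comm h0 _ _ (lin _ _), add_smul, add_smul] at f2
  simp only [smul_add, smul_neg] at f2 ⊢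
  rw [← sub_eq_zero] at f2 ⊢
  rw [← f2]
  abel

/-- On the diagonal this is the cocycle condition together with `diag_add_odd`. Both sides are
symmetric on even points, so polarization extends it to arbitrary arguments, as needed for mixed
entries H, π and 1. -/
theorem defect_one_add (hA : IsLInf 𝒜 QA) {E : MultilinearMap k (fun _ : Fin (n + 1) => A) B}
    (hEs : IsSymm 𝒜 E) (hE : ∀ y ∈ 𝒜.pts 0,
      (n + 1) • ext E (Fin.cons (lin (unary (QA 1)) y) fun _ => y) =
        -lin (unary (QB 1)) (diag E y))
    {θ : Grassmann k} (hθ : θ ∈ Grassmann.part 1) {y : Fin (n + 1) → Pt k A}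
    (hy : ∀ i, y i ∈ 𝒜.pts 0) :
    ext E (fun i => y i + θ • lin (unary (QA 1)) (y i)) =
      ext E y - θ • lin (unary (QB 1)) (ext E y) := by
  set T : Pt k A →ₗ[k] Pt k A :=
    LinearMap.id + Algebra.lsmul k k (Pt k A) θ ∘ₗ (lin (unary (QA 1))).restrictScalars k with hT
  set S : Pt k B →ₗ[k] Pt k B :=
    LinearMap.id - Algebra.lsmul k k (Pt k B) θ ∘ₗ (lin (unary (QB 1))).restrictScalars k with hS
  have hTm : ∀ y ∈ 𝒜.pts 0, T y ∈ 𝒜.pts 0 := fun y hy =>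
    add_mem hy (odd_smul_mem_pts hθ (by simpa using lin_mem_pts (unary_mem (hA.hasDeg 1)) hy))
  have := MultilinearMap.eq_zero_of_diag (k := k)
    ((ext E).compLinearMap (fun _ => T) - S.compMultilinearMap (ext E)) (𝒜.pts 0) ?_ ?_ y hy
  · exact sub_eq_zero.mp this
  · intro y hy
    refine sub_eq_zero.mpr ?_
    change diag E (y + θ • lin (unary (QA 1)) y) =
      diag E y - θ • lin (unary (QB 1)) (diag E y)
    rw [diag_add_odd hθ hEs hy (by simpa using lin_mem_pts (unary_mem (hA.hasDeg 1)) hy), hE y hy,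
      sub_eq_add_neg, ← smul_neg θ (lin (unary (QB 1)) (diag E y))]
  · intro y hy σ
    change ext E (fun i => T (y (σ i))) - S (ext E fun i => y (σ i)) =
      ext E (fun i => T (y i)) - S (ext E y)
    rw [ext_perm_of_isSymm hEs hy σ, ext_perm_of_isSymm hEs (fun i => hTm _ (hy i)) σ]

/-- The homotopy formula for K. Moving the entry H along d produces 1 - π, and the resulting sum ∑
E(y - πy, πy, …, πy, y, …, y) telescopes to E(y, …, y) - E(πy, …, πy), whose second term is zero.
The factor θ' makes θ'H(y) an even point, to which the symmetry of E applies. -/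
theorem homotopySum_one_add (hA : IsLInf 𝒜 QA)
    {E : MultilinearMap k (fun _ : Fin (n + 1) => A) B}
    (hEs : IsSymm 𝒜 E) (hE : ∀ y ∈ 𝒜.pts 0,
      (n + 1) • ext E (Fin.cons (lin (unary (QA 1)) y) fun _ => y) =
        -lin (unary (QB 1)) (diag E y))
    {φ : B →ₗ[k] A} (hC : IsContraction 𝒜 ℬ (unary (QA 1)) (unary (QB 1)) φ r H)
    (hφ : ∀ i, ∀ b ∈ ℬ.deg i, φ b ∈ 𝒜.deg i)
    (hEφ : ∀ y ∈ ℬ.pts 0, diag E (lin φ y) = 0)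
    {θ θ' : Grassmann k} (hθ : θ ∈ Grassmann.part 1) (hθ' : θ' ∈ Grassmann.part 1)
    {y : Pt k A} (hy : y ∈ 𝒜.pts 0) :
    θ' • diag (homotopySum E H (φ ∘ₗ r)) (y + θ • lin (unary (QA 1)) y) =
      θ' • (diag (homotopySum E H (φ ∘ₗ r)) y +
        θ • (lin (unary (QB 1)) (diag (homotopySum E H (φ ∘ₗ r)) y) + diag E y)) := by
  set d := unary (QA 1) with hd
  set d' := unary (QB 1) with hd'
  set π := φ ∘ₗ r with hπ
  have hπm : ∀ y ∈ 𝒜.pts 0, lin π y ∈ 𝒜.pts 0 := fun y hy => by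
    simpa using lin_mem_pts (d := 0) (e := 0) (f := π) (fun i a ha => by
      rw [add_zero]; exact hφ _ _ (hC.r_mem _ _ ha)) hy
  have hHy : θ' • lin H y ∈ 𝒜.pts 0 := odd_smul_mem_pts hθ'
    (by simpa using lin_mem_pts (d := -1) (e := 0) hC.H_mem hy)
  have hz : ∀ (a : Fin (n + 1)) (i : Fin n),
      (if (i : ℕ) < (a : ℕ) then lin π y else y) ∈ 𝒜.pts 0 := fun a i => by
    split_ifs
    · exact hπm _ hy
    · exact hy
  have hθθ := Grassmann.odd_mul_self hθ
  have hanti : θ' * θ = -(θ * θ') := by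
    rw [Grassmann.mul_comm_of_mem (p := 1) (q := 1) (by simpa using hθ) (by simpa using hθ')]
    simp
  have hdπ : lin π (lin d y) = lin d (lin π y) := by
    rw [← lin_comp, ← lin_comp]
    exact lin_eq (fun a => by simp [hπ, hC.r_d, hC.φ_d]) y
  have hhom : lin d (lin H y) + lin H (lin d y) = y - lin π y := by
    have := lin_eq (f := d ∘ₗ H + H ∘ₗ d) (g := LinearMap.id - π)
      (fun a => by simp [hπ, hC.homotopy]) y
    simpa [lin, LinearMap.baseChange_add, LinearMap.baseChange_sub, LinearMap.baseChange_comp]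
      using this
  -- Here Hd is replaced by 1 - π - dH; the sign of dH is absorbed by θ'θ = -θθ'.
  have e1 : θ' • lin H (y + θ • lin d y) =
      (θ' • lin H y + θ • lin d (θ' • lin H y)) + θ' • θ • (y - lin π y) := by
    rw [← hhom, map_add, map_smul, map_smul, smul_add, smul_add, smul_add, smul_smul θ θ',
      smul_smul θ' θ, smul_smul θ' θ, hanti, neg_smul, neg_smul]
    abel
  have e2 : ∀ a : Fin (n + 1), θ' • ext E (Fin.cons (lin H (y + θ • lin d y)) fun i : Fin n =>
      if (i : ℕ) < (a : ℕ) then lin π (y + θ • lin d y) else y + θ • lin d y) =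
      θ' • (ext E (Fin.cons (lin H y) fun i : Fin n => if (i : ℕ) < (a : ℕ) then lin π y else y) +
        θ • (lin d' (ext E (Fin.cons (lin H y) fun i : Fin n =>
          if (i : ℕ) < (a : ℕ) then lin π y else y)) +
        ext E (Fin.cons (y - lin π y) fun i : Fin n =>
          if (i : ℕ) < (a : ℕ) then lin π y else y))) := by
    intro a
    set z : Fin n → Pt k A := fun i => if (i : ℕ) < (a : ℕ) then lin π y else y with hz'
    have hz'' : (fun i : Fin n => if (i : ℕ) < (a : ℕ) then lin π (y + θ • lin d y)
        else y + θ • lin d y) = fun i => z i + θ • lin d (z i) := by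
      funext i
      simp only [hz']
      split_ifs
      · rw [map_add, map_smul, hdπ]
      · rfl
    rw [hz'', ← ext_cons_smul, e1, ← MultilinearMap.curryLeft_apply, map_add, _root_.add_apply,
      MultilinearMap.curryLeft_apply, MultilinearMap.curryLeft_apply, ext_cons_smul,
      ext_cons_smul]
    have h1 := defect_one_add (QB := QB) hA hEs hE hθ (y := Fin.cons (θ' • lin H y) z) fun i => by
      induction i using Fin.cases with
      | zero => exact hHy
      | succ i => exact hz a i
    have h2 : (fun i => (Fin.cons (θ' • lin H y) z : Fin (n + 1) → Pt k A) i +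
        θ • lin (unary (QA 1)) ((Fin.cons (θ' • lin H y) z : Fin (n + 1) → Pt k A) i)) =
        Fin.cons (θ' • lin H y + θ • lin d (θ' • lin H y)) fun i => z i + θ • lin d (z i) := by
      funext i
      induction i using Fin.cases <;> rfl
    rw [h2] at h1
    have h3 := odd_smul_ext_add hθ hθθ E (Fin.cons (y - lin π y) z)
      (Fin.cons 0 fun i => lin d (z i))
    have h4 : (fun i => (Fin.cons (y - lin π y) z : Fin (n + 1) → Pt k A) i +
        θ • (Fin.cons 0 fun i => lin d (z i) : Fin (n + 1) → Pt k A) i) =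
        Fin.cons (y - lin π y) fun i => z i + θ • lin d (z i) := by
      funext i
      induction i using Fin.cases with
      | zero => simp
      | succ i => rfl
    rw [h4] at h3
    rw [h1, h3, ext_cons_smul, map_smul, smul_add θ', smul_add θ, smul_add θ', smul_smul θ' θ (lin _ _),
      hanti, neg_smul, smul_smul θ θ', ← hd']
    abel
  have e3 := diag_sub_diag hEs (hπm y hy) hy
  have e4 : diag E (lin π y) = 0 := by
    rw [hπ, lin_comp]
    refine hEφ _ ?_
    simpa using lin_mem_pts (d := 0) (e := 0) (fun i a ha => by
      rw [add_zero]; exact hC.r_mem _ _ ha) hy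
  rw [e4, sub_zero] at e3
  rw [diag_homotopySum, Finset.smul_sum, Finset.sum_congr rfl fun a _ => e2 a, ← Finset.smul_sum,
    Finset.sum_add_distrib, ← Finset.smul_sum, Finset.sum_add_distrib, ← e3,
    ← map_sum (lin d'),
    ← diag_homotopySum]

end Step

end Retraction

end LInfty

/-! ### Inductive construction of a left inverse morphism. -/

namespace LInfty

open scoped TensorProduct

section Retraction

variable {k : Type u} [CommRing k] {A B : Type*} [AddCommGroup A] [Module k A]
  [AddCommGroup B] [Module k B] {𝒜 : Grading k A} {ℬ : Grading k B}
  {QA : MSeq k A A} {QB : MSeq k B B} {F : MSeq k B A} {r : A →ₗ[k] B} {H : A →ₗ[k] A} {n : ℕ}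

/-- `G` is a morphism and a left inverse of `F` up to arity `n`. -/
structure IsPartialRetraction (𝒜 : Grading k A) (ℬ : Grading k B) (QA : MSeq k A A)
    (QB : MSeq k B B) (F : MSeq k B A) (r : A →ₗ[k] B) (n : ℕ) (G : MSeq k A B) : Prop where
  zero : G 0 = 0
  one : unary (G 1) = r
  hasDeg : ∀ m, HasDeg 𝒜 ℬ 0 (G m)
  isSymm : ∀ m, IsSymm 𝒜 (G m)
  comm : ∀ m ≤ n, ∀ y ∈ 𝒜.pts 0, diag (compSeq QB G m) y = diag (insSeq G QA m) y
  leftInv : ∀ m ≤ n, ∀ y ∈ ℬ.pts 0, diag (compSeq G F m) y = diag (idSeq k B m) y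

/-- In arity one the two requirements are precisely that r is a chain map and that rφ = 1. -/
theorem isPartialRetraction_one (hA : IsLInf 𝒜 QA)
    (hC : IsContraction 𝒜 ℬ (unary (QA 1)) (unary (QB 1)) (unary (F 1)) r H) (hB : QB 0 = 0) :
    IsPartialRetraction 𝒜 ℬ QA QB F r 1 (linSeq r) := by
  refine ⟨rfl, rfl, fun m => hasDeg_linSeq (fun i a ha => ?_) m, isSymm_linSeq 𝒜 r,
    fun m hm y _ => ?_, fun m hm y _ => ?_⟩
  · rw [add_zero]
    exact hC.r_mem _ _ ha
  · congr 1
    interval_cases m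
    · rw [insSeq_zero _ hA.zero, compSeq_zero hB]
    · refine MultilinearMap.ext fun a => ?_
      rw [compSeq_one_apply, insSeq_one_apply _ hA.zero]
      exact (hC.r_d _).symm
  · congr 1
    interval_cases m
    · rw [compSeq_zero rfl]
      rfl
    · refine MultilinearMap.ext fun a => ?_
      rw [compSeq_one_apply]
      exact hC.r_φ _

variable [Algebra ℚ k]

/-- Since rφ = 1, adding (id - GF) ∘ (r, …, r) to the top coefficient of G changes GF in that arity
by exactly the missing amount: at top order F acts through its linear part φ. -/
theorem exists_leftInv_step (hF : IsMor ℬ 𝒜 QB QA F)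
    (hC : IsContraction 𝒜 ℬ (unary (QA 1)) (unary (QB 1)) (unary (F 1)) r H) (hn : 1 ≤ n)
    {G : MSeq k A B} (hG : IsPartialRetraction 𝒜 ℬ QA QB F r n G) :
    ∃ ψ : MultilinearMap k (fun _ : Fin (n + 1) => A) B, HasDeg 𝒜 ℬ 0 ψ ∧ IsSymm 𝒜 ψ ∧
      ∀ m ≤ n + 1, ∀ y ∈ ℬ.pts 0,
        diag (compSeq (Function.update G (n + 1) (G (n + 1) + ψ)) F m) y =
          diag (idSeq k B m) y := by
  set χ : MultilinearMap k (fun _ : Fin (n + 1) => A) B :=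
    (idSeq k B (n + 1) - compSeq G F (n + 1)).compLinearMap fun _ => r with hχ
  have hrm : ∀ y ∈ 𝒜.pts 0, lin r y ∈ ℬ.pts 0 := fun y hy => by
    simpa using lin_mem_pts (d := 0) (e := 0) (fun i a ha => by
      rw [add_zero]; exact hC.r_mem _ _ ha) hy
  -- Here n + 1 ≥ 2, so the identity series contributes nothing and the degree of χ is that of GF.
  have hid : idSeq k B (n + 1) = 0 := by
    obtain ⟨n, rfl⟩ := Nat.exists_eq_add_of_le' hn
    rfl
  have hχd : HasDeg 𝒜 ℬ 0 χ := by
    intro p a ha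
    have h1 := hasDeg_compSeq hG.hasDeg hF.hasDeg (n + 1) p (fun i => r (a i))
      fun i => hC.r_mem _ _ (ha i)
    rw [hχ, hid, zero_sub]
    exact neg_mem h1
  refine ⟨avg 𝒜 χ, hasDeg_avg hχd, isSymm_avg _, ?_⟩
  have hlt : ∀ m < n + 1, ∀ y ∈ ℬ.pts 0,
      diag (compSeq (Function.update G (n + 1) (G (n + 1) + avg 𝒜 χ)) F m) y =
        diag (idSeq k B m) y := by
    intro m hm y hy
    rw [compSeq_congr (Φ' := G) (F' := F)
      (fun j hj => Function.update_of_ne (by omega) _ _) fun _ _ => rfl]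
    exact hG.leftInv m (by omega) y hy
  intro m hm
  rcases Nat.lt_succ_iff_lt_or_eq.mp (Nat.lt_succ_of_le hm) with hm | rfl
  · exact hlt m hm
  refine diag_eq_of_ev_of_lt hlt fun p y hy => congrArg (p.θ' • p.θ • ·) ?_
  rw [← ev_ev p.h_mem p.h_pow _ hF.zero, ev_idSeq (Nat.le_add_left 1 n)]
  obtain ⟨u, hu, hu'⟩ := exists_ev_eq_smul_lin p.h_mem hF.zero hF.hasDeg
    (Nat.le_add_left 1 n) hy
  replace hu : u ∈ 𝒜.pts 0 := by exact_mod_cast hu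
  have hφ : lin (unary (F 1)) y ∈ 𝒜.pts 0 := by
    simpa using lin_mem_pts (unary_mem (hF.hasDeg 1)) hy
  have h1 := pow_smul_diag_add p.h_mem (i := n + 1) (j := 1) p.h_pow (by omega) (avg 𝒜 χ)
    (lin (unary (F 1)) y) u
  rw [pow_one, diag, diag, ext_avg_diag _ hφ, hχ, ext_compLinearMap] at h1
  have h2 : lin r (lin (unary (F 1)) y) = y := by
    rw [← lin_comp, lin_eq (g := LinearMap.id) hC.r_φ]
    simp [lin]
  rw [hu', ev_update p.h_mem, ← hu', ev_ev p.h_mem p.h_pow _ hF.zero]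
  refine (congrArg (_ + ·) h1).trans ?_
  rw [h2, ext_sub, ev_smul p.h_mem, Finset.sum_range_succ _ (n + 1)]
  refine Eq.trans ?_ (ev_idSeq (Nat.le_add_left 1 n) (p.h • y))
  rw [ev_smul p.h_mem, Finset.sum_range_succ _ (n + 1),
    Finset.sum_congr rfl fun m hm => congrArg (p.h ^ m • ·)
      (hG.leftInv m (Nat.lt_succ_iff.mp (Finset.mem_range.mp hm)) y hy), _root_.sub_apply,
    smul_sub]
  abel

/-- Adding K replaces the defect E by E + d'K - K·d, where K·d inserts d into each argument in turn;
this is zero by `homotopySum_one_add`. -/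
theorem exists_comm_step (hA : IsLInf 𝒜 QA) (hB : IsLInf ℬ QB) (hF : IsMor ℬ 𝒜 QB QA F)
    (hC : IsContraction 𝒜 ℬ (unary (QA 1)) (unary (QB 1)) (unary (F 1)) r H) (hn : 1 ≤ n)
    {G : MSeq k A B} (hG : IsPartialRetraction 𝒜 ℬ QA QB F r n G)
    (hGF : ∀ m ≤ n + 1, ∀ y ∈ ℬ.pts 0, diag (compSeq G F m) y = diag (idSeq k B m) y) :
    ∃ ψ : MultilinearMap k (fun _ : Fin (n + 1) => A) B,
      IsPartialRetraction 𝒜 ℬ QA QB F r (n + 1)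
        (Function.update G (n + 1) (G (n + 1) + ψ)) := by
  have hcl : ∀ m < n + 1, ∀ y ∈ 𝒜.pts 0, diag (compSeq QB G m) y = diag (insSeq G QA m) y :=
    fun m hm => hG.comm m (Nat.lt_succ_iff.mp hm)
  have hN : 1 ≤ n + 1 := Nat.le_add_left 1 n
  set E := defect 𝒜 QA QB G (n + 1) with hE
  have hEs : IsSymm 𝒜 E := isSymm_avg _
  have hEφ := defect_comp hA hB hF hG.zero hG.isSymm hN hcl hGF
  have hEd := defect_d hA hB hG.zero hG.hasDeg hG.isSymm hcl
  have hφm : ∀ i, ∀ b ∈ ℬ.deg i, unary (F 1) b ∈ 𝒜.deg i := fun i b hb => by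
    simpa using unary_mem (hF.hasDeg 1) i b hb
  set K := homotopySum E H (unary (F 1) ∘ₗ r) with hK
  have hKd : HasDeg 𝒜 ℬ 0 K := hasDeg_homotopySum (hasDeg_defect hA hB hG.hasDeg) hC.H_mem
    fun i a ha => hφm _ _ (hC.r_mem _ _ ha)
  -- The side condition Hφ = 0 ensures that the correction leaves GF untouched.
  have hKφ : ∀ y, diag K (lin (unary (F 1)) y) = 0 := by
    intro y
    rw [hK, diag_homotopySum]
    refine Finset.sum_eq_zero fun a _ => ?_
    have h1 : lin H (lin (unary (F 1)) y) = 0 := by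
      rw [← lin_comp, lin_eq (g := 0) hC.H_φ]
      simp [lin]
    rw [h1]
    exact (ext E).map_coord_zero 0 rfl
  set ψ := avg 𝒜 K with hψ
  have hdiag : ∀ y ∈ 𝒜.pts 0, diag ψ y = diag K y := fun y hy => ext_avg_diag _ hy
  set G' := Function.update G (n + 1) (G (n + 1) + ψ) with hG'
  have hne : ∀ m, m ≠ n + 1 → G' m = G m := fun m hm => Function.update_of_ne hm _ _
  have h0' : G' 0 = 0 := (hne 0 (by omega)).trans hG.zero
  have hdeg : ∀ m, HasDeg 𝒜 ℬ 0 (G' m) := fun m => by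
    by_cases hm : m = n + 1
    · subst hm
      rw [hG', Function.update_self]
      exact hasDeg_add (hG.hasDeg _) (hasDeg_avg hKd)
    · rw [hne m hm]
      exact hG.hasDeg m
  have hsymm : ∀ m, IsSymm 𝒜 (G' m) := fun m => by
    by_cases hm : m = n + 1
    · subst hm
      rw [hG', Function.update_self]
      exact isSymm_add (hG.isSymm _) (isSymm_avg K)
    · rw [hne m hm]
      exact hG.isSymm m
  have hcomm : ∀ m < n + 1, ∀ y ∈ 𝒜.pts 0,
      diag (compSeq QB G' m) y = diag (insSeq G' QA m) y := fun m hm y hy => by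
    rw [compSeq_congr (Φ' := QB) (F' := G) (fun _ _ => rfl) fun j hj => hne j (by omega),
      insSeq_congr (Φ' := G) hA.zero fun j hj => hne j (by omega)]
    exact hcl m hm y hy
  have hinv : ∀ m < n + 1, ∀ y ∈ ℬ.pts 0,
      diag (compSeq G' F m) y = diag (idSeq k B m) y := fun m hm y hy => by
    rw [compSeq_congr (Φ' := G) (F' := F) (fun j hj => hne j (by omega)) fun _ _ => rfl]
    exact hGF m hm.le y hy
  refine ⟨ψ, h0', by rw [← hG', hne 1 (by omega), hG.one], hdeg, hsymm, ?_, ?_⟩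
  · intro m hm
    rcases Nat.lt_succ_iff_lt_or_eq.mp (Nat.lt_succ_of_le hm) with hm | rfl
    · exact hcomm m hm
    refine diag_eq_of_ev_of_lt hcomm fun p y hy => ?_
    have h0 := p.h_mem
    have hθ := p.θ_mem
    have hpn := p.h_pow
    obtain ⟨u, hu, hu'⟩ := exists_point h0 p.θ hN hA hy
    have hdy : lin (unary (QA 1)) y ∈ 𝒜.pts 1 := by
      simpa using lin_mem_pts (unary_mem (hA.hasDeg 1)) hy
    have hym : y + p.θ • (lin (unary (QA 1)) y + p.h • u) ∈ 𝒜.pts 0 :=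
      add_mem hy (odd_smul_mem_pts hθ (add_mem hdy (even_smul_mem_pts h0 hu)))
    have f1 := ev_add_odd h0 hθ hpn hsymm hA.hasDeg hA.zero hy
    have f2 := ev_defect (QB := QB) hA hG.zero hG.isSymm hcl h0 hθ hpn hy
    obtain ⟨v, -, hv'⟩ := exists_ev_eq_smul h0 hG.zero hG.hasDeg (n + 1) hy
    have f3 : ev (n + 1) G' (p.h • y) =
        ev (n + 1) G (p.h • y) + p.h ^ (n + 1) • diag K y := by
      rw [hG', ev_update h0, hdiag y hy]
    have f4 : ev (n + 1) (compSeq QB G') (p.h • y) = ev (n + 1) QB (ev (n + 1) G (p.h • y)) +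
        p.h ^ (n + 1) • lin (unary (QB 1)) (diag K y) := by
      rw [← ev_ev h0 hpn _ h0', f3, hv', ev_add_top h0 hpn hN]
    have f5 : p.h ^ (n + 1) • diag K (y + p.θ • (lin (unary (QA 1)) y + p.h • u)) =
        p.h ^ (n + 1) • diag K (y + p.θ • lin (unary (QA 1)) y) := by
      have := pow_smul_diag_add h0 (i := n + 1) (j := 1) hpn (by omega) K
        (y + p.θ • lin (unary (QA 1)) y) (p.θ • u)
      rw [← this, pow_one, smul_add p.θ, smul_smul p.h, smul_smul p.θ, Grassmann.even_mul h0,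
        add_assoc]
    have f6 : ev (n + 1) G' (p.h • y + p.θ • ev (n + 1) QA (p.h • y)) =
        ev (n + 1) G (p.h • y + p.θ • ev (n + 1) QA (p.h • y)) +
          p.h ^ (n + 1) • diag K (y + p.θ • lin (unary (QA 1)) y) := by
      rw [hu', hG', ev_update h0, hdiag _ hym, f5]
    have f7 := homotopySum_one_add (QB := QB) hA hEs hEd hC hφm hEφ hθ p.θ'_mem hy
    rw [← hK] at f7
    rw [f6, f3, eq_sub_of_add_eq f2] at f1
    have f8 := congrArg (p.θ' • ·) f1
    have f9 := congrArg (p.h ^ (n + 1) • ·) f7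
    simp only [pow_smul_comm h0, smul_add, smul_sub] at f8 f9
    rw [f9] at f8
    rw [f4]
    simp only [smul_add]
    rw [← sub_eq_zero] at f8 ⊢
    rw [← f8, ← hE, ← hG']
    abel
  · intro m hm
    rcases Nat.lt_succ_iff_lt_or_eq.mp (Nat.lt_succ_of_le hm) with hm | rfl
    · exact hinv m hm
    refine diag_eq_of_ev_of_lt hinv fun p y hy => congrArg (p.θ' • p.θ • ·) ?_
    obtain ⟨u, hu, hu'⟩ := exists_ev_eq_smul_lin p.h_mem hF.zero hF.hasDeg hN hy
    replace hu : u ∈ 𝒜.pts 0 := by exact_mod_cast hu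
    have hφ : lin (unary (F 1)) y ∈ 𝒜.pts 0 := by
      simpa using lin_mem_pts (unary_mem (hF.hasDeg 1)) hy
    have h1 := pow_smul_diag_add p.h_mem (i := n + 1) (j := 1) p.h_pow (by omega) ψ
      (lin (unary (F 1)) y) u
    rw [pow_one, hdiag _ hφ, hKφ, smul_zero] at h1
    rw [← ev_ev p.h_mem p.h_pow _ hF.zero, ev_idSeq hN, hu', ev_update p.h_mem, h1, add_zero,
      ← hu', ev_ev p.h_mem p.h_pow _ hF.zero, ev_congr p.h_mem fun m hm => hGF m hm y hy,
      ev_idSeq hN]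

/-- The left inverse equation is settled in arity n + 1 before the morphism equation, since
`defect_comp` requires GF = id in that very arity. Neither correction affects the equations already
known in lower arities. -/
theorem exists_step (hA : IsLInf 𝒜 QA) (hB : IsLInf ℬ QB) (hF : IsMor ℬ 𝒜 QB QA F)
    (hC : IsContraction 𝒜 ℬ (unary (QA 1)) (unary (QB 1)) (unary (F 1)) r H) (hn : 1 ≤ n)
    {G : MSeq k A B} (hG : IsPartialRetraction 𝒜 ℬ QA QB F r n G) :
    ∃ G', IsPartialRetraction 𝒜 ℬ QA QB F r (n + 1) G' ∧ ∀ m ≤ n, G' m = G m := by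
  obtain ⟨ψ, hd, hs, hψ⟩ := exists_leftInv_step hF hC hn hG
  set G' := Function.update G (n + 1) (G (n + 1) + ψ) with hG'
  have hne : ∀ m, m ≠ n + 1 → G' m = G m := fun m hm => Function.update_of_ne hm _ _
  have hP : IsPartialRetraction 𝒜 ℬ QA QB F r n G' := by
    refine ⟨(hne 0 (by omega)).trans hG.zero, by rw [hne 1 (by omega), hG.one], fun m => ?_,
      fun m => ?_, fun m hm y hy => ?_, fun m hm => hψ m (by omega)⟩
    · by_cases hm : m = n + 1
      · subst hm
        rw [hG', Function.update_self]
        exact hasDeg_add (hG.hasDeg _) hd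
      · rw [hne m hm]
        exact hG.hasDeg m
    · by_cases hm : m = n + 1
      · subst hm
        rw [hG', Function.update_self]
        exact isSymm_add (hG.isSymm _) hs
      · rw [hne m hm]
        exact hG.isSymm m
    · rw [compSeq_congr (Φ' := QB) (F' := G) (fun _ _ => rfl) fun j hj => hne j (by omega),
        insSeq_congr (Φ' := G) hA.zero fun j hj => hne j (by omega)]
      exact hG.comm m hm y hy
  obtain ⟨χ, hχ⟩ := exists_comm_step hA hB hF hC hn hP hψ
  refine ⟨_, hχ, fun m hm => ?_⟩
  rw [Function.update_of_ne (by omega), hne m (by omega)]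

/-- A morphism whose linear part has a homotopy inverse, strict on one side, has a left inverse. -/
theorem exists_retraction (hA : IsLInf 𝒜 QA) (hB : IsLInf ℬ QB) (hF : IsMor ℬ 𝒜 QB QA F)
    (hC : IsContraction 𝒜 ℬ (unary (QA 1)) (unary (QB 1)) (unary (F 1)) r H) :
    ∃ G, IsMor 𝒜 ℬ QA QB G ∧ unary (G 1) = r := by
  have h₁ := isPartialRetraction_one hA hC hB.zero
  choose! next hnext hnext' using fun (n : ℕ) (G : MSeq k A B)
    (hG : IsPartialRetraction 𝒜 ℬ QA QB F r (n + 1) G) =>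
      exists_step hA hB hF hC (Nat.le_add_left 1 n) hG
  let S : ℕ → MSeq k A B := fun n => Nat.rec (linSeq r) (fun n G => next n G) n
  have hS : ∀ n, IsPartialRetraction 𝒜 ℬ QA QB F r (n + 1) (S n) := fun n => by
    induction n with
    | zero => exact h₁
    | succ n ih => exact hnext n _ ih
  have hle : ∀ n j m, m ≤ n + 1 → S (n + j) m = S n m := fun n j m hm => by
    induction j with
    | zero => rfl
    | succ j ih => exact (hnext' (n + j) _ (hS (n + j)) m (by omega)).trans ih
  have hlim : ∀ n m, m ≤ n → S m m = S n m := fun n m hm => by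
    obtain ⟨j, rfl⟩ := Nat.exists_eq_add_of_le hm
    exact (hle m j m (by omega)).symm
  -- The diagonal limit: `S n` is already correct through arity n + 1 and these coefficients no
  -- longer change, while the equation in arity n involves only coefficients of arity at most n.
  refine ⟨fun n => S n n, ⟨(hS 0).zero, fun n => (hS n).hasDeg n, fun n => (hS n).isSymm n,
    fun n y hy => ?_⟩, (hS 1).one⟩
  rw [compSeq_congr (Φ' := QB) (F' := S n) (fun _ _ => rfl) (hlim n),
    insSeq_congr (Φ' := S n) hA.zero (hlim n)]
  exact (hS n).comm n (Nat.le_succ n) y hy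

end Retraction

end LInfty

/-! ### Replacing a morphism by one with a strictly left invertible linear part. -/

namespace LInfty

open scoped TensorProduct

section Cone

variable {k : Type u} [CommRing k] {A B C : Type*} [AddCommGroup A] [Module k A]
  [AddCommGroup B] [Module k B] [AddCommGroup C] [Module k C]
  {𝒜 : Grading k A} {ℬ : Grading k B} {𝒞 : Grading k C}

/-- The composite of a power series with a linear map. -/
def postSeq (f : B →ₗ[k] C) (Φ : MSeq k A B) : MSeq k A C := fun n => f.compMultilinearMap (Φ n)

/-- The composite of a linear map with a power series. -/
def preSeq (Φ : MSeq k B C) (f : A →ₗ[k] B) : MSeq k A C := fun n =>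
  (Φ n).compLinearMap fun _ => f

theorem ev_postSeq (N : ℕ) (f : B →ₗ[k] C) (Φ : MSeq k A B) (x : Pt k A) :
    ev N (postSeq f Φ) x = lin f (ev N Φ x) := by
  rw [ev, ev, map_sum]
  exact Finset.sum_congr rfl fun n _ => ext_compMultilinearMap _ _ _

theorem ev_preSeq (N : ℕ) (Φ : MSeq k B C) (f : A →ₗ[k] B) (x : Pt k A) :
    ev N (preSeq Φ f) x = ev N Φ (lin f x) :=
  Finset.sum_congr rfl fun _ _ => ext_compLinearMap _ _ _

theorem ev_add (N : ℕ) (Φ Ψ : MSeq k A B) (x : Pt k A) :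
    ev N (Φ + Ψ) x = ev N Φ x + ev N Ψ x := by
  rw [ev, ev, ev, ← Finset.sum_add_distrib]
  refine Finset.sum_congr rfl fun n _ => ?_
  rw [Pi.add_apply, diag, ext_add]
  rfl

theorem hasDeg_postSeq {d : ℤ} {f : B →ₗ[k] C} {Φ : MSeq k A B} {n : ℕ} {e : ℤ}
    (hf : ∀ i, ∀ b ∈ ℬ.deg i, f b ∈ 𝒞.deg (i + d)) (hΦ : HasDeg 𝒜 ℬ e (Φ n)) :
    HasDeg 𝒜 𝒞 (e + d) (postSeq f Φ n) := fun p a ha => by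
  rw [← add_assoc]
  exact hf _ _ (hΦ p a ha)

theorem hasDeg_preSeq {f : A →ₗ[k] B} {Φ : MSeq k B C} {n : ℕ} {e : ℤ}
    (hf : ∀ i, ∀ a ∈ 𝒜.deg i, f a ∈ ℬ.deg i) (hΦ : HasDeg ℬ 𝒞 e (Φ n)) :
    HasDeg 𝒜 𝒞 e (preSeq Φ f n) := fun p _ ha => hΦ p _ fun i => hf _ _ (ha i)

theorem isSymm_postSeq (f : B →ₗ[k] C) {Φ : MSeq k A B} {n : ℕ} (hΦ : IsSymm 𝒜 (Φ n)) :
    IsSymm 𝒜 (postSeq f Φ n) := fun p a ha σ => by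
  change f _ = _ • f _
  rw [hΦ p a ha σ, Units.smul_def, Units.smul_def, map_zsmul]

theorem isSymm_preSeq {f : A →ₗ[k] B} {Φ : MSeq k B C} {n : ℕ}
    (hf : ∀ i, ∀ a ∈ 𝒜.deg i, f a ∈ ℬ.deg i) (hΦ : IsSymm ℬ (Φ n)) :
    IsSymm 𝒜 (preSeq Φ f n) := fun p _ ha σ => hΦ p _ (fun i => hf _ _ (ha i)) σ

section Criteria

variable [Algebra ℚ k]

/-- Orders N ≥ 1 suffice, because the constant terms of both sides vanish; the restriction is
convenient since a linear series truncated at order 0 would lose its only term. -/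
theorem IsMor.of_ev {Q : MSeq k A A} {Q' : MSeq k B B} {F : MSeq k A B} (hQ : IsLInf 𝒜 Q)
    (hQ' : Q' 0 = 0) (h0 : F 0 = 0) (hd : ∀ n, HasDeg 𝒜 ℬ 0 (F n)) (hs : ∀ n, IsSymm 𝒜 (F n))
    (H : ∀ N, 1 ≤ N → ∀ p : Grassmann.Params k N, ∀ y ∈ 𝒜.pts 0,
      ev N F (p.h • y + p.θ • ev N Q (p.h • y)) =
        ev N F (p.h • y) + p.θ • ev N Q' (ev N F (p.h • y))) : IsMor 𝒜 ℬ Q Q' F := by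
  refine ⟨h0, hd, hs, diag_eq_of_ev fun N p y hy => congrArg (p.θ' • ·) ?_⟩
  rcases Nat.eq_zero_or_pos N with rfl | hN
  · simp only [ev, zero_add, Finset.sum_range_one]
    rw [compSeq_zero hQ', insSeq_zero _ hQ.zero]
  · have := H N hN p y hy
    rwa [ev_add_odd p.h_mem p.θ_mem p.h_pow hs hQ.hasDeg hQ.zero hy, add_left_cancel_iff,
      ev_ev p.h_mem p.h_pow _ h0, eq_comm] at this

theorem IsLInf.of_ev {Q : MSeq k A A} (h0 : Q 0 = 0) (hd : ∀ n, HasDeg 𝒜 𝒜 1 (Q n))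
    (hs : ∀ n, IsSymm 𝒜 (Q n))
    (H : ∀ N, 1 ≤ N → ∀ p : Grassmann.Params k N, ∀ y ∈ 𝒜.pts 0,
      ev N Q (p.h • y + p.θ • ev N Q (p.h • y)) = ev N Q (p.h • y)) : IsLInf 𝒜 Q := by
  have h1 := diag_eq_of_ev (𝒜 := 𝒜) (Φ := insSeq Q Q) (Ψ := 0)
    fun N p y hy => congrArg (p.θ' • ·) ?_
  · refine ⟨h0, hd, hs, fun n y hy => ?_⟩
    rw [h1 n y hy, diag, Pi.zero_apply, ext_zero]
    rfl
  · have h2 : ev N (0 : MSeq k A A) (p.h • y) = 0 :=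
      Finset.sum_eq_zero fun n _ => by rw [Pi.zero_apply, diag, ext_zero]; rfl
    rw [h2, smul_zero]
    rcases Nat.eq_zero_or_pos N with rfl | hN
    · simp only [ev, zero_add, Finset.sum_range_one]
      rw [insSeq_zero _ h0, diag, ext_zero]
      exact smul_zero _
    · have := H N hN p y hy
      rwa [ev_add_odd p.h_mem p.θ_mem p.h_pow hs hd h0 hy, add_eq_left] at this

end Criteria

/-- The grading of the direct sum of `B` and the cone of `A`. -/
def coneGrading (𝒜 : Grading k A) (ℬ : Grading k B) : Grading k (B × A × A) where
  deg i := (ℬ.deg i).prod ((𝒜.deg i).prod (𝒜.deg (i + 1)))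
  even := ℬ.even.prodMap (𝒜.even.prodMap (LinearMap.id - 𝒜.even))
  even_of_even i hi a ha := by
    obtain ⟨h1, h2, h3⟩ := ha
    ext
    · exact ℬ.even_of_even i hi _ h1
    · exact 𝒜.even_of_even i hi _ h2
    · simp [𝒜.even_of_odd (i + 1) hi.add_one _ h3]
  even_of_odd i hi a ha := by
    obtain ⟨h1, h2, h3⟩ := ha
    ext
    · exact ℬ.even_of_odd i hi _ h1
    · exact 𝒜.even_of_odd i hi _ h2
    · simp [𝒜.even_of_even (i + 1) hi.add_one _ h3]

section Maps

variable (k A B)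

/-- The inclusion of `B`. -/
def coneInl : B →ₗ[k] B × A × A := LinearMap.inl k B (A × A)

/-- The inclusion of the first copy of `A`. -/
def coneMid : A →ₗ[k] B × A × A := LinearMap.inr k B (A × A) ∘ₗ LinearMap.inl k A A

/-- The inclusion of the second copy of `A`. -/
def coneInr : A →ₗ[k] B × A × A := LinearMap.inr k B (A × A) ∘ₗ LinearMap.inr k A A

/-- The differential of the cone. -/
def coneDiff : B × A × A →ₗ[k] B × A × A :=
  coneMid k A B ∘ₗ LinearMap.snd k A A ∘ₗ LinearMap.snd k B (A × A)

/-- The contraction of the cone. -/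
def coneHomotopy : B × A × A →ₗ[k] B × A × A :=
  coneInr k A B ∘ₗ LinearMap.fst k A A ∘ₗ LinearMap.snd k B (A × A)

end Maps

theorem lin_lin {f : B →ₗ[k] C} {g : A →ₗ[k] B} {h : A →ₗ[k] C} (H : ∀ a, f (g a) = h a)
    (x : Pt k A) : lin f (lin g x) = lin h x := by
  rw [← lin_comp]
  exact lin_eq H x

theorem lin_id (x : Pt k A) : lin LinearMap.id x = x := by
  rw [lin, LinearMap.baseChange_id]
  rfl

theorem lin_zero (x : Pt k A) : lin (0 : A →ₗ[k] B) x = 0 := by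
  rw [lin, LinearMap.baseChange_zero]
  rfl

theorem lin_fst_coneInl (z : Pt k B) :
    lin (LinearMap.fst k B (A × A)) (lin (coneInl k A B) z) = z :=
  (lin_lin (fun _ => rfl) z).trans (lin_id z)

theorem lin_fst_coneInr (z : Pt k A) :
    lin (LinearMap.fst k B (A × A)) (lin (coneInr k A B) z) = 0 :=
  (lin_lin (fun _ => rfl) z).trans (lin_zero z)

theorem lin_fst_coneMid (z : Pt k A) :
    lin (LinearMap.fst k B (A × A)) (lin (coneMid k A B) z) = 0 :=
  (lin_lin (fun _ => rfl) z).trans (lin_zero z)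

theorem lin_fst_coneDiff (z : Pt k (B × A × A)) :
    lin (LinearMap.fst k B (A × A)) (lin (coneDiff k A B) z) = 0 :=
  (lin_lin (fun _ => rfl) z).trans (lin_zero z)

theorem lin_coneDiff_coneInl (z : Pt k B) : lin (coneDiff k A B) (lin (coneInl k A B) z) = 0 :=
  (lin_lin (fun a => by simp [coneDiff, coneInl]) z).trans (lin_zero z)

theorem lin_coneDiff_coneMid (z : Pt k A) : lin (coneDiff k A B) (lin (coneMid k A B) z) = 0 :=
  (lin_lin (fun a => by simp [coneDiff, coneMid]) z).trans (lin_zero z)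

theorem lin_coneDiff_coneInr (z : Pt k A) :
    lin (coneDiff k A B) (lin (coneInr k A B) z) = lin (coneMid k A B) z :=
  lin_lin (fun _ => rfl) z

theorem lin_coneDiff_coneDiff (z : Pt k (B × A × A)) :
    lin (coneDiff k A B) (lin (coneDiff k A B) z) = 0 :=
  (lin_lin (fun a => by simp [coneDiff, coneMid]) z).trans (lin_zero z)

/-- The direct sum of the `L_∞`-algebra `B` and the cone of `A`. -/
def coneSeq (A : Type*) [AddCommGroup A] [Module k A] (Q' : MSeq k B B) :
    MSeq k (B × A × A) (B × A × A) :=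
  postSeq (coneInl k A B) (preSeq Q' (LinearMap.fst k B (A × A))) + linSeq (coneDiff k A B)

/-- The morphism given by `F` and by the canonical map to the cone. -/
def toCone (Q : MSeq k A A) (F : MSeq k A B) : MSeq k A (B × A × A) :=
  postSeq (coneInl k A B) F + postSeq (coneInr k A B) Q + linSeq (coneMid k A B)

theorem ev_coneSeq {N : ℕ} (hN : 1 ≤ N) (Q' : MSeq k B B) (x : Pt k (B × A × A)) :
    ev N (coneSeq A Q') x = lin (coneInl k A B) (ev N Q' (lin (LinearMap.fst k B (A × A)) x)) +
      lin (coneDiff k A B) x := by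
  rw [coneSeq, ev_add, ev_postSeq, ev_preSeq, ev_linSeq hN]

theorem ev_toCone {N : ℕ} (hN : 1 ≤ N) (Q : MSeq k A A) (F : MSeq k A B) (x : Pt k A) :
    ev N (toCone Q F) x = lin (coneInl k A B) (ev N F x) + lin (coneInr k A B) (ev N Q x) +
      lin (coneMid k A B) x := by
  rw [toCone, ev_add, ev_add, ev_postSeq, ev_postSeq, ev_linSeq hN]

theorem fst_mem (i : ℤ) (a : B × A × A) (ha : a ∈ (coneGrading 𝒜 ℬ).deg i) :
    LinearMap.fst k B (A × A) a ∈ ℬ.deg i := ha.1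

theorem coneInl_mem (i : ℤ) (b : B) (hb : b ∈ ℬ.deg i) :
    coneInl k A B b ∈ (coneGrading 𝒜 ℬ).deg i := ⟨hb, zero_mem _, zero_mem _⟩

theorem coneDiff_mem (i : ℤ) (a : B × A × A) (ha : a ∈ (coneGrading 𝒜 ℬ).deg i) :
    coneDiff k A B a ∈ (coneGrading 𝒜 ℬ).deg (i + 1) := ⟨zero_mem _, ha.2.2, zero_mem _⟩

theorem hasDeg_add_zero {n : ℕ} {d : ℤ} {φ : MultilinearMap k (fun _ : Fin n => A) B}
    (h : HasDeg 𝒜 ℬ (d + 0) φ) : HasDeg 𝒜 ℬ d φ := by rwa [add_zero] at h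

variable [Algebra ℚ k]

/-- The field on B is constant along its own flow, and the linear field (a, b) ↦ (b, 0) on the cone
has square zero; the two do not interact. -/
theorem isLInf_coneSeq (𝒜 : Grading k A) {Q' : MSeq k B B} (hQ' : IsLInf ℬ Q') :
    IsLInf (coneGrading 𝒜 ℬ) (coneSeq A Q') := by
  refine IsLInf.of_ev ?_ (fun n => ?_) (fun n => ?_) fun N hN p y hy => ?_
  · refine MultilinearMap.ext fun a => ?_
    change coneInl k A B (Q' 0 _) + 0 = 0
    rw [hQ'.zero, add_zero]
    exact map_zero _
  · refine hasDeg_add (hasDeg_add_zero (hasDeg_postSeq (d := 0) (fun i b hb => ?_)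
      (hasDeg_preSeq fst_mem (hQ'.hasDeg n)))) (hasDeg_linSeq coneDiff_mem n)
    rw [add_zero]
    exact coneInl_mem i b hb
  · exact isSymm_add (isSymm_postSeq _ (isSymm_preSeq fst_mem (hQ'.isSymm n)))
      (isSymm_linSeq _ _ n)
  · have hp : lin (LinearMap.fst k B (A × A)) y ∈ ℬ.pts 0 := by
      simpa using lin_mem_pts (d := 0) (fun i a ha => by rw [add_zero]; exact fst_mem i a ha) hy
    have h1 := hQ'.ev_sq p.h_mem p.θ_mem p.h_pow hp
    have e1 : lin (LinearMap.fst k B (A × A)) (p.h • y) = p.h • lin (LinearMap.fst k B (A × A)) y :=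
      map_smul _ _ _
    have e2 : lin (coneDiff k A B) (p.h • y) = p.h • lin (coneDiff k A B) y := map_smul _ _ _
    rw [ev_coneSeq hN, ev_coneSeq hN]
    simp only [map_add, map_smul (lin (LinearMap.fst k B (A × A))) p.θ,
      map_smul (lin (coneDiff k A B)) p.θ, lin_fst_coneInl, lin_fst_coneDiff,
      lin_coneDiff_coneInl, lin_coneDiff_coneDiff, add_zero, smul_zero, e1, h1]

/-- The map is x ↦ (F(x), x, Q(x)). Along the flow the middle entry changes by θ times the last one,
and the last entry is constant because Q² = 0, so this intertwines the flow with the differential of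
the cone. The full nonlinear Q is needed in the last entry. -/
theorem isMor_toCone {Q : MSeq k A A} {Q' : MSeq k B B} {F : MSeq k A B} (hQ : IsLInf 𝒜 Q)
    (hQ' : IsLInf ℬ Q') (hF : IsMor 𝒜 ℬ Q Q' F) :
    IsMor 𝒜 (coneGrading 𝒜 ℬ) Q (coneSeq A Q') (toCone Q F) := by
  refine IsMor.of_ev hQ (isLInf_coneSeq 𝒜 hQ').zero ?_ (fun n => ?_) (fun n => ?_)
    fun N hN p y hy => ?_
  · refine MultilinearMap.ext fun a => ?_
    change coneInl k A B (F 0 a) + coneInr k A B (Q 0 a) + 0 = 0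
    rw [hQ.zero, hF.zero, add_zero]
    exact (congrArg₂ (· + ·) (map_zero _) (map_zero _)).trans (add_zero _)
  · refine hasDeg_add (hasDeg_add (hasDeg_add_zero (hasDeg_postSeq (d := 0) (fun i b hb => ?_)
      (hF.hasDeg n))) ?_) (hasDeg_linSeq (fun i a ha => ?_) n)
    · rw [add_zero]
      exact coneInl_mem i b hb
    · have := hasDeg_postSeq (𝒜 := 𝒜) (ℬ := 𝒜) (𝒞 := coneGrading 𝒜 ℬ) (d := -1) (e := 1)
        (f := coneInr k A B) (Φ := Q) (n := n)
        (fun i a ha => ⟨zero_mem _, zero_mem _, by rwa [neg_add_cancel_right]⟩) (hQ.hasDeg n)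
      exact this
    · rw [add_zero]
      exact ⟨zero_mem _, ha, zero_mem _⟩
  · exact isSymm_add (isSymm_add (isSymm_postSeq _ (hF.isSymm n)) (isSymm_postSeq _ (hQ.isSymm n)))
      (isSymm_linSeq _ _ n)
  · rw [ev_toCone hN, ev_toCone hN, ev_coneSeq hN, hQ.ev_sq p.h_mem p.θ_mem p.h_pow hy,
      ev_comm p.h_mem p.θ_mem p.h_pow hQ hF.zero hF.isSymm (fun n _ => hF.comm n) hy]
    simp only [map_add, map_smul (lin (coneInl k A B)), map_smul (lin (coneMid k A B)) p.θ,
      lin_fst_coneInl, lin_fst_coneInr, lin_fst_coneMid, lin_coneDiff_coneInl,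
      lin_coneDiff_coneMid, lin_coneDiff_coneInr, add_zero, zero_add, smul_add]
    abel

theorem isMor_coneInl (𝒜 : Grading k A) {Q' : MSeq k B B} (hQ' : IsLInf ℬ Q') :
    IsMor ℬ (coneGrading 𝒜 ℬ) Q' (coneSeq A Q') (linSeq (coneInl k A B)) := by
  refine IsMor.of_ev hQ' (isLInf_coneSeq 𝒜 hQ').zero rfl
    (hasDeg_linSeq fun i b hb => by rw [add_zero]; exact coneInl_mem i b hb) (isSymm_linSeq _ _)
    fun N hN p y hy => ?_
  rw [ev_linSeq hN, ev_linSeq hN, ev_coneSeq hN, lin_fst_coneInl, lin_coneDiff_coneInl, add_zero,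
    map_add, map_smul (lin (coneInl k A B)) p.θ]

/-- A morphism whose linear part has a homotopy inverse has a homotopy inverse. -/
theorem exists_inverse {Q : MSeq k A A} {Q' : MSeq k B B} {F : MSeq k A B} (hQ : IsLInf 𝒜 Q)
    (hQ' : IsLInf ℬ Q') (hF : IsMor 𝒜 ℬ Q Q' F) {g : B →ₗ[k] A} {κ : A →ₗ[k] A} {κ' : B →ₗ[k] B}
    (hg : ∀ i, ∀ b ∈ ℬ.deg i, g b ∈ 𝒜.deg i) (hκ : ∀ i, ∀ a ∈ 𝒜.deg i, κ a ∈ 𝒜.deg (i - 1))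
    (hκ' : ∀ i, ∀ b ∈ ℬ.deg i, κ' b ∈ ℬ.deg (i - 1))
    (hdd : ∀ a, unary (Q 1) (unary (Q 1) a) = 0)
    (hgd : ∀ b, g (unary (Q' 1) b) = unary (Q 1) (g b))
    (hFd : ∀ a, unary (F 1) (unary (Q 1) a) = unary (Q' 1) (unary (F 1) a))
    (h1 : ∀ a, unary (Q 1) (κ a) + κ (unary (Q 1) a) = a - g (unary (F 1) a))
    (h2 : ∀ b, unary (Q' 1) (κ' b) + κ' (unary (Q' 1) b) = b - unary (F 1) (g b)) :
    ∃ G, IsMor ℬ 𝒜 Q' Q G ∧ unary (G 1) = g := by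
  set d := unary (Q 1) with hd
  set d' := unary (Q' 1) with hd'
  set f := unary (F 1) with hf
  set p := LinearMap.fst k B (A × A)
  set D := unary (coneSeq A Q' 1) with hD
  have hDa : ∀ x : B × A × A, D x = (d' x.1, x.2.2, 0) := fun x => by
    change coneInl k A B (d' x.1) + coneDiff k A B x = _
    ext <;> simp [coneInl, coneDiff, coneMid]
  set φ := unary (toCone Q F 1) with hφ
  have hφa : ∀ a, φ a = (f a, a, d a) := fun a => by
    change coneInl k A B (f a) + coneInr k A B (d a) + coneMid k A B a = _
    ext <;> simp [coneInl, coneInr, coneMid]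
  -- From 1 = gf + dκ + κd: on φ(a) = (f(a), a, d(a)) the three summands g, dκ and κ add up to a.
  set r : B × A × A →ₗ[k] A := LinearMap.coprod g (LinearMap.coprod (d ∘ₗ κ) κ) with hr
  have hra : ∀ x : B × A × A, r x = g x.1 + (d (κ x.2.1) + κ x.2.2) := fun x => rfl
  -- Write h for `coneHomotopy`; it contracts the cone, so Dh + hD is the projection to the cone.
  -- Split 1 - φr by this projection. On the cone part the homotopy is (1 - φr)h. On B it remains to
  -- bound 1 - φg, whose B component 1 - fg is bounded by κ' and whose cone component by -hφg.
  set H₀ : B × A × A →ₗ[k] B × A × A := (LinearMap.id - φ ∘ₗ r) ∘ₗ coneHomotopy k A B +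
    coneInl k A B ∘ₗ κ' ∘ₗ p - coneHomotopy k A B ∘ₗ φ ∘ₗ g ∘ₗ p with hH₀
  have hH₀a : ∀ x : B × A × A, H₀ x = (κ' x.1 - f (κ x.2.1), - κ x.2.1,
      x.2.1 - d (κ x.2.1) - g x.1) := fun x => by
    simp only [hH₀, coneHomotopy, LinearMap.add_apply, LinearMap.sub_apply, LinearMap.comp_apply,
      hφa, hra]
    ext <;> (simp [coneInl, coneInr, p]; try abel)
  have hrφ : ∀ a, r (φ a) = a := fun a => by
    rw [hφa, hra]
    simp only
    rw [h1]
    abel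
  have hhom : ∀ x, D (H₀ x) + H₀ (D x) = x - φ (r x) := fun x => by
    have e2 := eq_sub_of_add_eq (h2 x.1)
    simp only [hDa, hH₀a, hφa, hra, map_add, map_sub, hgd, hFd, hdd]
    refine Prod.ext ?_ (Prod.ext ?_ ?_)
    · change d' (κ' x.1) - d' (f (κ x.2.1)) + (κ' (d' x.1) - f (κ x.2.2)) =
        x.1 - (f (g x.1) + (d' (f (κ x.2.1)) + f (κ x.2.2)))
      rw [e2]
      abel
    · change x.2.1 - d (κ x.2.1) - g x.1 + -κ x.2.2 =
        x.2.1 - (g x.1 + (d (κ x.2.1) + κ x.2.2))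
      abel
    · change 0 + (x.2.2 - d (κ x.2.2) - d (g x.1)) =
        x.2.2 - (d (g x.1) + (0 + d (κ x.2.2)))
      abel
  -- Precomposing H₀ with 1 - φr forces Hφ = 0, since rφ = 1. It is still a homotopy for the same
  -- map because 1 - φr is an idempotent chain map.
  have hC : IsContraction (coneGrading 𝒜 ℬ) 𝒜 D d φ r (H₀ ∘ₗ (LinearMap.id - φ ∘ₗ r)) := by
    have hφD : ∀ a, φ (d a) = D (φ a) := fun a => by rw [hφa, hφa, hDa, hdd, hFd]
    have hrD : ∀ x, r (D x) = d (r x) := fun x => by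
      simp only [hra, hDa, map_add, map_zero, add_zero, hgd, hdd, zero_add]
    have hrm : ∀ i, ∀ x ∈ (coneGrading 𝒜 ℬ).deg i, r x ∈ 𝒜.deg i := fun i x hx => by
      obtain ⟨hx1, hx2, hx3⟩ := hx
      rw [hra]
      refine add_mem (hg _ _ hx1) (add_mem ?_ ?_)
      · have := unary_mem (hQ.hasDeg 1) _ _ (hκ _ _ hx2)
        rwa [sub_add_cancel] at this
      · have := hκ _ _ hx3
        rwa [add_sub_cancel_right] at this
    have hφm : ∀ i, ∀ a ∈ 𝒜.deg i, φ a ∈ (coneGrading 𝒜 ℬ).deg i := fun i a ha => by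
      have := unary_mem ((isMor_toCone hQ hQ' hF).hasDeg 1) i a ha
      rwa [add_zero] at this
    refine ⟨hrm, fun i x hx => ?_, hrφ, hrD, hφD, fun x => ?_, fun a => ?_⟩
    · have hy : x - φ (r x) ∈ (coneGrading 𝒜 ℬ).deg i := sub_mem hx (hφm _ _ (hrm _ _ hx))
      change H₀ (x - φ (r x)) ∈ _
      generalize x - φ (r x) = y at hy
      obtain ⟨hy1, hy2, hy3⟩ := hy
      rw [hH₀a]
      have hfm := unary_mem (hF.hasDeg 1)
      have hdm := unary_mem (hQ.hasDeg 1)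
      simp only [add_zero] at hfm
      refine ⟨sub_mem (hκ' _ _ hy1) (hfm _ _ (hκ _ _ hy2)), neg_mem (hκ _ _ hy2), ?_⟩
      have h3 := hdm _ _ (hκ _ _ hy2)
      rw [sub_add_cancel] at h3
      change _ ∈ 𝒜.deg (i + -1 + 1)
      rw [neg_add_cancel_right]
      exact sub_mem (sub_mem hy2 h3) (hg _ _ hy1)
    · change D (H₀ (x - φ (r x))) + H₀ (D x - φ (r (D x))) = _
      rw [hrD, hφD, ← map_sub, hhom, map_sub r, hrφ, sub_self, map_zero, sub_zero]
    · change H₀ (φ a - φ (r (φ a))) = 0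
      rw [hrφ, sub_self, map_zero]
  obtain ⟨G, hG, hG1⟩ := exists_retraction (isLInf_coneSeq 𝒜 hQ') hQ (isMor_toCone hQ hQ' hF) hC
  refine ⟨_, IsMor.comp hQ' (isLInf_coneSeq 𝒜 hQ') hG (isMor_coneInl 𝒜 hQ'), ?_⟩
  rw [unary_comp, hG1, unary_linSeq]
  refine LinearMap.ext fun b => ?_
  rw [LinearMap.comp_apply, hra]
  simp [coneInl]

end Cone

end LInfty

/-! ### Shuffle sums, factorials and Taylor coefficients. -/

namespace LInfty

open scoped TensorProduct

section Shuffles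

/-- The permutation of `n` elements given by permutations of the first `i` and of the last `n - i`
of them. -/
def blockPerm {n : ℕ} (i : Fin (n + 1))
    (τ : Equiv.Perm (Fin (i : ℕ)) × Equiv.Perm (Fin (n - (i : ℕ)))) : Equiv.Perm (Fin n) :=
  (finSumFinEquiv.trans (finCongr (Nat.add_sub_of_le i.is_le))).permCongr
    (Equiv.sumCongr τ.1 τ.2)

/-- An index in the first block. -/
abbrev fstIdx {n : ℕ} (i : Fin (n + 1)) (j : Fin (i : ℕ)) : Fin n := Fin.castLE i.is_le j

/-- An index in the second block. -/
abbrev sndIdx {n : ℕ} (i : Fin (n + 1)) (j : Fin (n - (i : ℕ))) : Fin n :=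
  ⟨(i : ℕ) + (j : ℕ), by omega⟩

theorem blockPerm_fst {n : ℕ} (i : Fin (n + 1))
    (τ : Equiv.Perm (Fin (i : ℕ)) × Equiv.Perm (Fin (n - (i : ℕ)))) (j : Fin (i : ℕ)) :
    blockPerm i τ (fstIdx i j) = fstIdx i (τ.1 j) := by
  have : fstIdx i j = (finSumFinEquiv.trans (finCongr (Nat.add_sub_of_le i.is_le))) (Sum.inl j) :=
    rfl
  rw [this, blockPerm, Equiv.permCongr_apply, Equiv.symm_apply_apply]
  rfl

theorem blockPerm_snd {n : ℕ} (i : Fin (n + 1))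
    (τ : Equiv.Perm (Fin (i : ℕ)) × Equiv.Perm (Fin (n - (i : ℕ)))) (j : Fin (n - (i : ℕ))) :
    blockPerm i τ (sndIdx i j) = sndIdx i (τ.2 j) := by
  have : sndIdx i j = (finSumFinEquiv.trans (finCongr (Nat.add_sub_of_le i.is_le))) (Sum.inr j) :=
    rfl
  rw [this, blockPerm, Equiv.permCongr_apply, Equiv.symm_apply_apply]
  rfl

theorem prod_eq_prod_blocks {M : Type*} [CommMonoid M] {n : ℕ} (i : Fin (n + 1)) (f : Fin n → M) :
    ∏ j, f j = (∏ j, f (fstIdx i j)) * ∏ j, f (sndIdx i j) := by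
  rw [← (finSumFinEquiv.trans (finCongr (Nat.add_sub_of_le i.is_le))).prod_comp,
    Fintype.prod_sum_type]
  rfl

theorem exists_idx {n : ℕ} (i : Fin (n + 1)) (a : Fin n) :
    (∃ j, a = fstIdx i j) ∨ ∃ j, a = sndIdx i j := by
  rcases lt_or_ge (a : ℕ) i with h | h
  · exact Or.inl ⟨⟨a, h⟩, rfl⟩
  · exact Or.inr ⟨⟨a - i, by omega⟩, Fin.ext (by simp; omega)⟩

/-- A block permutation creates no inversions between the two blocks. -/
theorem koszulSign_blockPerm {n : ℕ} (p : Fin n → ℤ) (i : Fin (n + 1))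
    (τ : Equiv.Perm (Fin (i : ℕ)) × Equiv.Perm (Fin (n - (i : ℕ)))) :
    koszulSign p (blockPerm i τ) =
      koszulSign (fun j => p (fstIdx i j)) τ.1 * koszulSign (fun j => p (sndIdx i j)) τ.2 := by
  rw [koszulSign, prod_eq_prod_blocks i]
  congr 1
  · refine Finset.prod_congr rfl fun a _ => ?_
    rw [prod_eq_prod_blocks i]
    refine (congrArg (_ * ·) (Finset.prod_eq_one fun b _ => ?_)).trans
      ((mul_one _).trans (Finset.prod_congr rfl fun b _ => ?_))
    · rw [blockPerm_fst, blockPerm_snd]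
      refine if_neg fun h => ?_
      have := h.2
      simp only [Fin.lt_def, Fin.val_castLE] at this
      omega
    · rw [blockPerm_fst, blockPerm_fst]
      rfl
  · refine Finset.prod_congr rfl fun a _ => ?_
    rw [prod_eq_prod_blocks i, Finset.prod_eq_one (f := fun j => ite _ _ _), one_mul]
    · refine Finset.prod_congr rfl fun b _ => ?_
      rw [blockPerm_snd, blockPerm_snd]
      simp only [Fin.lt_def, add_lt_add_iff_left]
    · intro b _
      refine if_neg fun h => ?_
      have := h.1
      simp only [Fin.lt_def, Fin.val_castLE] at this
      omega

theorem koszulSign_cons {n : ℕ} (p : Fin (n + 1) → ℤ) (τ : Equiv.Perm (Fin n)) :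
    koszulSign p (Equiv.Perm.decomposeFin.symm (0, τ)) = koszulSign (fun j => p j.succ) τ := by
  have h0 : Equiv.Perm.decomposeFin.symm (0, τ) 0 = 0 := by simp
  have hs : ∀ j : Fin n, Equiv.Perm.decomposeFin.symm (0, τ) j.succ = (τ j).succ := fun j => by
    simp
  rw [koszulSign, Fin.prod_univ_succ, Finset.prod_eq_one, one_mul]
  · refine Finset.prod_congr rfl fun a _ => ?_
    rw [Fin.prod_univ_succ, if_neg (by simp), one_mul]
    simp only [hs, Fin.succ_lt_succ_iff]
  · intro b _
    rw [h0]
    refine if_neg fun h => ?_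
    induction b using Fin.cases with
    | zero => simp at h
    | succ b => rw [hs] at h; simp at h

theorem isShuffle_iff {n : ℕ} (i : Fin (n + 1)) (σ : Equiv.Perm (Fin n)) :
    IsShuffle i σ ↔ StrictMono (fun j => σ (fstIdx i j)) ∧ StrictMono fun j => σ (sndIdx i j) := by
  constructor
  · intro h
    exact ⟨fun a b hab => h.1 _ _ hab b.2, fun a b hab => h.2 _ _ (by simpa using hab) (by simp)⟩
  · rintro ⟨h1, h2⟩
    refine ⟨fun a b hab hb => ?_, fun a b hab ha => ?_⟩
    · have hb' : (b : ℕ) < i := hb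
      exact h1 (a := ⟨a, (Fin.lt_def.mp hab).trans hb'⟩) (b := ⟨b, hb'⟩) hab
    · obtain ⟨a', rfl⟩ : ∃ a', a = sndIdx i a' :=
        ⟨⟨a - i, by omega⟩, Fin.ext (by simp; omega)⟩
      obtain ⟨b', rfl⟩ : ∃ b', b = sndIdx i b' :=
        ⟨⟨b - i, by omega⟩, Fin.ext (by have := Fin.lt_def.mp hab; simp at *; omega)⟩
      exact h2 (by simpa using hab)

/-- The two increasing maps have the same range, hence coincide; injectivity then gives the
permutations. This is the uniqueness of the shuffle in its coset. -/
theorem perm_eq_of_strictMono {m n : ℕ} {f : Fin m → Fin n} {τ τ' : Equiv.Perm (Fin m)}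
    {g : Fin m → Fin n} (hf : StrictMono f) (hg : StrictMono g) (h : f ∘ τ = g ∘ τ') :
    τ = τ' := by
  have h1 : f = g := by
    refine (StrictMono.range_inj hf hg).mp ?_
    rw [← τ.surjective.range_comp f, h, τ'.surjective.range_comp g]
  subst h1
  exact Equiv.ext fun j => hf.injective (congrFun h j)

/-- A sum over all permutations which is invariant under permutations of the blocks, as a sum over
shuffles. -/
theorem sum_perm_eq_sum_shuffles {M : Type*} [AddCommMonoid M] {n : ℕ} (i : Fin (n + 1))
    (f : Equiv.Perm (Fin n) → M) (hf : ∀ σ τ, f (σ * blockPerm i τ) = f σ) :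
    ∑ σ, f σ = ((i : ℕ).factorial * (n - i).factorial) • ∑ σ ∈ shuffles i n, f σ := by
  have h1 : ∑ x ∈ shuffles i n ×ˢ (Finset.univ : Finset
      (Equiv.Perm (Fin (i : ℕ)) × Equiv.Perm (Fin (n - (i : ℕ))))), f (x.1 * blockPerm i x.2) =
      ∑ σ, f σ := by
    refine Finset.sum_bij (fun x _ => x.1 * blockPerm i x.2) (fun _ _ => Finset.mem_univ _)
      ?_ ?_ fun _ _ => rfl
    · rintro ⟨s, τ⟩ hs ⟨s', τ'⟩ hs' h
      simp only [shuffles, Finset.mem_product, Finset.mem_filter, Finset.mem_univ, true_and,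
        and_true, isShuffle_iff] at hs hs' h
      have e1 : τ = τ' := by
        refine Prod.ext (perm_eq_of_strictMono hs.1 hs'.1 (funext fun j => ?_))
          (perm_eq_of_strictMono hs.2 hs'.2 (funext fun j => ?_))
        · have := congrArg (fun e => e (fstIdx i j)) h
          simpa only [Equiv.Perm.mul_apply, blockPerm_fst, Function.comp_apply] using this
        · have := congrArg (fun e => e (sndIdx i j)) h
          simpa only [Equiv.Perm.mul_apply, blockPerm_snd, Function.comp_apply] using this
      subst e1
      rw [mul_left_inj] at h
      rw [h]
    · intro σ _
      -- Sorting the values of σ on each block gives the shuffle representing its coset.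
      set τ : Equiv.Perm (Fin (i : ℕ)) × Equiv.Perm (Fin (n - (i : ℕ))) :=
        (Tuple.sort fun j => σ (fstIdx i j), Tuple.sort fun j => σ (sndIdx i j)) with hτ
      refine ⟨(σ * blockPerm i τ, τ⁻¹), ?_, ?_⟩
      · simp only [shuffles, Finset.mem_product, Finset.mem_filter, Finset.mem_univ, true_and,
          and_true, isShuffle_iff, Equiv.Perm.mul_apply, blockPerm_fst, blockPerm_snd]
        refine ⟨(Tuple.monotone_sort fun j => σ (fstIdx i j)).strictMono_of_injective ?_,
          (Tuple.monotone_sort fun j => σ (sndIdx i j)).strictMono_of_injective ?_⟩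
        · refine Function.Injective.comp (g := fun j => σ (fstIdx i j)) (fun a b h => ?_)
            (Equiv.injective _)
          have := σ.injective h
          simpa [Fin.ext_iff] using this
        · refine Function.Injective.comp (g := fun j => σ (sndIdx i j)) (fun a b h => ?_)
            (Equiv.injective _)
          have := σ.injective h
          simpa [Fin.ext_iff] using this
      · change σ * blockPerm i τ * blockPerm i τ⁻¹ = σ
        refine Equiv.ext fun a => ?_
        rcases exists_idx i a with ⟨j, rfl⟩ | ⟨j, rfl⟩
        · simp [blockPerm_fst]
        · simp [blockPerm_snd]
  rw [← h1, Finset.sum_product]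
  simp only [hf, Finset.sum_const, Finset.card_univ, Fintype.card_prod, Fintype.card_perm,
    Fintype.card_fin, ← Finset.smul_sum]

end Shuffles

section Normalization

variable {k : Type u} [CommRing k] {A B : Type*} [AddCommGroup A] [Module k A]
  [AddCommGroup B] [Module k B]
  {𝒜 : Grading k A} {ℬ : Grading k B}

/-- The symmetry of δ handles the first block. For the second block, the symmetry of φ is used with
a permutation fixing the inserted element in front, so its degree contributes no sign. -/
theorem insertFirst_blockPerm {n : ℕ} (i : Fin (n + 1))
    {φ : MultilinearMap k (fun _ : Fin (n - i + 1) => A) B}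
    {δ : MultilinearMap k (fun _ : Fin (i : ℕ) => A) A} {e : ℤ} (hφ : IsSymm 𝒜 φ)
    (hδ : IsSymm 𝒜 δ) (hd : HasDeg 𝒜 𝒜 e δ) {p : Fin n → ℤ} {a : Fin n → A}
    (ha : ∀ j, a j ∈ 𝒜.deg (p j))
    (τ : Equiv.Perm (Fin (i : ℕ)) × Equiv.Perm (Fin (n - (i : ℕ)))) :
    insertFirst i φ δ (fun j => a (blockPerm i τ j)) =
      koszulSign p (blockPerm i τ) • insertFirst i φ δ a := by
  rw [insertFirst_apply, insertFirst_apply, koszulSign_blockPerm]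
  have h1 := hδ (fun j => p (fstIdx i j)) (fun j => a (fstIdx i j)) (fun j => ha _) τ.1
  have h2 := hφ (Fin.cons (∑ j, p (fstIdx i j) + e) fun j => p (sndIdx i j))
    (Fin.cons (δ fun j => a (fstIdx i j)) fun j => a (sndIdx i j)) (fun j => by
      induction j using Fin.cases with
      | zero => exact hd _ _ fun j => ha _
      | succ j => exact ha _) (Equiv.Perm.decomposeFin.symm (0, τ.2))
  rw [koszulSign_cons] at h2
  simp only [Fin.cons_succ] at h2
  rw [mul_smul, ← h2]
  have e1 : (fun j => a (blockPerm i τ (Fin.castLE i.is_le j))) =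
      fun j => a (fstIdx i (τ.1 j)) := funext fun j => congrArg a (blockPerm_fst i τ j)
  have e2 : (fun j : Fin (n - (i : ℕ)) => a (blockPerm i τ ⟨(i : ℕ) + (j : ℕ), by omega⟩)) =
      fun j => a (sndIdx i (τ.2 j)) := funext fun j => congrArg a (blockPerm_snd i τ j)
  have e3 : (fun j => (Fin.cons (δ fun j => a (fstIdx i j)) fun j => a (sndIdx i j) :
      Fin (n - (i : ℕ) + 1) → A) (Equiv.Perm.decomposeFin.symm (0, τ.2) j)) =
      Fin.cons (δ fun j => a (fstIdx i j)) fun j => a (sndIdx i (τ.2 j)) := by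
    funext j
    induction j using Fin.cases with
    | zero => simp
    | succ j => simp
  rw [e1, e2, e3, h1, Units.smul_def, Units.smul_def, ← MultilinearMap.curryLeft_apply,
    map_zsmul, _root_.smul_apply]
  rfl

variable [Algebra ℚ k]

/-- The Taylor coefficients of a sequence of symmetric maps. -/
def taylor (Φ : MSeq k A B) : MSeq k A B := fun n =>
  algebraMap ℚ k ((n.factorial : ℚ)⁻¹) • Φ n

theorem taylor_factorial (Φ : MSeq k A B) (n : ℕ) :
    taylor (fun m => m.factorial • Φ m) n = Φ n :=
  smul_factorial_inv n (Φ n)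

theorem compositionSum_eq (Q' : MSeq k B B) (F : MSeq k A B) {n : ℕ} (q : Fin n → ℤ)
    (w : Fin n → A) : compositionSum Q' F q w = ∑ σ : Equiv.Perm (Fin n),
      koszulSign q σ • compSeq (taylor Q') (taylor F) n fun i => w (σ i) := by
  have h : ∀ σ : Equiv.Perm (Fin n),
      koszulSign q σ • compSeq (taylor Q') (taylor F) n (fun i => w (σ i)) =
        ∑ c : Composition n,
          algebraMap ℚ k (((c.length.factorial * ∏ r, (c.blocksFun r).factorial : ℕ) : ℚ)⁻¹) •
            koszulSign q σ •
              Q' c.length fun r => F (c.blocksFun r) fun j => w (σ (c.embedding r j)) := by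
    intro σ
    rw [compSeq, _root_.sum_apply, Finset.smul_sum]
    refine Finset.sum_congr rfl fun c _ => ?_
    rw [smul_comm]
    congr 1
    rw [compAlong_apply]
    simp only [taylor, _root_.smul_apply]
    rw [MultilinearMap.map_smul_univ, smul_smul, ← map_prod, ← map_mul]
    congr 2
    push_cast
    rw [mul_inv, Finset.prod_inv_distrib]
  rw [Finset.sum_congr rfl fun σ _ => h σ, Finset.sum_comm]
  exact Finset.sum_congr rfl fun c _ => Finset.smul_sum

/-- Summing over all permutations counts each shuffle i!(n - i)! times, up to signs that cancel by
the symmetry of the maps. The Taylor normalization and the factor n - i + 1 of `insSeq` compensate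
this multiplicity. -/
theorem insertionSum_eq {G : MSeq k A B} {Q : MSeq k A A} {e : ℤ} (hG : ∀ n, IsSymm 𝒜 (G n))
    (hQ : ∀ n, IsSymm 𝒜 (Q n)) (hQd : ∀ n, HasDeg 𝒜 𝒜 e (Q n)) {n : ℕ} {q : Fin n → ℤ}
    {w : Fin n → A} (hw : ∀ i, w i ∈ 𝒜.deg (q i)) :
    insertionSum G Q q w = ∑ σ : Equiv.Perm (Fin n),
      koszulSign q σ • insSeq (taylor G) (taylor Q) n fun i => w (σ i) := by
  have h : ∀ σ : Equiv.Perm (Fin n),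
      koszulSign q σ • insSeq (taylor G) (taylor Q) n (fun i => w (σ i)) =
        ∑ i : Fin (n + 1),
          algebraMap ℚ k ((((i : ℕ).factorial * (n - i).factorial : ℕ) : ℚ)⁻¹) •
            koszulSign q σ • insertFirst i (G (n - i + 1)) (Q i) (fun i => w (σ i)) := by
    intro σ
    rw [insSeq, _root_.sum_apply, Finset.smul_sum]
    refine Finset.sum_congr rfl fun i _ => ?_
    rw [smul_comm (algebraMap ℚ k _)]
    congr 1
    rw [_root_.smul_apply, insertFirst_apply, insertFirst_apply]
    simp only [taylor, _root_.smul_apply]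
    rw [← MultilinearMap.curryLeft_apply, map_smul, _root_.smul_apply,
      MultilinearMap.curryLeft_apply, smul_smul, ← map_mul, ← Nat.cast_smul_eq_nsmul k, smul_smul,
      ← map_natCast (algebraMap ℚ k), ← map_mul]
    congr 2
    -- With m = n - i: (m + 1) / ((m + 1)! i!) = 1 / (i! m!).
    rw [Nat.factorial_succ]
    push_cast
    have h1 : ((n - (i : ℕ) : ℕ) : ℚ) + 1 ≠ 0 := by positivity
    have h2 := Nat.factorial_ne_zero (i : ℕ)
    have h3 := Nat.factorial_ne_zero (n - i)
    field_simp
  rw [Finset.sum_congr rfl fun σ _ => h σ, Finset.sum_comm]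
  refine Finset.sum_congr rfl fun i _ => ?_
  rw [← Finset.smul_sum, sum_perm_eq_sum_shuffles i]
  · rw [← Nat.cast_smul_eq_nsmul k, smul_smul, ← map_natCast (algebraMap ℚ k), ← map_mul,
      inv_mul_cancel₀ (by positivity), map_one, one_smul]
    rfl
  · intro σ τ
    have := insertFirst_blockPerm i (hG (n - i + 1)) (hQ i) (hQd i) (p := q ∘ σ)
      (a := fun j => w (σ j)) (fun j => hw _) τ
    rw [koszulSign_mul, mul_smul]
    refine congrArg (koszulSign q σ • ·) ?_
    refine (congrArg (koszulSign (q ∘ σ) (blockPerm i τ) • ·) this).trans ?_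
    rw [smul_smul, koszulSign_mul_self, one_smul]

end Normalization

end LInfty

/-! ### Décalage between antisymmetric and symmetric maps. -/

namespace LInfty

section Shift

variable {k : Type u} [CommRing k] {M N : Type*} [AddCommGroup M] [Module k M]
  [AddCommGroup N] [Module k N] (𝓜 : ℤ → Submodule k M) [DirectSum.Decomposition 𝓜]
  (𝓝 : ℤ → Submodule k N) [DirectSum.Decomposition 𝓝]

theorem parity_parity (a : M) : parity 𝓜 (parity 𝓜 a) = a := by
  induction a using DirectSum.Decomposition.inductionOn 𝓜 with
  | zero => simp
  | @homogeneous i a =>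
    rw [parity_of_mem 𝓜 a.2, Units.smul_def, map_zsmul, parity_of_mem 𝓜 a.2, Units.smul_def,
      smul_smul, ← Units.val_mul, Int.units_mul_self, Units.val_one, one_smul]
  | add a b ha hb => simp [ha, hb]

theorem parity_pow_of_mem {i : ℤ} {a : M} (ha : a ∈ 𝓜 i) (m : ℕ) :
    (parity 𝓜 ^ m) a = Int.negOnePow (m * i) • a := by
  induction m with
  | zero => simp
  | succ m ih =>
    rw [pow_succ', Module.End.mul_apply, ih, Units.smul_def, map_zsmul, parity_of_mem 𝓜 ha,
      ← Units.smul_def, smul_smul, ← Int.negOnePow_add]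
    congr 2
    push_cast
    ring

/-- The parity map is an involution, so the passage to the shifted maps is its own inverse and also
serves to go back. -/
theorem shiftMap_shiftMap {n : ℕ} (φ : MultilinearMap k (fun _ : Fin n => M) N) :
    shiftMap 𝓜 (shiftMap 𝓜 φ) = φ := by
  refine MultilinearMap.ext fun a => congrArg φ (funext fun i => ?_)
  have h : parity 𝓜 * parity 𝓜 = 1 := LinearMap.ext (parity_parity 𝓜)
  change (parity 𝓜 ^ _ * parity 𝓜 ^ _) (a i) = a i
  rw [← pow_add, ← two_mul, pow_mul, pow_two, h, one_pow]
  rfl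

theorem shiftMap_apply {n : ℕ} (φ : MultilinearMap k (fun _ : Fin n => M) N) {p : Fin n → ℤ}
    {a : Fin n → M} (ha : ∀ i, a i ∈ 𝓜 (p i)) : shiftMap 𝓜 φ a = shiftSign p • φ a := by
  change φ (fun i => (parity 𝓜 ^ (n - 1 - (i : ℕ))) (a i)) = _
  have : (fun i : Fin n => (parity 𝓜 ^ (n - 1 - (i : ℕ))) (a i)) = fun i : Fin n =>
      (((Int.negOnePow ((n - 1 - (i : ℕ) : ℕ) * p i) : ℤˣ) : ℤ) : k) • a i := funext fun i => by
    rw [parity_pow_of_mem 𝓜 (ha i), Units.smul_def, Int.cast_smul_eq_zsmul]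
  rw [this, MultilinearMap.map_smul_univ, ← Int.cast_prod, Int.cast_smul_eq_zsmul, ← Units.coe_prod]
  rfl

theorem unary_shiftMap (φ : MultilinearMap k (fun _ : Fin 1 => M) N) :
    unary (shiftMap 𝓜 φ) = unary φ := by
  refine LinearMap.ext fun a => congrArg φ (funext fun i => ?_)
  rw [Fin.fin_one_eq_zero i]
  rfl

theorem hasDeg_smul {A B : Type*} [AddCommGroup A] [Module k A] [AddCommGroup B] [Module k B]
    {𝒜 : Grading k A} {ℬ : Grading k B} {n : ℕ} {φ : MultilinearMap k (fun _ : Fin n => A) B}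
    {d : ℤ} (h : HasDeg 𝒜 ℬ d φ) (c : k) : HasDeg 𝒜 ℬ d (c • φ) := fun p a ha =>
  Submodule.smul_mem _ c (h p a ha)

theorem isSymm_smul {A B : Type*} [AddCommGroup A] [Module k A] [AddCommGroup B] [Module k B]
    {𝒜 : Grading k A} {n : ℕ} {φ : MultilinearMap k (fun _ : Fin n => A) B}
    (h : IsSymm 𝒜 φ) (c : k) : IsSymm 𝒜 (c • φ) := fun p a ha σ => by
  rw [_root_.smul_apply, _root_.smul_apply, h p a ha σ, smul_comm]

theorem shiftMap_smul (c : ℕ) {n : ℕ} (φ : MultilinearMap k (fun _ : Fin n => M) N) :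
    shiftMap 𝓜 (c • φ) = c • shiftMap 𝓜 φ := rfl

variable [Algebra ℚ k]

/-- The grading of `M[1]`. -/
def shiftGrading : Grading k M where
  deg i := 𝓜 (i + 1)
  even := algebraMap ℚ k 2⁻¹ • (LinearMap.id - parity 𝓜)
  even_of_even i hi a ha := by
    have h2 : a + a = (2 : k) • a := (two_smul k a).symm
    rw [LinearMap.smul_apply, LinearMap.sub_apply, parity_of_mem 𝓜 ha,
      Int.negOnePow_odd _ hi.add_one, Units.neg_smul, one_smul, sub_neg_eq_add, LinearMap.id_apply,
      h2, smul_smul, ← map_ofNat (algebraMap ℚ k) 2, ← map_mul, inv_mul_cancel₀ two_ne_zero,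
      map_one, one_smul]
  even_of_odd i hi a ha := by
    rw [LinearMap.smul_apply, LinearMap.sub_apply, parity_of_mem 𝓜 ha,
      Int.negOnePow_even _ hi.add_one, one_smul, LinearMap.id_apply, sub_self, smul_zero]

variable {𝓜 𝓝}

theorem isSymm_shiftMap {n : ℕ} {φ : MultilinearMap k (fun _ : Fin n => M) N}
    (h : ∀ (p : Fin n → ℤ) (a : Fin n → M), (∀ i, a i ∈ 𝓜 (p i)) →
      ∀ σ : Equiv.Perm (Fin n), φ (fun i => a (σ i)) = antiKoszulSign p σ • φ a) :
    IsSymm (shiftGrading 𝓜) (shiftMap 𝓜 φ) := by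
  intro q a ha σ
  have hq : koszulSign q σ = koszulSign (fun i => q i + 1 - 1) σ := by simp
  rw [shiftMap_apply 𝓜 φ (p := fun i => q i + 1) ha,
    shiftMap_apply 𝓜 φ (p := fun i => q (σ i) + 1) fun i => ha (σ i),
    h (fun i => q i + 1) a ha, hq, koszulSign_sub_one (fun i => q i + 1), smul_smul, smul_smul]
  congr 1
  change shiftSign ((fun i => q i + 1) ∘ σ) * _ = _
  rw [mul_assoc, mul_assoc, Int.units_mul_self, mul_one, mul_comm]

theorem antisymm_shiftMap {n : ℕ} {φ : MultilinearMap k (fun _ : Fin n => M) N}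
    (h : IsSymm (shiftGrading 𝓜) φ) (p : Fin n → ℤ) (a : Fin n → M) (ha : ∀ i, a i ∈ 𝓜 (p i))
    (σ : Equiv.Perm (Fin n)) :
    shiftMap 𝓜 φ (fun i => a (σ i)) = antiKoszulSign p σ • shiftMap 𝓜 φ a := by
  have := h (fun i => p i - 1) a (fun i => by
    change a i ∈ 𝓜 (p i - 1 + 1)
    rw [sub_add_cancel]
    exact ha i) σ
  rw [shiftMap_apply 𝓜 φ ha, shiftMap_apply 𝓜 φ (p := fun i => p (σ i)) fun i => ha (σ i), this,
    koszulSign_sub_one, smul_smul, smul_smul]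
  congr 1
  change shiftSign (p ∘ σ) * _ = _
  rw [mul_left_comm, ← mul_assoc (shiftSign (p ∘ σ)), Int.units_mul_self, one_mul]

end Shift

end LInfty

/-! ### Dictionary between `L_∞`-algebras and odd vector fields. -/

namespace LInftyAlgebra

open LInfty

theorem d_mem {k : Type u} [CommRing k] (L : LInftyAlgebra.{u, v} k) {i : ℤ} {a : L.carrier}
    (ha : a ∈ L.grading i) : L.d a ∈ L.grading (i + 1) := by
  have := L.μ_mem 1 (fun _ => i) (fun _ => a) fun _ => ha
  rwa [Fin.sum_univ_one, show i + 2 - ((1 : ℕ) : ℤ) = i + 1 by push_cast; ring] at this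

variable {k : Type u} [CommRing k] [Algebra ℚ k] (L : LInftyAlgebra.{u, v} k)
  {L' : LInftyAlgebra.{u, w} k}

/-- The grading of `L[1]`. -/
abbrev shifted : Grading k L.carrier := shiftGrading L.grading

theorem hasDeg_Q (n : ℕ) : HasDeg L.shifted L.shifted 1 (L.Q n) := by
  intro q a ha
  rw [Q, shiftMap_apply L.grading (L.μ n) (p := fun i => q i + 1) ha]
  refine units_smul_mem ?_ _
  have := L.μ_mem n (fun i => q i + 1) a ha
  rw [Finset.sum_add_distrib] at this
  simp only [Finset.sum_const, Finset.card_univ, Fintype.card_fin, nsmul_eq_mul, mul_one] at this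
  change _ ∈ L.grading (∑ i, q i + 1 + 1)
  convert this using 2
  ring

theorem isSymm_Q (n : ℕ) : IsSymm L.shifted (L.Q n) := isSymm_shiftMap (L.μ_antisymm n)

/-- The shuffle form of Q² = 0 on homogeneous elements becomes, after Taylor normalization, the
Koszul-signed sum over all permutations, which `ext_diag_eq_zero` transfers to points. -/
theorem isLInf : IsLInf L.shifted (taylor L.Q) := by
  refine ⟨?_, fun n => hasDeg_smul (L.hasDeg_Q n) _, fun n => isSymm_smul (L.isSymm_Q n) _,
    fun n y hy => ext_diag_eq_zero (fun q a ha => ?_) hy⟩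
  · have : L.Q 0 = 0 := by
      rw [Q, L.μ_zero]
      rfl
    rw [taylor, this, smul_zero]
  · rw [← insertionSum_eq L.isSymm_Q L.isSymm_Q L.hasDeg_Q ha]
    have := L.sq_zero n (fun i => q i + 1) a ha
    simp only [add_sub_cancel_right] at this
    exact this

theorem unary_taylor {A B : Type*} [AddCommGroup A] [Module k A] [AddCommGroup B] [Module k B]
    (Φ : MSeq k A B) : unary (taylor Φ 1) = unary (Φ 1) := by
  rw [taylor, Nat.factorial_one, Nat.cast_one, inv_one, map_one, one_smul]

theorem unary_Q : unary (taylor L.Q 1) = L.d := by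
  rw [unary_taylor]
  exact unary_shiftMap L.grading (L.μ 1)

/-- The arity one part of Q² = 0, read back from points on homogeneous elements. -/
theorem d_d (a : L.carrier) : L.d (L.d a) = 0 := by
  induction a using DirectSum.Decomposition.inductionOn L.grading with
  | zero => simp
  | @homogeneous i a =>
    have := koszul_sum_eq_zero (L.isLInf.sq 1) (fun _ => i - 1) (fun _ => a) fun _ => by
      change (a : L.carrier) ∈ L.grading (i - 1 + 1)
      rw [sub_add_cancel]
      exact a.2
    rw [Fintype.sum_subsingleton _ (1 : Equiv.Perm (Fin 1)), koszulSign_one, one_smul,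
      insSeq_one_apply _ L.isLInf.zero, unary_Q] at this
    exact this
  | add a b ha hb => simp [ha, hb]

variable {L}

namespace Hom

/-- The Taylor coefficients of the morphism of coalgebras determined by `f`. -/
def coeffs (f : L.Hom L') : MSeq k L.carrier L'.carrier :=
  taylor fun m => shiftMap L.grading (f.f m)

theorem isMor_coeffs (f : L.Hom L') :
    IsMor L.shifted L'.shifted (taylor L.Q) (taylor L'.Q) f.coeffs := by
  have hs : ∀ n, IsSymm L.shifted (shiftMap L.grading (f.f n)) := fun n =>
    isSymm_shiftMap (f.f_antisymm n)
  refine ⟨?_, fun n => hasDeg_smul (fun q a ha => ?_) _, fun n => isSymm_smul (hs n) _,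
    fun n y hy => ?_⟩
  · have : shiftMap L.grading (f.f 0) = 0 := by
      rw [f.f_zero]
      rfl
    rw [coeffs, taylor, this, smul_zero]
  · rw [shiftMap_apply L.grading (f.f n) (p := fun i => q i + 1) ha]
    refine units_smul_mem ?_ _
    have := f.f_mem n (fun i => q i + 1) a ha
    rw [Finset.sum_add_distrib] at this
    simp only [Finset.sum_const, Finset.card_univ, Fintype.card_fin, nsmul_eq_mul, mul_one] at this
    change _ ∈ L'.grading (∑ i, q i + 0 + 1)
    convert this using 2
    ring
  · refine sub_eq_zero.mp ?_
    have := ext_diag_eq_zero (𝒜 := L.shifted) (φ := compSeq (taylor L'.Q) f.coeffs n -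
      insSeq f.coeffs (taylor L.Q) n) (fun q a ha => ?_) hy
    · rw [ext_sub] at this
      exact this
    · simp only [_root_.sub_apply, smul_sub, Finset.sum_sub_distrib]
      rw [coeffs, ← insertionSum_eq hs L.isSymm_Q L.hasDeg_Q ha, ← compositionSum_eq, sub_eq_zero]
      have := f.map_codifferential n (fun i => q i + 1) a ha
      simpa using this

theorem unary_coeffs (f : L.Hom L') : unary (f.coeffs 1) = f.linear := by
  rw [coeffs, unary_taylor]
  exact unary_shiftMap L.grading (f.f 1)

/-- The `L_∞`-morphism with given Taylor coefficients. -/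
def ofIsMor {G : MSeq k L.carrier L'.carrier}
    (hG : IsMor L.shifted L'.shifted (taylor L.Q) (taylor L'.Q) G) : L.Hom L' where
  f n := n.factorial • shiftMap L.grading (G n)
  f_zero := by
    rw [hG.zero]
    exact smul_zero _
  f_mem n p a ha := by
    rw [_root_.smul_apply, shiftMap_apply L.grading (G n) ha]
    refine Submodule.smul_of_tower_mem _ _ (units_smul_mem ?_ _)
    have := hG.hasDeg n (fun i => p i - 1) a fun i => by
      change a i ∈ L.grading (p i - 1 + 1)
      rw [sub_add_cancel]
      exact ha i
    change _ ∈ L'.grading (_ + 0 + 1) at this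
    rw [Finset.sum_sub_distrib] at this
    simp only [Finset.sum_const, Finset.card_univ, Fintype.card_fin, nsmul_eq_mul, mul_one] at this
    convert this using 2
    ring
  f_antisymm n p a ha σ := by
    rw [_root_.smul_apply, _root_.smul_apply, antisymm_shiftMap (hG.isSymm n) p a ha σ, smul_comm]
  map_codifferential n p a ha := by
    have ha' : ∀ i, a i ∈ L.shifted.deg (p i - 1) := fun i => by
      change a i ∈ L.grading (p i - 1 + 1)
      rw [sub_add_cancel]
      exact ha i
    -- The factorial in the definition undoes the Taylor normalization, and shifting twice is the
    -- identity, so the morphism has coefficients `G`.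
    have e : (fun m => shiftMap L.grading (m.factorial • shiftMap L.grading (G m))) =
        fun m => m.factorial • G m := funext fun m => by
      rw [shiftMap_smul, shiftMap_shiftMap]
    have e' : taylor (fun m => m.factorial • G m) = G := funext fun m =>
      taylor_factorial G m
    have hs : ∀ m, IsSymm L.shifted (m.factorial • G m) := fun m => by
      rw [← Nat.cast_smul_eq_nsmul k]
      exact isSymm_smul (hG.isSymm m) _
    rw [e, compositionSum_eq, insertionSum_eq hs L.isSymm_Q L.hasDeg_Q ha', e', ← sub_eq_zero,
      ← Finset.sum_sub_distrib]
    have := koszul_sum_eq_zero (𝒜 := L.shifted) (φ := compSeq (taylor L'.Q) G n -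
      insSeq G (taylor L.Q) n) (fun x hx => by
        rw [ext_sub]
        exact sub_eq_zero.mpr (hG.comm n x hx)) _ a ha'
    simpa only [_root_.sub_apply, smul_sub] using this

theorem linear_ofIsMor {G : MSeq k L.carrier L'.carrier}
    (hG : IsMor L.shifted L'.shifted (taylor L.Q) (taylor L'.Q) G) :
    (ofIsMor hG).linear = unary (G 1) := by
  change unary (Nat.factorial 1 • shiftMap L.grading (G 1)) = _
  rw [Nat.factorial_one, one_smul, unary_shiftMap]

end Hom

end LInftyAlgebra

/-! ### Split complexes: quasi-isomorphisms are homotopy equivalences. -/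

namespace LInftyAlgebra

open LInfty

section Homotopy

variable {k : Type u} [CommRing k] {M N : Type*} [AddCommGroup M] [Module k M]
  [AddCommGroup N] [Module k N] (𝓜 : ℤ → Submodule k M) [DirectSum.Decomposition 𝓜]
  (𝓝 : ℤ → Submodule k N) [DirectSum.Decomposition 𝓝]

/-- The projection to the homogeneous component of degree `i`. -/
def homogeneousPart (i : ℤ) : M →ₗ[k] M :=
  (𝓜 i).subtype ∘ₗ DirectSum.component k ℤ (fun i => 𝓜 i) i ∘ₗ
    (DirectSum.decomposeLinearEquiv 𝓜).toLinearMap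

theorem homogeneousPart_mem (i : ℤ) (a : M) : homogeneousPart 𝓜 i a ∈ 𝓜 i :=
  (DirectSum.decompose 𝓜 a i).2

theorem homogeneousPart_same {i : ℤ} {a : M} (ha : a ∈ 𝓜 i) : homogeneousPart 𝓜 i a = a :=
  DirectSum.decompose_of_mem_same 𝓜 ha

theorem homogeneousPart_ne {i j : ℤ} {a : M} (ha : a ∈ 𝓜 j) (h : j ≠ i) :
    homogeneousPart 𝓜 i a = 0 :=
  DirectSum.decompose_of_mem_ne 𝓜 ha h

theorem homogeneousPart_map {T : M →ₗ[k] N} {e : ℤ} (hT : ∀ i, ∀ a ∈ 𝓜 i, T a ∈ 𝓝 (i + e))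
    (i : ℤ) (a : M) : homogeneousPart 𝓝 (i + e) (T a) = T (homogeneousPart 𝓜 i a) := by
  induction a using DirectSum.Decomposition.inductionOn 𝓜 with
  | zero => simp
  | @homogeneous j a =>
    by_cases h : j = i
    · subst h
      rw [homogeneousPart_same 𝓜 a.2, homogeneousPart_same 𝓝 (hT _ _ a.2)]
    · rw [homogeneousPart_ne 𝓜 a.2 h, map_zero,
        homogeneousPart_ne 𝓝 (hT _ _ a.2) fun h' => h (add_right_cancel h')]
  | add a b ha hb => simp [ha, hb]

end Homotopy

/-- A chain map which vanishes on homology is null homotopic if the complex is split. -/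
theorem exists_nullHomotopy {k M : Type*} [CommRing k] [AddCommGroup M] [Module k M]
    {𝓜 : ℤ → Submodule k M} {d η T : M →ₗ[k] M} (hd : ∀ i, ∀ a ∈ 𝓜 i, d a ∈ 𝓜 (i + 1))
    (hη : ∀ i, ∀ a ∈ 𝓜 i, η a ∈ 𝓜 (i - 1)) (hT : ∀ i, ∀ a ∈ 𝓜 i, T a ∈ 𝓜 i)
    (hdd : ∀ a, d (d a) = 0) (hdηd : ∀ a, d (η (d a)) = d a) (hTd : ∀ a, T (d a) = d (T a))
    (hTz : ∀ z, d z = 0 → ∃ b, T z = d b) :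
    ∃ κ : M →ₗ[k] M, (∀ i, ∀ a ∈ 𝓜 i, κ a ∈ 𝓜 (i - 1)) ∧
      ∀ a, d (κ a) + κ (d a) = T a := by
  have hdη : ∀ i, ∀ a ∈ 𝓜 i, d (η a) ∈ 𝓜 i := fun i a ha => by
    have := hd _ _ (hη i a ha)
    rwa [sub_add_cancel] at this
  have hηd : ∀ i, ∀ a ∈ 𝓜 i, η (d a) ∈ 𝓜 i := fun i a ha => by
    have := hη _ _ (hd i a ha)
    rwa [add_sub_cancel_right] at this
  -- The map 1 - ηd projects to cycles, on which T takes values in boundaries, and dη is the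
  -- identity on boundaries. The first summand thus gives T(1 - ηd) + ηTd; the second supplies the
  -- missing (Tη - ηT)d and has zero differential, as T commutes with d.
  refine ⟨η ∘ₗ T ∘ₗ (LinearMap.id - η ∘ₗ d) + (T ∘ₗ η - η ∘ₗ T) ∘ₗ d ∘ₗ η, fun i a ha => ?_,
    fun a => ?_⟩
  · exact add_mem (hη _ _ (hT _ _ (sub_mem ha (hηd _ _ ha))))
      (sub_mem (hT _ _ (hη _ _ (hdη _ _ ha))) (hη _ _ (hT _ _ (hdη _ _ ha))))
  · obtain ⟨b, hb⟩ := hTz (a - η (d a)) (by rw [map_sub, hdηd, sub_self])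
    change d (η (T (a - η (d a))) + (T (η (d (η a))) - η (T (d (η a))))) +
      (η (T (d a - η (d (d a)))) + (T (η (d (η (d a)))) - η (T (d (η (d a)))))) = T a
    rw [hdd, map_zero, sub_zero, hdηd, hb, map_add, hdηd, ← hb, map_sub d, ← hTd, hTd (η a),
      hdηd, hdηd, hTd, map_sub]
    abel

theorem Homology.mk_eq_iff {k : Type u} [CommRing k] {L : LInftyAlgebra.{u, v} k}
    (z w : LinearMap.ker L.d) :
    (Submodule.Quotient.mk z : L.Homology) = Submodule.Quotient.mk w ↔
      ∃ b, (z : L.carrier) = w + L.d b := by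
  rw [Submodule.Quotient.eq]
  constructor
  · rintro ⟨b, hb⟩
    exact ⟨b, by rw [hb]; simp⟩
  · rintro ⟨b, hb⟩
    exact ⟨b, by simp [hb]⟩

section Inverse

variable {k : Type u} [CommRing k] [Algebra ℚ k] {L : LInftyAlgebra.{u, v} k}
  {L' : LInftyAlgebra.{u, w} k}

theorem Hom.linear_mem (f : L.Hom L') {i : ℤ} {a : L.carrier} (ha : a ∈ L.grading i) :
    f.linear a ∈ L'.grading i := by
  have := f.f_mem 1 (fun _ => i) (fun _ => a) fun _ => ha
  rwa [Fin.sum_univ_one, show i + 1 - ((1 : ℕ) : ℤ) = i by push_cast; ring] at this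

theorem Hom.homologyMap_mk (f : L.Hom L') (z : LinearMap.ker L.d) :
    f.homologyMap (Submodule.Quotient.mk z) = Submodule.Quotient.mk ⟨f.linear z, by
      rw [LinearMap.mem_ker, f.d_linear, LinearMap.mem_ker.mp z.2, map_zero]⟩ := rfl

/-- A quasi-isomorphism of split complexes is a homotopy equivalence. -/
theorem Hom.exists_linear_inverse (f : L.Hom L') (hf : f.IsQuasiIso) (hL : L.IsSplit)
    (hL' : L'.IsSplit) : ∃ (g : L'.carrier →ₗ[k] L.carrier) (κ : L.carrier →ₗ[k] L.carrier)
      (κ' : L'.carrier →ₗ[k] L'.carrier),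
      (∀ i, ∀ b ∈ L'.grading i, g b ∈ L.grading i) ∧
      (∀ i, ∀ a ∈ L.grading i, κ a ∈ L.grading (i - 1)) ∧
      (∀ i, ∀ b ∈ L'.grading i, κ' b ∈ L'.grading (i - 1)) ∧
      (∀ b, g (L'.d b) = L.d (g b)) ∧
      (∀ a, L.d (κ a) + κ (L.d a) = a - g (f.linear a)) ∧
      ∀ b, L'.d (κ' b) + κ' (L'.d b) = b - f.linear (g b) := by
  obtain ⟨η, hη, hdηd⟩ := hL
  obtain ⟨η', hη', hdηd'⟩ := hL'
  replace hdηd : ∀ a, L.d (η (L.d a)) = L.d a := LinearMap.congr_fun hdηd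
  replace hdηd' : ∀ a, L'.d (η' (L'.d a)) = L'.d a := LinearMap.congr_fun hdηd'
  let e : L.Homology ≃ₗ[k] L'.Homology := LinearEquiv.ofBijective f.homologyMap hf
  -- The splittings connect complexes with their homology: 1 - η'd' projects L' to cycles, and 1 -
  -- dη kills boundaries, hence lifts homology classes to cycles of L. The map g passes through
  -- homology, and so dg = 0 = gd'.
  let σ : L'.carrier →ₗ[k] L'.Homology := Submodule.mkQ _ ∘ₗ
    LinearMap.codRestrict (LinearMap.ker L'.d) (LinearMap.id - η' ∘ₗ L'.d) fun a => by
      rw [LinearMap.mem_ker]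
      change L'.d (a - η' (L'.d a)) = 0
      rw [map_sub, hdηd', sub_self]
  let j : L.Homology →ₗ[k] L.carrier := Submodule.liftQ _
    ((LinearMap.id - L.d ∘ₗ η) ∘ₗ (LinearMap.ker L.d).subtype) (by
      rintro ⟨a, ha⟩ ⟨b, hb⟩
      change L.d b = a at hb
      rw [LinearMap.mem_ker]
      change a - L.d (η a) = 0
      rw [← hb, hdηd, sub_self])
  let g : L'.carrier →ₗ[k] L.carrier := j ∘ₗ e.symm.toLinearMap ∘ₗ σ
  have hg : ∀ a z b', L.d z = 0 → f.linear z = a - η' (L'.d a) + L'.d b' →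
      g a = z - L.d (η z) := fun a z b' hz h => by
    have h1 : e (Submodule.Quotient.mk ⟨z, hz⟩) = σ a :=
      (Homology.mk_eq_iff (L := L') _ _).mpr ⟨b', h⟩
    change j (e.symm (σ a)) = _
    rw [← h1, LinearEquiv.symm_apply_apply]
    rfl
  have hs : ∀ a, ∃ z b', L.d z = 0 ∧ f.linear z = a - η' (L'.d a) + L'.d b' := fun a => by
    obtain ⟨x, hx⟩ := hf.2 (σ a)
    obtain ⟨⟨z, hz⟩, rfl⟩ := Submodule.Quotient.mk_surjective _ x
    rw [f.homologyMap_mk] at hx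
    obtain ⟨b', hb'⟩ := (Homology.mk_eq_iff (L := L') _ _).mp hx
    exact ⟨z, b', hz, hb'⟩
  have hdg : ∀ a, L.d (g a) = 0 := fun a => by
    obtain ⟨z, b', hz, h⟩ := hs a
    rw [hg a z b' hz h, map_sub, hz, d_d, sub_zero]
  have hgd : ∀ a, g (L'.d a) = 0 := fun a => by
    rw [hg (L'.d a) 0 (-a) (map_zero _) (by simp [L'.d_d])]
    simp
  -- The inverse on homology is not known to be graded, so a cycle z representing the preimage may
  -- be inhomogeneous. Its component of degree i, together with the component of b' of degree i - 1,
  -- represents the same class.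
  have hgm : ∀ i, ∀ a ∈ L'.grading i, g a ∈ L.grading i := fun i a ha => by
    obtain ⟨z, b', hz, h⟩ := hs a
    have hd : ∀ i, ∀ a ∈ L.grading i, L.d a ∈ L.grading (i + 1) := fun i a ha => L.d_mem ha
    have hd' : ∀ i, ∀ a ∈ L'.grading i, L'.d a ∈ L'.grading (i + 1) := fun i a ha => L'.d_mem ha
    have hm : a - η' (L'.d a) ∈ L'.grading i := by
      have := hη' _ _ (L'.d_mem ha)
      rw [add_sub_cancel_right] at this
      exact sub_mem ha this
    have h1 := homogeneousPart_map L.grading L'.grading (T := f.linear) (e := 0)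
      (fun i a ha => by rw [add_zero]; exact f.linear_mem ha) i z
    have h2 := homogeneousPart_map L'.grading L'.grading hd' (i - 1) b'
    have h3 := homogeneousPart_map L.grading L.grading hd i z
    rw [add_zero, h, map_add, homogeneousPart_same _ hm] at h1
    rw [sub_add_cancel] at h2
    rw [hz, map_zero] at h3
    rw [hg a _ _ h3.symm (by rw [← h1, h2])]
    have hzi := homogeneousPart_mem L.grading i z
    have := hd _ _ (hη _ _ hzi)
    rw [sub_add_cancel] at this
    exact sub_mem hzi this
  obtain ⟨κ, hκ, hκ'⟩ := exists_nullHomotopy (𝓜 := L.grading) (d := L.d) (η := η)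
    (T := LinearMap.id - g ∘ₗ f.linear) (fun i a ha => L.d_mem ha) hη
    (fun i a ha => sub_mem ha (hgm _ _ (f.linear_mem ha))) L.d_d hdηd (fun a => by
      change L.d a - g (f.linear (L.d a)) = L.d (a - g (f.linear a))
      rw [map_sub, hdg, ← f.d_linear, hgd]) fun z hz => ⟨η z, by
      change z - g (f.linear z) = _
      rw [hg _ z 0 hz (by simp [f.d_linear, hz]), sub_sub_cancel]⟩
  obtain ⟨κ₂, hκ₂, hκ₂'⟩ := exists_nullHomotopy (𝓜 := L'.grading) (d := L'.d) (η := η')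
    (T := LinearMap.id - f.linear ∘ₗ g) (fun i a ha => L'.d_mem ha) hη'
    (fun i a ha => sub_mem ha (f.linear_mem (hgm _ _ ha))) L'.d_d hdηd' (fun a => by
      change L'.d a - f.linear (g (L'.d a)) = L'.d (a - f.linear (g a))
      rw [map_sub, hgd, f.d_linear, hdg, map_zero]) fun a ha => by
      obtain ⟨z, b', hz, h⟩ := hs a
      refine ⟨f.linear (η z) - b', ?_⟩
      change a - f.linear (g a) = _
      rw [hg a z b' hz h, map_sub, h, ha, map_zero, map_sub, f.d_linear]
      abel
  exact ⟨g, κ, κ₂, hgm, hκ, hκ₂, fun b => by rw [hgd, hdg], hκ', hκ₂'⟩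

/-- A quasi-isomorphism of split `L_∞`-algebras has an inverse on homology. -/
theorem Hom.exists_inverse (f : L.Hom L') (hf : f.IsQuasiIso) (hL : L.IsSplit)
    (hL' : L'.IsSplit) : ∃ g : L'.Hom L, g.homologyMap ∘ₗ f.homologyMap = LinearMap.id ∧
      f.homologyMap ∘ₗ g.homologyMap = LinearMap.id := by
  obtain ⟨g, κ, κ', hg, hκ, hκ', hgd, h1, h2⟩ := f.exists_linear_inverse hf hL hL'
  have hshift : ∀ i : ℤ, i + 1 - 1 = i - 1 + 1 := fun i => by ring
  obtain ⟨G, hG, hG1⟩ := LInfty.exists_inverse L.isLInf L'.isLInf f.isMor_coeffs (g := g) (κ := κ)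
    (κ' := κ') (fun i b hb => hg _ b hb)
    (fun i a ha => by
      have := hκ _ a ha
      rwa [hshift] at this)
    (fun i b hb => by
      have := hκ' _ b hb
      rwa [hshift] at this)
    (fun a => by rw [unary_Q, d_d]) (fun b => by rw [unary_Q, unary_Q, hgd])
    (fun a => by rw [unary_Q, unary_Q, f.unary_coeffs, f.d_linear])
    (fun a => by rw [unary_Q, f.unary_coeffs, h1]) (fun b => by rw [unary_Q, f.unary_coeffs, h2])
  have hl : (ofIsMor hG).linear = g := (linear_ofIsMor hG).trans hG1
  refine ⟨ofIsMor hG, LinearMap.ext fun x => ?_, LinearMap.ext fun x => ?_⟩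
  · obtain ⟨z, rfl⟩ := Submodule.Quotient.mk_surjective _ x
    rw [LinearMap.comp_apply, f.homologyMap_mk, homologyMap_mk]
    refine (Homology.mk_eq_iff _ _).mpr ⟨-κ z, ?_⟩
    have := h1 z
    rw [LinearMap.mem_ker.mp z.2, map_zero, add_zero] at this
    change (ofIsMor hG).linear (f.linear z) = z + _
    rw [hl, map_neg, this]
    abel
  · obtain ⟨z, rfl⟩ := Submodule.Quotient.mk_surjective _ x
    rw [LinearMap.comp_apply, homologyMap_mk, f.homologyMap_mk]
    refine (Homology.mk_eq_iff (L := L') _ _).mpr ⟨-κ' z, ?_⟩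
    have := h2 z
    rw [LinearMap.mem_ker.mp z.2, map_zero, add_zero] at this
    change f.linear ((ofIsMor hG).linear z) = z + _
    rw [hl, map_neg, this]
    abel

end Inverse

/-! ### Identity and composition, and splittings over a field. -/

section Category

variable {k : Type u} [CommRing k] [Algebra ℚ k]

theorem exists_id (L : LInftyAlgebra.{u, v} k) : ∃ f : L.Hom L, f.IsQuasiIso := by
  have h : IsMor L.shifted L.shifted (taylor L.Q) (taylor L.Q) (idSeq k L.carrier) :=
    IsMor.of_ev L.isLInf L.isLInf.zero rfl
      (hasDeg_linSeq fun i a ha => by rw [add_zero]; exact ha) (isSymm_linSeq _ _)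
      fun N hN p y hy => by rw [ev_idSeq hN, ev_idSeq hN]
  refine ⟨Hom.ofIsMor h, ?_⟩
  have : (Hom.ofIsMor h).homologyMap = LinearMap.id := LinearMap.ext fun x => by
    obtain ⟨z, rfl⟩ := Submodule.Quotient.mk_surjective _ x
    rw [Hom.homologyMap_mk]
    refine (Homology.mk_eq_iff _ _).mpr ⟨0, ?_⟩
    change (Hom.ofIsMor h).linear z = z + _
    rw [Hom.linear_ofIsMor, unary_linSeq, map_zero, add_zero, LinearMap.id_apply]
  rw [Hom.IsQuasiIso, this]
  exact Function.bijective_id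

theorem exists_comp {L L' L'' : LInftyAlgebra.{u, v} k} {f : L.Hom L'} {g : L'.Hom L''}
    (hf : f.IsQuasiIso) (hg : g.IsQuasiIso) : ∃ h : L.Hom L'', h.IsQuasiIso := by
  have h := IsMor.comp L.isLInf L'.isLInf g.isMor_coeffs f.isMor_coeffs
  refine ⟨Hom.ofIsMor h, ?_⟩
  have : (Hom.ofIsMor h).homologyMap = g.homologyMap ∘ₗ f.homologyMap := LinearMap.ext fun x => by
    obtain ⟨z, rfl⟩ := Submodule.Quotient.mk_surjective _ x
    rw [Hom.homologyMap_mk, LinearMap.comp_apply, Hom.homologyMap_mk, Hom.homologyMap_mk]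
    refine (Homology.mk_eq_iff _ _).mpr ⟨0, ?_⟩
    change (Hom.ofIsMor h).linear z = g.linear (f.linear z) + _
    rw [Hom.linear_ofIsMor, unary_comp, f.unary_coeffs, g.unary_coeffs, map_zero, add_zero,
      LinearMap.comp_apply]
  rw [Hom.IsQuasiIso, this]
  exact hg.comp hf

end Category

section Field

/-- Over a field the surjection onto the range has a section, which extends from the range to the
whole space. -/
theorem exists_generalizedInverse {k : Type u} [CommRing k] (hk : IsField k) {V W : Type*}
    [AddCommGroup V] [Module k V] [AddCommGroup W] [Module k W] (f : V →ₗ[k] W) :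
    ∃ h : W →ₗ[k] V, ∀ a, f (h (f a)) = f a := by
  let := hk.toField
  obtain ⟨s, hs⟩ := f.rangeRestrict.exists_rightInverse_of_surjective f.range_rangeRestrict
  obtain ⟨h, hh⟩ := LinearMap.exists_extend s
  refine ⟨h, fun a => ?_⟩
  have h1 : h (f a) = s (f.rangeRestrict a) := LinearMap.congr_fun hh (f.rangeRestrict a)
  rw [h1]
  exact congrArg Subtype.val (LinearMap.congr_fun hs (f.rangeRestrict a))

/-- Generalized inverses are chosen separately for each graded piece of d, which makes the assembled
map homogeneous of degree -1. -/
theorem isSplit_of_isField {k : Type u} [CommRing k] [Algebra ℚ k] (hk : IsField k)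
    (L : LInftyAlgebra.{u, v} k) : L.IsSplit := by
  have hd : ∀ i, ∀ a ∈ L.grading (i - 1), L.d a ∈ L.grading i := fun i a ha => by
    have := L.d_mem ha
    rwa [sub_add_cancel] at this
  choose h hh using fun i => exists_generalizedInverse hk (L.d.restrict (hd i))
  let η : L.carrier →ₗ[k] L.carrier :=
    (DirectSum.toModule k ℤ L.carrier fun i => (L.grading (i - 1)).subtype ∘ₗ h i) ∘ₗ
      (DirectSum.decomposeLinearEquiv L.grading).toLinearMap
  have hη : ∀ i a (ha : a ∈ L.grading i), η a = h i ⟨a, ha⟩ := fun i a ha => by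
    have : DirectSum.decomposeLinearEquiv L.grading a =
        DirectSum.lof k ℤ (fun i => L.grading i) i ⟨a, ha⟩ := by
      rw [DirectSum.decomposeLinearEquiv_apply, DirectSum.decompose_of_mem _ ha,
        DirectSum.lof_eq_of]
    simp only [η, LinearMap.comp_apply, LinearEquiv.coe_coe, this, DirectSum.toModule_lof]
    rfl
  refine ⟨η, fun i a ha => ?_, LinearMap.ext fun a => ?_⟩
  · rw [hη i a ha]
    exact (h i _).2
  · rw [LinearMap.comp_apply, LinearMap.comp_apply]
    induction a using DirectSum.Decomposition.inductionOn L.grading with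
    | zero => simp
    | @homogeneous j a =>
      have ha : (a : L.carrier) ∈ L.grading (j + 1 - 1) := by
        rw [add_sub_cancel_right]
        exact a.2
      rw [hη (j + 1) _ (L.d_mem a.2)]
      exact congrArg Subtype.val (hh (j + 1) ⟨a, ha⟩)
    | add a b ha hb => simp only [map_add, ha, hb]

end Field

end LInftyAlgebra

end

theorem mainTheorem7 {k : Type u} [CommRing k] [Algebra ℚ k] :
    (∀ (L : LInftyAlgebra.{u, v} k) (L' : LInftyAlgebra.{u, w} k), L.IsSplit → L'.IsSplit →
      ∀ f : L.Hom L', f.IsQuasiIso →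
        ∃ g : L'.Hom L,
          g.homologyMap ∘ₗ f.homologyMap = LinearMap.id ∧
          f.homologyMap ∘ₗ g.homologyMap = LinearMap.id) ∧
    (IsField k →
      Equivalence fun L L' : LInftyAlgebra.{u, v} k => ∃ f : L.Hom L', f.IsQuasiIso) := by
  refine ⟨fun L L' hL hL' f hf => f.exists_inverse hf hL hL', fun hk => ⟨fun L => L.exists_id,
    ?_, ?_⟩⟩
  · rintro L L' ⟨f, hf⟩
    obtain ⟨g, h1, h2⟩ := f.exists_inverse hf (LInftyAlgebra.isSplit_of_isField hk L)
      (LInftyAlgebra.isSplit_of_isField hk L')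
    exact ⟨g, Function.bijective_iff_has_inverse.mpr
      ⟨f.homologyMap, LinearMap.congr_fun h2, LinearMap.congr_fun h1⟩⟩
  · rintro L L' L'' ⟨f, hf⟩ ⟨g, hg⟩
    exact LInftyAlgebra.exists_comp hf hg
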